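/- Let $A_1,A_2$ be C*-algebras (not necessarily unital, separable, or nuclear), let $\beta$ be a C*-norm on the algebraic tensor product $A_1\odot A_2$, and let $C:=A_1\otimes_\beta A_2$ be the completion of $A_1\odot A_2$ in $\beta$. For a C*-algebra $A$ let $K(A)$ denote its Pedersen ideal, that is, the smallest dense two-sided ideal of $A$, and let $K(A)_+$ be the set of its positive elements. Let $LTC(A)$ be the cone of lower semicontinuous densely finite traces on $A$, that is, of the lower semicontinuous maps $\tau\colon A_+\to[0,\infty]$ that are additive, positively homogeneous, satisfy $\tau(x^*x)=\tau(xx^*)$ for all $x\in A$, and for which $\{a\in A_+:\tau(a)<\infty\}$ is dense in $A_+$. Such traces are finite on $K(A)_+$, and $LTC(A)$ carries the weak topology $\sigma(LTC(A),K(A))$, that is, the topology of pointwise convergence on $K(A)_+$. Let $LTC(A_1)\odot LTC(A_2)$ be the cone of all finite sums $\sum_i\tau_1^{(i)}\otimes\tau_2^{(i)}$ with $\tau_1^{(i)}\in LTC(A_1)$ and $\tau_2^{(i)}\in LTC(A_2)$, regarded as functionals on $K(A_1)\odot K(A_2)$. Then every $f\in LTC(A_1)\odot LTC(A_2)$ extends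 to $C$ in a unique way: there is exactly one $\tau\in LTC(C)$ such that $\tau(a\otimes b)=f(a\otimes b)$ for all $a\in K(A_1)_+$ and $b\in K(A_2)_+$. Let $LTC(A_1)\otimes_\beta LTC(A_2)$ be the closure of $LTC(A_1)\odot LTC(A_2)$, regarded by means of this extension as a set of functionals $K(C)_+\to[0,\infty)$, in the topology of pointwise convergence on $K(C)_+$. Then every element $\varphi$ of $LTC(A_1)\otimes_\beta LTC(A_2)$ is the restriction to $K(C)_+$ of a unique trace $\mathcal T(\varphi)\in LTC(C)$, and the map $\mathcal T$ so defined is an additive and positively homogeneous homeomorphism from $LTC(A_1)\otimes_\beta LTC(A_2)$ onto $LTC(C)$. -/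

import Mathlib

open scoped NNReal ENNReal TensorProduct

noncomputable section

namespace TracialCone

section Traces

variable (A : Type*) [NonUnitalCStarAlgebra A] [PartialOrder A] [StarOrderedRing A]

/-- The positive cone `A₊` of a C*-algebra. -/
abbrev Pos : Type _ := {a : A // 0 ≤ a}

variable {A}

/-- The element `t a` of `A₊`, for a real number `t ≥ 0` and `a ∈ A₊`. -/
def Pos.scale (t : ℝ≥0) (a : Pos A) : Pos A := ⟨(t : ℝ) • (a : A), smul_nonneg t.2 a.2⟩

/-- The element `x* x` of `A₊`. -/
def Pos.starMul (x : A) : Pos A := ⟨star x * x, star_mul_self_nonneg x⟩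

/-- A trace on `A₊`, with values in `[0, ∞]`. The convention `0 * ∞ = 0` is in force, so that
`τ 0 = 0`. -/
structure IsTrace (τ : Pos A → ℝ≥0∞) : Prop where
  add : ∀ a b : Pos A, τ (a + b) = τ a + τ b
  scale : ∀ (t : ℝ≥0) (a : Pos A), τ (a.scale t) = t * τ a
  tracial : ∀ x : A, τ (Pos.starMul x) = τ (Pos.starMul (star x))

/-- A trace is densely finite if the positive elements of finite trace are dense in `A₊`. -/
def DenselyFinite (τ : Pos A → ℝ≥0∞) : Prop := Dense {a : Pos A | τ a < ∞}

theorem IsTrace.mono {τ : Pos A → ℝ≥0∞} (hτ : IsTrace τ) {a b : Pos A} (h : (a : A) ≤ b) :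
    τ a ≤ τ b := by
  have : b = a + ⟨(b : A) - a, sub_nonneg.2 h⟩ := Subtype.ext (by simp)
  rw [this, hτ.add]
  exact le_self_add

theorem IsTrace.zero {τ : Pos A → ℝ≥0∞} (hτ : IsTrace τ) : τ 0 = 0 := by
  have h : Pos.scale 0 (0 : Pos A) = 0 := Subtype.ext (by simp [Pos.scale])
  simpa [h] using hτ.scale 0 0

/-- `τ (z* y z) ≤ ‖y‖ τ (z* z)`. -/
theorem IsTrace.conj_le {τ : Pos A → ℝ≥0∞} (hτ : IsTrace τ) (y : Pos A) (z : A) (w : Pos A)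
    (hw : (w : A) = star z * y * z) : τ w ≤ ‖(y : A)‖₊ * τ (Pos.starMul z) := by
  rw [← hτ.scale]
  refine hτ.mono ?_
  rw [hw]
  exact CStarAlgebra.star_left_conjugate_le_norm_smul (IsSelfAdjoint.of_nonneg y.2)

theorem IsTrace.sq_lt_top {τ : Pos A → ℝ≥0∞} (hτ : IsTrace τ) {y : Pos A} (hy : τ y < ∞) :
    τ (Pos.starMul (y : A)) < ∞ := by
  have hs : IsSelfAdjoint (CFC.sqrt (y : A)) := IsSelfAdjoint.of_nonneg (CFC.sqrt_nonneg _)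
  have hy' : IsSelfAdjoint (y : A) := IsSelfAdjoint.of_nonneg y.2
  have hq : CFC.sqrt (y : A) * CFC.sqrt (y : A) = y := CFC.sqrt_mul_sqrt_self _ y.2
  have h1 : Pos.starMul (CFC.sqrt (y : A)) = y :=
    Subtype.ext (by simp [Pos.starMul, hs.star_eq, hq])
  refine (hτ.conj_le y (CFC.sqrt (y : A)) _ ?_).trans_lt ?_
  · simp only [Pos.starMul, hs.star_eq, hy'.star_eq]
    calc (y : A) * y
        = CFC.sqrt (y : A) * CFC.sqrt (y : A) * (CFC.sqrt (y : A) * CFC.sqrt (y : A)) := by rw [hq]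
      _ = CFC.sqrt (y : A) * (CFC.sqrt (y : A) * CFC.sqrt (y : A)) * CFC.sqrt (y : A) := by
        simp only [mul_assoc]
      _ = CFC.sqrt (y : A) * y * CFC.sqrt (y : A) := by rw [hq]
  · rw [h1]
    exact ENNReal.mul_lt_top ENNReal.coe_lt_top hy

/-- `τ (y z y) < ∞` whenever `τ y < ∞` or `τ z < ∞`. -/
theorem IsTrace.triple_lt_top {τ : Pos A → ℝ≥0∞} (hτ : IsTrace τ) {y z w : Pos A}
    (hw : (w : A) = y * z * y) (h : τ y < ∞ ∨ τ z < ∞) : τ w < ∞ := by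
  have hy' : IsSelfAdjoint (y : A) := IsSelfAdjoint.of_nonneg y.2
  rcases h with h | h
  · refine (hτ.conj_le z (y : A) w (by rw [hw, hy'.star_eq])).trans_lt ?_
    exact ENNReal.mul_lt_top ENNReal.coe_lt_top (hτ.sq_lt_top h)
  · have hs : IsSelfAdjoint (CFC.sqrt (z : A)) := IsSelfAdjoint.of_nonneg (CFC.sqrt_nonneg _)
    have hq : CFC.sqrt (z : A) * CFC.sqrt (z : A) = z := CFC.sqrt_mul_sqrt_self _ z.2
    have h1 : Pos.starMul (CFC.sqrt (z : A)) = z :=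
      Subtype.ext (by simp [Pos.starMul, hs.star_eq, hq])
    have h2 : w = Pos.starMul (CFC.sqrt (z : A) * y) := Subtype.ext (by
      simp only [Pos.starMul, star_mul, hs.star_eq, hy'.star_eq, hw]
      conv_lhs => rw [← hq]
      simp only [mul_assoc])
    rw [h2, hτ.tracial]
    refine (hτ.conj_le (Pos.starMul (y : A)) (CFC.sqrt (z : A)) _ ?_).trans_lt ?_
    · simp only [Pos.starMul, star_mul, hs.star_eq, hy'.star_eq, mul_assoc]
    · rw [h1]
      exact ENNReal.mul_lt_top ENNReal.coe_lt_top h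

theorem DenselyFinite.add {τ σ : Pos A → ℝ≥0∞} (hτ : IsTrace τ) (hσ : IsTrace σ)
    (dτ : DenselyFinite τ) (dσ : DenselyFinite σ) : DenselyFinite (τ + σ) := by
  let f : Pos A × Pos A → Pos A := fun p =>
    ⟨p.1 * p.2 * p.1, conjugate_nonneg_of_nonneg p.2.2 p.1.2⟩
  have hf : Continuous f := by
    refine Continuous.subtype_mk ?_ _
    fun_prop
  have hs : Function.Surjective f := by
    intro x
    refine ⟨(⟨(x : A) ^ ((3 : ℝ≥0)⁻¹), CFC.nnrpow_nonneg⟩,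
      ⟨(x : A) ^ ((3 : ℝ≥0)⁻¹), CFC.nnrpow_nonneg⟩), Subtype.ext ?_⟩
    change (x : A) ^ ((3 : ℝ≥0)⁻¹) * (x : A) ^ ((3 : ℝ≥0)⁻¹) * (x : A) ^ ((3 : ℝ≥0)⁻¹) = x
    rw [← CFC.nnrpow_three _ CFC.nnrpow_nonneg, CFC.nnrpow_inv_nnrpow _ (by norm_num) x.2]
  refine (hs.denseRange.dense_image hf (dτ.prod dσ)).mono ?_
  rintro _ ⟨p, hp, rfl⟩
  exact ENNReal.add_lt_top.2
    ⟨hτ.triple_lt_top rfl (Or.inl hp.1), hσ.triple_lt_top rfl (Or.inr hp.2)⟩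

variable (A)

/-- The lower semicontinuous densely finite traces, as a convex cone of functions on `A₊`. -/
def ltcCone : Submodule ℝ≥0 (Pos A → ℝ≥0∞) where
  carrier := {τ | IsTrace τ ∧ LowerSemicontinuous τ ∧ DenselyFinite τ}
  zero_mem' := by
    refine ⟨⟨by simp, by simp, by simp⟩, lowerSemicontinuous_const, ?_⟩
    simp [DenselyFinite]
  add_mem' := by
    rintro τ σ ⟨h1, h2, h3⟩ ⟨k1, k2, k3⟩
    refine ⟨⟨fun a b => ?_, fun t a => ?_, fun x => ?_⟩, h2.add k2, h3.add h1 k1 k3⟩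
    · simp only [Pi.add_apply, h1.add, k1.add]
      exact add_add_add_comm _ _ _ _
    · simp only [Pi.add_apply, h1.scale, k1.scale, mul_add]
    · simp only [Pi.add_apply, h1.tracial x, k1.tracial x]
  smul_mem' := by
    rintro c τ ⟨h1, h2, h3⟩
    have hc : ∀ a, (c • τ) a = c * τ a := fun a => rfl
    refine ⟨⟨fun a b => ?_, fun t a => ?_, fun x => ?_⟩, ?_, ?_⟩
    · simp only [hc, h1.add, mul_add]
    · simp only [hc, h1.scale, mul_left_comm]
    · simp only [hc, h1.tracial x]
    · have : (c • τ) = (fun y : ℝ≥0∞ => c * y) ∘ τ := rfl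
      rw [this]
      exact (ENNReal.continuous_const_mul ENNReal.coe_ne_top).comp_lowerSemicontinuous h2
        (fun a b h => by dsimp only; gcongr)
    · refine Dense.mono (fun a ha => ?_) h3
      exact ENNReal.mul_lt_top ENNReal.coe_lt_top ha

/-- `LTC(A)`: the cone of densely finite lower semicontinuous traces on `A`. -/
def LTC : Type _ := ltcCone A

namespace LTC

instance : AddCommMonoid (LTC A) := inferInstanceAs (AddCommMonoid (ltcCone A))

instance : Module ℝ≥0 (LTC A) := inferInstanceAs (Module ℝ≥0 (ltcCone A))

instance : CoeFun (LTC A) (fun _ => Pos A → ℝ≥0∞) := ⟨fun τ => Subtype.val τ⟩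

end LTC

/-- The Pedersen ideal `K(A)`: the smallest dense two-sided ideal of `A`, that is, the
intersection of all dense two-sided ideals of `A`. -/
def pedersenIdeal : Submodule ℂ A :=
  sInf {I : Submodule ℂ A | Dense (I : Set A) ∧ ∀ x ∈ I, ∀ a : A, a * x ∈ I ∧ x * a ∈ I}

/-- The positive part `K(A)₊` of the Pedersen ideal. -/
def PedPos : Type _ := {a : Pos A // (a : A) ∈ pedersenIdeal A}

variable {A}

/-- The elements `x` with `τ (x* x) < ∞` form a dense two-sided ideal. -/
theorem exists_sqIdeal {τ : Pos A → ℝ≥0∞} (hτ : IsTrace τ) (dτ : DenselyFinite τ) :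
    ∃ N : Submodule ℂ A, (∀ x, x ∈ N ↔ τ (Pos.starMul x) < ∞) ∧ Dense (N : Set A) ∧
      ∀ x ∈ N, ∀ a : A, a * x ∈ N ∧ x * a ∈ N := by
  let N : Submodule ℂ A :=
    { carrier := {x | τ (Pos.starMul x) < ∞}
      zero_mem' := by
        have : Pos.starMul (0 : A) = 0 := Subtype.ext (by simp [Pos.starMul])
        simp [this, hτ.zero]
      add_mem' := by
        intro x y hx hy
        have h : τ (Pos.starMul (x + y)) ≤
            τ ((Pos.starMul x + Pos.starMul x) + (Pos.starMul y + Pos.starMul y)) := by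
          refine hτ.mono ?_
          change star (x + y) * (x + y) ≤
            (star x * x + star x * x) + (star y * y + star y * y)
          have h0 := star_mul_self_nonneg (x - y)
          rw [← sub_nonneg]
          convert h0 using 1
          simp only [star_add, star_sub]
          noncomm_ring
        refine h.trans_lt ?_
        simp only [hτ.add]
        exact ENNReal.add_lt_top.2
          ⟨ENNReal.add_lt_top.2 ⟨hx, hx⟩, ENNReal.add_lt_top.2 ⟨hy, hy⟩⟩
      smul_mem' := by
        intro c x hx
        have h : Pos.starMul (c • x) = (Pos.starMul x).scale (‖c‖₊ ^ 2) := by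
          refine Subtype.ext ?_
          simp only [Pos.starMul, Pos.scale, star_smul, smul_mul_assoc, mul_smul_comm, smul_smul]
          rw [← Complex.coe_smul]
          congr 1
          simp [Complex.mul_conj']
        change τ (Pos.starMul (c • x)) < ∞
        rw [h, hτ.scale]
        exact ENNReal.mul_lt_top ENNReal.coe_lt_top hx }
  have hN : ∀ x, x ∈ N ↔ τ (Pos.starMul x) < ∞ := fun x => Iff.rfl
  have hstar : ∀ x ∈ N, star x ∈ N := fun x hx => by
    rw [hN] at hx ⊢
    rwa [← hτ.tracial]
  have hleft : ∀ x ∈ N, ∀ a : A, a * x ∈ N := fun x hx a => by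
    rw [hN] at hx ⊢
    refine (hτ.conj_le (Pos.starMul a) x _ ?_).trans_lt
      (ENNReal.mul_lt_top ENNReal.coe_lt_top hx)
    simp [Pos.starMul, mul_assoc]
  refine ⟨N, hN, ?_, fun x hx a => ⟨hleft x hx a, ?_⟩⟩
  · have hcl : N.topologicalClosure = ⊤ := by
      rw [eq_top_iff, ← CStarAlgebra.span_nonneg, Submodule.span_le]
      intro a ha
      have h1 : (⟨a, ha⟩ : Pos A) ∈ closure {a : Pos A | τ a < ∞} := dτ _
      have h2 := image_closure_subset_closure_image continuous_subtype_val
        (Set.mem_image_of_mem Subtype.val h1)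
      refine closure_mono ?_ h2
      rintro _ ⟨y, hy, rfl⟩
      exact hτ.sq_lt_top hy
    exact Submodule.dense_iff_topologicalClosure_eq_top.2 hcl
  · simpa using hstar _ (hleft _ (hstar x hx) (star a))

/-- Densely finite traces are finite on the positive part of the Pedersen ideal. -/
theorem IsTrace.lt_top_of_mem_pedersenIdeal {τ : Pos A → ℝ≥0∞} (hτ : IsTrace τ)
    (dτ : DenselyFinite τ) (x : PedPos A) : τ x.1 < ∞ := by
  obtain ⟨N, hN, hd, hi⟩ := exists_sqIdeal hτ dτ
  have hstar : ∀ x ∈ N, star x ∈ N := fun x hx => by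
    rw [hN] at hx ⊢
    rwa [← hτ.tracial]
  let J : Submodule ℂ A := Submodule.span ℂ {z | ∃ x ∈ N, ∃ y ∈ N, z = x * y}
  have hJd : Dense (J : Set A) := by
    have hcl : J.topologicalClosure = ⊤ := by
      rw [eq_top_iff, ← CStarAlgebra.span_nonneg, Submodule.span_le]
      intro a ha
      have h1 : (CFC.sqrt a, CFC.sqrt a) ∈ closure ((N : Set A) ×ˢ (N : Set A)) :=
        (hd.prod hd) _
      have h2 := image_closure_subset_closure_image
        (continuous_mul (M := A)) (Set.mem_image_of_mem _ h1)
      have h3 : CFC.sqrt a * CFC.sqrt a = a := CFC.sqrt_mul_sqrt_self a ha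
      simp only [h3] at h2
      refine closure_mono ?_ h2
      rintro _ ⟨p, hp, rfl⟩
      exact Submodule.subset_span ⟨p.1, hp.1, p.2, hp.2, rfl⟩
    exact Submodule.dense_iff_topologicalClosure_eq_top.2 hcl
  have hJi : ∀ x ∈ J, ∀ a : A, a * x ∈ J ∧ x * a ∈ J := by
    intro x hx a
    induction hx using Submodule.span_induction with
    | mem x h =>
      obtain ⟨u, hu, v, hv, rfl⟩ := h
      exact ⟨Submodule.subset_span ⟨a * u, (hi u hu a).1, v, hv, (mul_assoc _ _ _).symm⟩,
        Submodule.subset_span ⟨u, hu, v * a, (hi v hv a).2, mul_assoc _ _ _⟩⟩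
    | zero => simp
    | add x y _ _ h1 h2 =>
      rw [mul_add, add_mul]
      exact ⟨J.add_mem h1.1 h2.1, J.add_mem h1.2 h2.2⟩
    | smul c x _ h =>
      rw [mul_smul_comm, smul_mul_assoc]
      exact ⟨J.smul_mem c h.1, J.smul_mem c h.2⟩
  have hxJ : (x.1 : A) ∈ J := (Submodule.mem_sInf.1 x.2) J ⟨hJd, hJi⟩
  have key : ∀ z ∈ J, ∀ c : ℂ, ∃ p : Pos A, τ p < ∞ ∧ c • z + star (c • z) ≤ p := by
    intro z hz
    induction hz using Submodule.span_induction with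
    | mem z h =>
      obtain ⟨u, hu, v, hv, rfl⟩ := h
      intro c
      replace hu : c • u ∈ N := N.smul_mem c hu
      rw [← smul_mul_assoc]
      generalize c • u = u at hu
      refine ⟨Pos.starMul (star u) + Pos.starMul v, ?_, ?_⟩
      · rw [hτ.add]
        exact ENNReal.add_lt_top.2 ⟨(hN _).1 (hstar u hu), (hN _).1 hv⟩
      · change u * v + star (u * v) ≤ star (star u) * star u + star v * v
        have h0 := star_mul_self_nonneg (star u - v)
        rw [← sub_nonneg]
        convert h0 using 1
        simp only [star_mul, star_sub, star_star]
        noncomm_ring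
    | zero => exact fun c => ⟨0, by simp [hτ.zero], by simp⟩
    | add x y _ _ h1 h2 =>
      intro c
      obtain ⟨p, hp, hp'⟩ := h1 c
      obtain ⟨q, hq, hq'⟩ := h2 c
      refine ⟨p + q, by rw [hτ.add]; exact ENNReal.add_lt_top.2 ⟨hp, hq⟩, ?_⟩
      calc c • (x + y) + star (c • (x + y))
          = (c • x + star (c • x)) + (c • y + star (c • y)) := by
            rw [smul_add, star_add]; abel
        _ ≤ p + q := add_le_add hp' hq'
    | smul d x _ h =>
      intro c
      rw [smul_smul]
      exact h (c * d)
  obtain ⟨p, hp, hxp⟩ := key _ hxJ 1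
  rw [one_smul] at hxp
  refine (hτ.mono ?_).trans_lt hp
  have hs : star (x.1 : A) = x.1 := (IsSelfAdjoint.of_nonneg x.1.2).star_eq
  rw [hs] at hxp
  exact (le_add_of_nonneg_left x.1.2).trans hxp

namespace LTC

theorem lt_top (τ : LTC A) (x : PedPos A) : τ x.1 < ∞ :=
  τ.2.1.lt_top_of_mem_pedersenIdeal τ.2.2.2 x

variable (A)

/-- The restriction of a trace in `LTC(A)` to the positive part of the Pedersen ideal, where it is
finite. -/
def restrict : LTC A →ₗ[ℝ≥0] (PedPos A → ℝ≥0) where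
  toFun τ x := (τ x.1).toNNReal
  map_add' τ σ := by
    funext x
    exact ENNReal.toNNReal_add (τ.lt_top x).ne (σ.lt_top x).ne
  map_smul' c τ := by
    funext x
    exact ENNReal.toNNReal_mul.trans rfl

variable {A}

theorem coe_restrict (τ : LTC A) (x : PedPos A) : (restrict A τ x : ℝ≥0∞) = τ x.1 :=
  ENNReal.coe_toNNReal (τ.lt_top x).ne

/-- The weak topology `σ(LTC(A), K(A))`: the topology of pointwise convergence on the positive
part of the Pedersen ideal. -/
instance : TopologicalSpace (LTC A) := TopologicalSpace.induced (restrict A) inferInstance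

end LTC

end Traces

section Tensor

variable (A₁ A₂ : Type*)
  [NonUnitalCStarAlgebra A₁] [PartialOrder A₁] [StarOrderedRing A₁]
  [NonUnitalCStarAlgebra A₂] [PartialOrder A₂] [StarOrderedRing A₂]

/-- A C*-norm on the algebraic tensor product of two C*-algebras. -/
structure CStarNorm where
  toFun : A₁ ⊗[ℂ] A₂ → ℝ
  add_le : ∀ s t, toFun (s + t) ≤ toFun s + toFun t
  smul : ∀ (c : ℂ) (t), toFun (c • t) = ‖c‖ * toFun t
  eq_zero : ∀ t, toFun t = 0 → t = 0
  mul_le : ∀ s t, toFun (s * t) ≤ toFun s * toFun t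
  star_mul_self : ∀ t, toFun (star t * t) = toFun t ^ 2

variable {A₁ A₂}
variable {C : Type*} [NonUnitalCStarAlgebra C] [PartialOrder C] [StarOrderedRing C]

/-- The C*-algebra `C`, with the *-homomorphism `ι`, is the completion `A₁ ⊗_β A₂` of the
algebraic tensor product in the C*-norm `β`. -/
structure IsTensorCompletion (β : CStarNorm A₁ A₂) (ι : A₁ ⊗[ℂ] A₂ →⋆ₙₐ[ℂ] C) : Prop where
  norm_map : ∀ t, ‖ι t‖ = β.toFun t
  denseRange : DenseRange ι

/-- The elementary tensor `a ⊗ b` of positive elements, as a positive element of `C`. -/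
def Pos.tmul (ι : A₁ ⊗[ℂ] A₂ →⋆ₙₐ[ℂ] C) (a : Pos A₁) (b : Pos A₂) : Pos C :=
  ⟨ι ((a : A₁) ⊗ₜ[ℂ] (b : A₂)), by
    have h1 := CFC.sqrt_mul_sqrt_self (a : A₁) a.2
    have h2 := CFC.sqrt_mul_sqrt_self (b : A₂) b.2
    have s1 : star (CFC.sqrt (a : A₁)) = CFC.sqrt (a : A₁) :=
      (IsSelfAdjoint.of_nonneg (CFC.sqrt_nonneg _)).star_eq
    have s2 : star (CFC.sqrt (b : A₂)) = CFC.sqrt (b : A₂) :=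
      (IsSelfAdjoint.of_nonneg (CFC.sqrt_nonneg _)).star_eq
    have h : ι ((a : A₁) ⊗ₜ[ℂ] (b : A₂)) =
        star (ι (CFC.sqrt (a : A₁) ⊗ₜ[ℂ] CFC.sqrt (b : A₂))) *
          ι (CFC.sqrt (a : A₁) ⊗ₜ[ℂ] CFC.sqrt (b : A₂)) := by
      rw [← map_star, ← map_mul, TensorProduct.star_tmul,
        Algebra.TensorProduct.tmul_mul_tmul, s1, s2, h1, h2]
    rw [h]
    exact star_mul_self_nonneg _⟩

variable (A₁ A₂) in
/-- The algebraic tensor product `LTC(A₁) ⊙ LTC(A₂)`: the cone of finite sums of elementary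
tensors `τ₁ ⊗ τ₂`. Its elements are viewed as positive functionals on the algebraic tensor product
of the Pedersen ideals, and are recorded through their values at the elementary tensors `a ⊗ b` with
`a ∈ K(A₁)₊` and `b ∈ K(A₂)₊`. -/
def algTensor : Submodule ℝ≥0 (PedPos A₁ × PedPos A₂ → ℝ≥0∞) :=
  Submodule.span ℝ≥0 {f | ∃ (τ₁ : LTC A₁) (τ₂ : LTC A₂), ∀ a b, f (a, b) = τ₁ a.1 * τ₂ b.1}

/-- The values of a trace on `C` at the elementary tensors `a ⊗ b` with `a ∈ K(A₁)₊` and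
`b ∈ K(A₂)₊`. -/
def tensorValues (ι : A₁ ⊗[ℂ] A₂ →⋆ₙₐ[ℂ] C) :
    LTC C →ₗ[ℝ≥0] (PedPos A₁ × PedPos A₂ → ℝ≥0∞) where
  toFun τ p := τ (Pos.tmul ι p.1.1 p.2.1)
  map_add' _ _ := rfl
  map_smul' _ _ := rfl

/-- The tensor product of cones `LTC(A₁) ⊗_β LTC(A₂)`: the functionals on `K(C)₊`, where
`C = A₁ ⊗_β A₂`, in the closure of `LTC(A₁) ⊙ LTC(A₂)` for the topology of pointwise convergence on
`K(C)₊`. An element of `LTC(A₁) ⊙ LTC(A₂)` is here a functional on `K(C)₊` through its extension to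
a trace on `C`. -/
def tensorCone (ι : A₁ ⊗[ℂ] A₂ →⋆ₙₐ[ℂ] C) : Submodule ℝ≥0 (PedPos C → ℝ≥0) :=
  (((algTensor A₁ A₂).comap (tensorValues ι)).map (LTC.restrict C)).topologicalClosure

end Tensor

end TracialCone

end

/-!
For `φ` defined on `K(A)₊`, being the restriction of a trace amounts to a family of equations,
each between finitely many values of `φ`: given such a `φ`, the functionals `x ↦ φ (√x e √x)` are
positive, increase with `e`, and their supremum over the `e` in `K(A)₊` of norm less than one is a
trace in `LTC(A)` that extends `φ`. Hence `LTC(A)` embeds as a closed cone of functions on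
`K(A)₊`.

The product of two positive functionals extends to the completion for every C*-norm. By the
Krein-Milman theorem one factor may be taken extremal among the positive functionals of norm at most
one. Were the other factor `ψ` not among those that extend, Hahn-Banach separation would give a
selfadjoint `p - q` whose value at `ψ` exceeds its values at these; as `a ⊗ b ≠ 0` for nonzero `a`
and `b`, the compressions of states of the completion provide a functional with marginal `φ` that
witnesses the large value of `p - q`, and it is a product because `φ` is extremal. Products of
traces are then suprema of products of increasing nets of functionals.

If the values of traces converge at the elementary tensors of the Pedersen ideals, then they
converge on `K(C)₊`, since `K(C)` is contained in the ideal generated by these tensors. So a trace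
on the completion is determined by its values at elementary tensors, and it remains to approximate
finitely many of these values by those of sums of products. The slices `b ↦ τ (a ⊗ b)` lie in
`LTC(A₂)`, which is a lattice cone, the infimum of two traces being
`y ↦ inf {σ y₁ + ψ y₂ : y₁ + y₂ = y}`, and in which bounded increasing sequences
have suprema. It thus has band projections, and Freudenthal's spectral theorem decomposes it so that
the slices in question become nearly proportional to a single trace in each part, which makes `τ`
nearly a product there.
-/

noncomputable section

namespace TracialCone

open Filter Topology

section PedersenIdeal

namespace pedersenIdeal

variable {A : Type*} [NonUnitalCStarAlgebra A]

theorem mul_mem_left (a : A) {x : A} (hx : x ∈ pedersenIdeal A) : a * x ∈ pedersenIdeal A :=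
  Submodule.mem_sInf.2 fun I hI => (hI.2 x (Submodule.mem_sInf.1 hx I hI) a).1

theorem mul_mem_right (a : A) {x : A} (hx : x ∈ pedersenIdeal A) : x * a ∈ pedersenIdeal A :=
  Submodule.mem_sInf.2 fun I hI => (hI.2 x (Submodule.mem_sInf.1 hx I hI) a).2

theorem mem_of_mul_eq {a y : A} (h : a * y = y) : y ∈ pedersenIdeal A := by
  refine Submodule.mem_sInf.2 fun I ⟨hI, hmul⟩ => ?_
  obtain ⟨i, hi, hai⟩ := Metric.mem_closure_iff.1 (hI a) 1 one_pos
  rw [dist_eq_norm] at hai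
  -- `1 - (a - i)` is invertible in the unitization and maps `y` to `i y ∈ I`.
  let u : (Unitization ℂ A)ˣ := Units.oneSub ((a - i : A) : Unitization ℂ A)
    (by rwa [Unitization.norm_inr])
  have huy : (u : Unitization ℂ A) * (y : Unitization ℂ A) = ((i * y : A) : Unitization ℂ A) := by
    simp only [u, Units.val_oneSub, sub_mul, one_mul, ← Unitization.inr_mul, h,
      ← Unitization.inr_sub, sub_sub_cancel]
  have hy : (y : Unitization ℂ A) = (↑u⁻¹ : Unitization ℂ A) * ((i * y : A) : Unitization ℂ A) := by
    rw [← huy, Units.inv_mul_cancel_left]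
  have hy' : y = (↑u⁻¹ : Unitization ℂ A).fst • (i * y) +
      (↑u⁻¹ : Unitization ℂ A).snd * (i * y) := by
    simpa only [Unitization.snd_inr, Unitization.snd_mul, Unitization.fst_inr, zero_smul,
      add_zero] using congrArg (fun z => z.snd) hy
  rw [hy']
  have hiy : i * y ∈ I := (hmul i hi y).2
  exact I.add_mem (I.smul_mem _ hiy) (hmul _ hiy _).1

theorem cfcₙ_id_mul_mem {x : A} (hsa : IsSelfAdjoint x) (hx : x ∈ pedersenIdeal A) {h : ℝ → ℝ}
    (hh : ContinuousOn h (quasispectrum ℝ x)) : cfcₙ (fun t => t * h t) x ∈ pedersenIdeal A := by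
  have hsub : ContinuousOn (fun t => h t - h 0) (quasispectrum ℝ x) := by fun_prop
  have hsplit : cfcₙ (fun t => t * h t) x = (h 0 : ℂ) • x + x * cfcₙ (fun t => h t - h 0) x := by
    calc cfcₙ (fun t => t * h t) x
        = cfcₙ (fun t => h 0 * t + t * (h t - h 0)) x := cfcₙ_congr fun t _ => by ring
      _ = cfcₙ (fun t => h 0 * t) x + cfcₙ (fun t => t) x * cfcₙ (fun t => h t - h 0) x := by
        rw [cfcₙ_add _ _ x (by fun_prop) (by simp) (by fun_prop) (by simp),
          cfcₙ_mul _ _ x (by fun_prop) rfl hsub (sub_self _)]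
      _ = _ := by
        rw [cfcₙ_const_mul _ _ x (by fun_prop) rfl, cfcₙ_id' ℝ x hsa, Complex.coe_smul]
  rw [hsplit]
  exact add_mem (Submodule.smul_mem _ _ hx) (mul_mem_right _ hx)

end pedersenIdeal

variable {A : Type*} [NonUnitalCStarAlgebra A] [PartialOrder A]

variable (A) in
/-- The positive elements `f` with a left unit `u f = f`. They are dense in `A₊` and lie in every
dense ideal, so that they are the elements at hand to work with in the Pedersen ideal. -/
def unitSet : Set (Pos A) := {f | ∃ u : A, u * (f : A) = f}

theorem mem_pedersenIdeal_of_mem_unitSet {f : Pos A} (hf : f ∈ unitSet A) :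
    (f : A) ∈ pedersenIdeal A :=
  pedersenIdeal.mem_of_mul_eq hf.choose_spec

/-- The ideal of the linear combinations of the products `x f z` with `f ∈ S`. -/
def idealSpan (S : Set (Pos A)) : Submodule ℂ A :=
  Submodule.span ℂ {y | ∃ (x : A) (f : Pos A) (z : A), f ∈ S ∧ y = x * f * z}

theorem mul_mem_idealSpan {S : Set (Pos A)} {y : A} (hy : y ∈ idealSpan S) (a : A) :
    a * y ∈ idealSpan S ∧ y * a ∈ idealSpan S := by
  induction hy using Submodule.span_induction with
  | mem y h =>
    obtain ⟨x, f, z, hf, rfl⟩ := h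
    exact ⟨Submodule.subset_span ⟨a * x, f, z, hf, by simp only [mul_assoc]⟩,
      Submodule.subset_span ⟨x, f, z * a, hf, by simp only [mul_assoc]⟩⟩
  | zero => simp
  | add x y _ _ hx hy =>
    rw [mul_add, add_mul]
    exact ⟨Submodule.add_mem _ hx.1 hy.1, Submodule.add_mem _ hx.2 hy.2⟩
  | smul c x _ hx =>
    rw [mul_smul_comm, smul_mul_assoc]
    exact ⟨Submodule.smul_mem _ c hx.1, Submodule.smul_mem _ c hx.2⟩

theorem pedersenIdeal_le_idealSpan {S : Set (Pos A)} (hS : Dense (idealSpan S : Set A)) :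
    pedersenIdeal A ≤ idealSpan S :=
  sInf_le ⟨hS, fun _ hx a => mul_mem_idealSpan hx a⟩

variable [StarOrderedRing A]

theorem mem_closure_idealSpan {S : Set (Pos A)} {f : Pos A} (hf : f ∈ S) :
    (f : A) ∈ closure (idealSpan S : Set A) := by
  have hl := CStarAlgebra.increasingApproximateUnit A
  have hmul (x : A) : x * f ∈ closure (idealSpan S : Set A) :=
    mem_closure_of_tendsto (hl.tendsto_mul_left (x * f))
      (Eventually.of_forall fun e => Submodule.subset_span ⟨x, f, e, hf, rfl⟩)
  exact isClosed_closure.mem_of_tendsto (hl.tendsto_mul_right (f : A))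
    (Eventually.of_forall fun e => hmul e)

namespace Pos

theorem star_eq (a : Pos A) : star (a : A) = a := (IsSelfAdjoint.of_nonneg a.2).star_eq

/-- The square root of a positive element, as a positive element. -/
def sqrt (a : Pos A) : Pos A := ⟨CFC.sqrt (a : A), CFC.sqrt_nonneg _⟩

theorem sqrt_mul_sqrt (a : Pos A) : (a.sqrt : A) * a.sqrt = a :=
  CFC.sqrt_mul_sqrt_self (a : A) a.2

/-- The conjugate `w* a w` of a positive element, as a positive element. -/
def conj (a : Pos A) (w : A) : Pos A := ⟨star w * a * w, star_left_conjugate_nonneg a.2 w⟩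

theorem coe_conj (a : Pos A) (w : A) : (a.conj w : A) = star w * a * w := rfl

theorem coe_scale (t : ℝ≥0) (a : Pos A) : (a.scale t : A) = (t : ℝ) • (a : A) := rfl

theorem coe_starMul (w : A) : (Pos.starMul w : A) = star w * w := rfl

/-- The element `(a - ε)₊`, which belongs to the Pedersen ideal and is within `ε` of `a`. -/
def cut (ε : ℝ) (a : Pos A) : Pos A :=
  ⟨cfcₙ (fun t : ℝ => max (t - ε) 0) (a : A), cfcₙ_nonneg fun _ _ => le_max_right _ _⟩

theorem norm_cut_sub_le {ε : ℝ} (hε : 0 ≤ ε) (a : Pos A) : ‖(a.cut ε : A) - a‖ ≤ ε := by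
  have h : (a.cut ε : A) - a = cfcₙ (fun t : ℝ => max (t - ε) 0 - t) (a : A) := by
    rw [cfcₙ_sub _ _ _ (by fun_prop) (by simpa using hε) (by fun_prop) rfl,
      cfcₙ_id' ℝ (a : A) (IsSelfAdjoint.of_nonneg a.2)]
    rfl
  rw [h]
  refine norm_cfcₙ_le fun t ht => ?_
  have := quasispectrum_nonneg_of_nonneg (a : A) a.2 t ht
  rw [Real.norm_eq_abs, abs_le]
  constructor
  · linarith [le_max_left (t - ε) 0]
  · rcases max_cases (t - ε) 0 with h | h <;> linarith

theorem cut_mem_unitSet {ε : ℝ} (hε : 0 < ε) (a : Pos A) : a.cut ε ∈ unitSet A := by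
  refine ⟨cfcₙ (fun t : ℝ => min (t / ε) 1) (a : A), ?_⟩
  rw [Pos.cut, ← cfcₙ_mul _ _ _ (by fun_prop) (by simp) (by fun_prop) (by simpa using hε.le)]
  refine cfcₙ_congr fun t _ => ?_
  rcases le_or_gt t ε with h | h
  · simp [max_eq_right (sub_nonpos.2 h)]
  · have : min (t / ε) 1 = 1 := min_eq_right ((one_le_div hε).2 h.le)
    simp [this]

end Pos

variable (A) in
theorem dense_unitSet : Dense (unitSet A) := by
  refine fun a => Metric.mem_closure_iff.2 fun ε hε => ?_
  refine ⟨a.cut (ε / 2), a.cut_mem_unitSet (by positivity), ?_⟩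
  rw [Subtype.dist_eq, dist_comm, dist_eq_norm]
  exact (a.norm_cut_sub_le (by positivity)).trans_lt (by linarith)

variable (A) in
theorem dense_pedPos : Dense {a : Pos A | (a : A) ∈ pedersenIdeal A} :=
  (dense_unitSet A).mono fun _ => mem_pedersenIdeal_of_mem_unitSet

theorem eq_top_of_isClosed_of_unitSet_subset {S : Submodule ℂ A} (hS : IsClosed (S : Set A))
    (h : ∀ a ∈ unitSet A, (a : A) ∈ S) : S = ⊤ := by
  rw [eq_top_iff, ← CStarAlgebra.span_nonneg, Submodule.span_le]
  intro a ha
  have hcl : closure (unitSet A) ⊆ Subtype.val ⁻¹' (S : Set A) :=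
    closure_minimal h (hS.preimage continuous_subtype_val)
  exact hcl (dense_unitSet A ⟨a, ha⟩)

variable (A) in
theorem pedersenIdeal_le_idealSpan_unitSet : pedersenIdeal A ≤ idealSpan (unitSet A) :=
  pedersenIdeal_le_idealSpan <| Submodule.dense_iff_topologicalClosure_eq_top.2 <|
    eq_top_of_isClosed_of_unitSet_subset (Submodule.isClosed_topologicalClosure _)
      fun _ => mem_closure_idealSpan

/-- The cone of the finite sums of elements `w* f w` with `f ∈ S`. -/
def conjCone (S : Set (Pos A)) : AddSubmonoid (Pos A) :=
  AddSubmonoid.closure {y | ∃ f ∈ S, ∃ w : A, y = f.conj w}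

theorem conj_mem_conjCone {S : Set (Pos A)} {f : Pos A} (hf : f ∈ S) (w : A) :
    f.conj w ∈ conjCone S :=
  AddSubmonoid.subset_closure ⟨f, hf, w, rfl⟩

theorem exists_smul_add_star_eq_sub_of_mem_idealSpan {S : Set (Pos A)} {y : A}
    (hy : y ∈ idealSpan S) (c : ℂ) :
    ∃ n ∈ conjCone S, ∃ p ∈ conjCone S, c • y + star (c • y) = (p : A) - n := by
  induction hy using Submodule.span_induction generalizing c with
  | mem y h =>
    -- Polarization: `x f z + z* f x* = (x* + z)* f (x* + z) - x f x* - z* f z`.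
    obtain ⟨x, f, z, hf, rfl⟩ := h
    refine ⟨f.conj (star (c • x)) + f.conj z,
      add_mem (conj_mem_conjCone hf _) (conj_mem_conjCone hf _),
      f.conj (star (c • x) + z), conj_mem_conjCone hf _, ?_⟩
    rw [← smul_mul_assoc, ← smul_mul_assoc]
    simp only [Nonneg.coe_add, Pos.coe_conj, star_star, star_mul, star_add, f.star_eq]
    noncomm_ring
  | zero => exact ⟨0, zero_mem _, 0, zero_mem _, by simp⟩
  | add x y _ _ hx hy =>
    obtain ⟨n, hn, p, hp, h⟩ := hx c
    obtain ⟨n', hn', p', hp', h'⟩ := hy c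
    refine ⟨n + n', add_mem hn hn', p + p', add_mem hp hp', ?_⟩
    simp only [Nonneg.coe_add, add_sub_add_comm, ← h, ← h', smul_add, star_add]
    abel
  | smul d x _ hx => simpa only [smul_smul] using hx (c * d)

theorem exists_add_eq_of_mem_idealSpan {S : Set (Pos A)} {k : Pos A}
    (hk : (k : A) ∈ idealSpan S) : ∃ n ∈ conjCone S, ∃ p ∈ conjCone S, k + n = p := by
  obtain ⟨n, hn, p, hp, h⟩ :=
    exists_smul_add_star_eq_sub_of_mem_idealSpan hk ((2⁻¹ : ℝ) : ℂ)
  refine ⟨n, hn, p, hp, Subtype.ext ?_⟩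
  rw [Complex.coe_smul, star_smul, k.star_eq, star_trivial, ← add_smul] at h
  norm_num at h
  rw [Nonneg.coe_add, h, sub_add_cancel]

end PedersenIdeal

section PedersenBall

variable {A : Type*} [NonUnitalCStarAlgebra A] [PartialOrder A]

variable (A) in
/-- The positive elements of the Pedersen ideal of norm less than one. In its natural order this is
a directed set, and the net of its elements is an approximate unit. -/
abbrev PedBall : Type _ := {e : Pos A // (e : A) ∈ pedersenIdeal A ∧ ‖(e : A)‖ < 1}

instance : Nonempty (PedBall A) := ⟨⟨0, by simp⟩⟩

variable [StarOrderedRing A]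

theorem one_sub_pos_of_mem_quasispectrum {a : A} (ha : 0 ≤ a) (ha' : ‖a‖ < 1) {t : ℝ}
    (ht : t ∈ quasispectrum ℝ a) : 0 < 1 - t :=
  sub_pos.2 <| ((Real.le_norm_self t).trans <|
    NonUnitalIsometricContinuousFunctionalCalculus.norm_quasispectrum_le a ht
      ha.isSelfAdjoint).trans_lt ha'

theorem continuousOn_inv_one_sub {a : A} (ha : 0 ≤ a) (ha' : ‖a‖ < 1) :
    ContinuousOn (fun t : ℝ => (1 - t)⁻¹) (quasispectrum ℝ a) :=
  ContinuousOn.inv₀ (by fun_prop) fun _ ht => (one_sub_pos_of_mem_quasispectrum ha ha' ht).ne'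

theorem le_cfcₙ_one_sub_one_add_inv {a b : A} (ha : 0 ≤ a) (ha' : ‖a‖ < 1) (hb : 0 ≤ b) :
    a ≤ cfcₙ (fun t : ℝ => 1 - (1 + t)⁻¹) (cfcₙ (fun t : ℝ => t * (1 - t)⁻¹) a + b) := by
  have hlt : ∀ t ∈ quasispectrum ℝ a, 0 < 1 - t := fun _ =>
    one_sub_pos_of_mem_quasispectrum ha ha'
  have hcont : ContinuousOn (fun t : ℝ => t * (1 - t)⁻¹) (quasispectrum ℝ a) :=
    continuousOn_id.mul (continuousOn_inv_one_sub ha ha')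
  have hpos : ∀ t ∈ quasispectrum ℝ a, 0 ≤ t * (1 - t)⁻¹ := fun t ht =>
    mul_nonneg (quasispectrum_nonneg_of_nonneg a ha t ht) (inv_nonneg.2 (hlt t ht).le)
  have hinv : a = cfcₙ (fun t : ℝ => 1 - (1 + t)⁻¹) (cfcₙ (fun t : ℝ => t * (1 - t)⁻¹) a) := by
    rw [← cfcₙ_comp' _ _ a ?_ (by simp) hcont (by simp) ha.isSelfAdjoint]
    · conv_lhs => rw [← cfcₙ_id' ℝ a ha.isSelfAdjoint]
      refine cfcₙ_congr fun t ht => ?_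
      have := (hlt t ht).ne'
      field_simp
      ring
    · rintro _ ⟨t, ht, rfl⟩
      refine ContinuousAt.continuousWithinAt ?_
      have := hpos t ht
      fun_prop (disch := positivity)
  have hg : (0 : A) ≤ cfcₙ (fun t : ℝ => t * (1 - t)⁻¹) a := cfcₙ_nonneg hpos
  conv_lhs => rw [hinv]
  exact CFC.monotoneOn_one_sub_one_add_inv_real hg (add_nonneg hg hb) (le_add_of_nonneg_right hb)

theorem exists_pedBall_eq_cfcₙ {y : A} (hy : 0 ≤ y)
    (hyK : y ∈ pedersenIdeal A) :
    ∃ e : PedBall A, (e.1 : A) = cfcₙ (fun t : ℝ => 1 - (1 + t)⁻¹) y := by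
  have hpos : ∀ t ∈ quasispectrum ℝ y, 0 ≤ t := quasispectrum_nonneg_of_nonneg y hy
  have heq : cfcₙ (fun t : ℝ => 1 - (1 + t)⁻¹) y = cfcₙ (fun t : ℝ => t * (1 + t)⁻¹) y :=
    cfcₙ_congr fun t ht => by
      have : 1 + t ≠ 0 := by linarith [hpos t ht]
      field_simp
      ring
  refine ⟨⟨⟨_, cfcₙ_nonneg (f := fun t : ℝ => 1 - (1 + t)⁻¹) fun t ht => ?_⟩, ?_, ?_⟩, rfl⟩
  · exact sub_nonneg.2 (inv_le_one_of_one_le₀ (by linarith [hpos t ht]))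
  · change cfcₙ _ y ∈ _
    rw [heq]
    refine pedersenIdeal.cfcₙ_id_mul_mem hy.isSelfAdjoint hyK ?_
    fun_prop (disch := intro t ht; linarith [hpos t ht])
  · refine norm_cfcₙ_lt fun t ht => ?_
    have h1 : 0 < (1 + t)⁻¹ := by have := hpos t ht; positivity
    have h2 : (1 + t)⁻¹ ≤ 1 := inv_le_one_of_one_le₀ (by linarith [hpos t ht])
    rw [Real.norm_eq_abs, abs_lt]
    constructor <;> linarith

instance : IsDirected (PedBall A) (· ≤ ·) := by
  refine ⟨fun a b => ?_⟩
  let g : Pos A → A := fun a => cfcₙ (fun t : ℝ => t * (1 - t)⁻¹) (a : A)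
  have hg (a : PedBall A) : 0 ≤ g a.1 := cfcₙ_nonneg fun t ht =>
    mul_nonneg (quasispectrum_nonneg_of_nonneg _ a.1.2 t ht) 
      (inv_nonneg.2 (one_sub_pos_of_mem_quasispectrum a.1.2 a.2.2 ht).le)
  have hgK (a : PedBall A) : g a.1 ∈ pedersenIdeal A :=
    pedersenIdeal.cfcₙ_id_mul_mem a.1.2.isSelfAdjoint a.2.1 (continuousOn_inv_one_sub a.1.2 a.2.2)
  obtain ⟨e, he⟩ := exists_pedBall_eq_cfcₙ (add_nonneg (hg a) (hg b)) (add_mem (hgK a) (hgK b))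
  refine ⟨e, ?_, ?_⟩
  · change (a.1 : A) ≤ e.1
    rw [he]
    exact le_cfcₙ_one_sub_one_add_inv a.1.2 a.2.2 (hg b)
  · change (b.1 : A) ≤ e.1
    rw [he, add_comm]
    exact le_cfcₙ_one_sub_one_add_inv b.1.2 b.2.2 (hg a)

theorem exists_pedBall_norm_sub_mul_lt (x : A) {ε : ℝ} (hε : 0 < ε) :
    ∃ e : PedBall A, ‖x - (e.1 : A) * x‖ < ε := by
  have hl := CStarAlgebra.increasingApproximateUnit A
  have hnorm : Continuous fun a : Pos A => ‖(a : A)‖ := by fun_prop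
  have hsub : Continuous fun a : Pos A => ‖x - a * x‖ := by fun_prop
  have hopen : IsOpen {a : Pos A | ‖(a : A)‖ < 1 ∧ ‖x - a * x‖ < ε} :=
    (isOpen_lt hnorm continuous_const).inter (isOpen_lt hsub continuous_const)
  obtain ⟨a, ⟨ha, ha'⟩, hax⟩ := (CStarAlgebra.hasBasis_approximateUnit A).eventually_iff.1
    ((hl.tendsto_mul_right x).eventually (Metric.ball_mem_nhds x hε))
  have hmem : ‖x - a * x‖ < ε := by
    simpa only [Metric.mem_ball, dist_eq_norm, norm_sub_rev] using
      hax (x := a) ⟨le_rfl, by simpa using ha'.le⟩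
  obtain ⟨e, ⟨he1, he⟩, heK⟩ := (dense_pedPos A).inter_open_nonempty _ hopen ⟨⟨a, ha⟩, ha', hmem⟩
  exact ⟨⟨e, heK, he1⟩, he⟩

theorem PedBall.sq_norm_sub_mul_le (x : A) {e₀ e : PedBall A} (h : e₀ ≤ e) :
    ‖x - (e.1 : A) * x‖ ^ 2 ≤ ‖x‖ * ‖x - (e₀.1 : A) * x‖ := by
  have hinr : star (x : Unitization ℂ A) * (1 - ((e₀.1 : A) : Unitization ℂ A)) * x =
      ((star x * (x - (e₀.1 : A) * x) : A) : Unitization ℂ A) := by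
    simp only [Unitization.inr_mul, Unitization.inr_sub, Unitization.inr_star, mul_sub, sub_mul,
      mul_one, mul_assoc]
  have hbound : ‖star x * (x - (e₀.1 : A) * x)‖ ≤ ‖x‖ * ‖x - (e₀.1 : A) * x‖ :=
    (norm_mul_le _ _).trans_eq (by rw [norm_star])
  refine (Real.le_sqrt (norm_nonneg _) (by positivity)).1 ?_
  refine CStarAlgebra.norm_sub_mul_self_le_of_inr x e₀.1.2 h e.2.2.le (Real.sqrt_nonneg _) ?_
  rwa [hinr, Unitization.norm_inr, Real.sq_sqrt (by positivity)]

theorem tendsto_pedBall_mul (x : A) :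
    Tendsto (fun e : PedBall A => (e.1 : A) * x) atTop (𝓝 x) := by
  refine Metric.tendsto_nhds.2 fun ε hε => ?_
  obtain ⟨e₀, he₀⟩ := exists_pedBall_norm_sub_mul_lt x (ε := ε ^ 2 / (‖x‖ + 1)) (by positivity)
  filter_upwards [eventually_ge_atTop e₀] with e he
  rw [dist_comm, dist_eq_norm]
  refine lt_of_pow_lt_pow_left₀ 2 hε.le ?_
  calc ‖x - (e.1 : A) * x‖ ^ 2 ≤ ‖x‖ * ‖x - (e₀.1 : A) * x‖ := PedBall.sq_norm_sub_mul_le x he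
    _ ≤ (‖x‖ + 1) * ‖x - (e₀.1 : A) * x‖ := by gcongr; linarith
    _ < ε ^ 2 := by rwa [lt_div_iff₀' (by positivity)] at he₀

end PedersenBall

section PosFun

open scoped ComplexOrder

variable {A : Type*} [NonUnitalCStarAlgebra A] [PartialOrder A] [StarOrderedRing A]

/-- An additive and positively homogeneous map `A₊ → [0, ∞)`, that is, the restriction to `A₊` of
a positive linear functional. -/
structure IsPosFun (φ : Pos A → ℝ) : Prop where
  nonneg : ∀ a, 0 ≤ φ a
  add : ∀ a b, φ (a + b) = φ a + φ b
  scale : ∀ (t : ℝ≥0) (a), φ (a.scale t) = t * φ a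

namespace IsPosFun

variable {φ ψ : Pos A → ℝ}

theorem mono (hφ : IsPosFun φ) {a b : Pos A} (h : (a : A) ≤ b) : φ a ≤ φ b := by
  have : b = a + ⟨(b : A) - a, sub_nonneg.2 h⟩ := Subtype.ext (by simp)
  rw [this, hφ.add]
  exact le_add_of_nonneg_right (hφ.nonneg _)

theorem zero (hφ : IsPosFun φ) : φ 0 = 0 := by
  have h : Pos.scale 0 (0 : Pos A) = 0 := Subtype.ext (by simp [Pos.scale])
  simpa [h] using hφ.scale 0 0

theorem sub_eq_sub (hφ : IsPosFun φ) {a b c d : Pos A} (h : (a : A) - b = c - d) :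
    φ a - φ b = φ c - φ d := by
  have : a + d = c + b := Subtype.ext (sub_eq_sub_iff_add_eq_add.1 h)
  have := congrArg φ this
  rw [hφ.add, hφ.add] at this
  linarith

/-- The real linear functional on `A` that agrees with `φ` on `A₊` and depends on the real part
only. -/
def realExt (hφ : IsPosFun φ) : A →ₗ[ℝ] ℝ :=
  let P (x : A) : Pos A := ⟨(realPart x : A)⁺, CFC.posPart_nonneg _⟩
  let N (x : A) : Pos A := ⟨(realPart x : A)⁻, CFC.negPart_nonneg _⟩
  have hPN (x : A) : (P x : A) - N x = realPart x := CFC.posPart_sub_negPart _ (realPart x).2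
  { toFun x := φ (P x) - φ (N x)
    map_add' x y := by
      rw [hφ.sub_eq_sub (c := P x + P y) (d := N x + N y), hφ.add, hφ.add]
      · ring
      · rw [hPN, map_add, AddSubgroup.coe_add, ← hPN, ← hPN, Nonneg.coe_add, Nonneg.coe_add]
        abel
    map_smul' r x := by
      rw [RingHom.id_apply, smul_eq_mul]
      obtain ⟨s, rfl | rfl⟩ : ∃ s : ℝ≥0, r = s ∨ r = -s := by
        rcases le_total 0 r with hr | hr
        · exact ⟨r.toNNReal, .inl (Real.coe_toNNReal r hr).symm⟩
        · exact ⟨(-r).toNNReal, .inr (by rw [Real.coe_toNNReal _ (by linarith), neg_neg])⟩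
      · rw [hφ.sub_eq_sub (c := (P x).scale s) (d := (N x).scale s), hφ.scale, hφ.scale, mul_sub]
        rw [hPN, Pos.coe_scale, Pos.coe_scale, ← smul_sub, hPN, map_smul, selfAdjoint.val_smul]
      · rw [hφ.sub_eq_sub (c := (N x).scale s) (d := (P x).scale s), hφ.scale, hφ.scale]
        · ring
        · rw [hPN, Pos.coe_scale, Pos.coe_scale, ← smul_sub, ← neg_sub, hPN, map_smul,
            selfAdjoint.val_smul, neg_smul, smul_neg] }

theorem realExt_apply (hφ : IsPosFun φ) (a : Pos A) : hφ.realExt a = φ a := by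
  refine (hφ.sub_eq_sub (c := a) (d := 0) ?_).trans (by rw [hφ.zero, sub_zero])
  rw [CFC.posPart_sub_negPart _ (realPart (a : A)).2, Nonneg.coe_zero, sub_zero,
    (IsSelfAdjoint.of_nonneg a.2).coe_realPart]

theorem realExt_I_smul (hφ : IsPosFun φ) (a : Pos A) : hφ.realExt (Complex.I • (a : A)) = 0 := by
  refine (hφ.sub_eq_sub (c := 0) (d := 0) ?_).trans (sub_self _)
  rw [CFC.posPart_sub_negPart _ (realPart (Complex.I • (a : A))).2, realPart_I_smul,
    (IsSelfAdjoint.of_nonneg a.2).imaginaryPart, neg_zero, ZeroMemClass.coe_zero, sub_self]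

theorem extendRCLike_realExt_apply (hφ : IsPosFun φ) (a : Pos A) :
    Module.Dual.extendRCLike (𝕜 := ℂ) hφ.realExt (a : A) = (φ a : ℂ) := by
  simp [Module.Dual.extendRCLike_apply, hφ.realExt_apply, hφ.realExt_I_smul]

/-- The positive linear functional that extends `φ`. It is continuous because positive functionals
on a C*-algebra are. -/
def ext (hφ : IsPosFun φ) : A →L[ℂ] ℂ where
  toLinearMap := Module.Dual.extendRCLike (𝕜 := ℂ) hφ.realExt
  cont := map_continuous <| PositiveLinearMap.mk₀ (Module.Dual.extendRCLike (𝕜 := ℂ) hφ.realExt)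
    fun a ha => by
      rw [hφ.extendRCLike_realExt_apply ⟨a, ha⟩]
      exact_mod_cast hφ.nonneg _

theorem ext_apply (hφ : IsPosFun φ) (a : Pos A) : hφ.ext a = (φ a : ℂ) :=
  hφ.extendRCLike_realExt_apply a

theorem eq_re (hφ : IsPosFun φ) (a : Pos A) : φ a = (hφ.ext a).re := by
  rw [hφ.ext_apply, Complex.ofReal_re]

theorem continuous (hφ : IsPosFun φ) : Continuous φ := by
  rw [funext hφ.eq_re]
  fun_prop

theorem exists_bound (hφ : IsPosFun φ) : ∃ M : ℝ, 0 ≤ M ∧ ∀ a : Pos A, φ a ≤ M * ‖(a : A)‖ := by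
  refine ⟨‖hφ.ext‖, norm_nonneg _, fun a => ?_⟩
  rw [hφ.eq_re]
  exact (Complex.re_le_norm _).trans (hφ.ext.le_opNorm _)

theorem norm_ext_le (hφ : IsPosFun φ) {M : ℝ} (hM : ∀ a : Pos A, φ a ≤ M * ‖(a : A)‖)
    (hM0 : 0 ≤ M) (x : A) : ‖hφ.ext x‖ ≤ 4 * M * ‖x‖ := by
  obtain ⟨y, hy0, hyn, hy⟩ := CStarAlgebra.exists_sum_four_nonneg x
  have hterm (i : Fin 4) : ‖Complex.I ^ (i : ℕ) • hφ.ext (y i)‖ ≤ M * ‖x‖ := by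
    rw [norm_smul, norm_pow, Complex.norm_I, one_pow, one_mul, hφ.ext_apply ⟨y i, hy0 i⟩,
      Complex.norm_real, Real.norm_of_nonneg (hφ.nonneg _)]
    exact (hM _).trans (mul_le_mul_of_nonneg_left (hyn i) hM0)
  conv_lhs => rw [hy]
  simp only [map_sum, map_smul]
  refine (norm_sum_le_of_le _ fun i _ => hterm i).trans_eq ?_
  simp [mul_assoc]

theorem smul (hφ : IsPosFun φ) {c : ℝ} (hc : 0 ≤ c) : IsPosFun fun a => c * φ a where
  nonneg a := mul_nonneg hc (hφ.nonneg a)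
  add a b := by rw [hφ.add, mul_add]
  scale t a := by rw [hφ.scale, mul_left_comm]

theorem comp_conj (hφ : IsPosFun φ) (w : A) : IsPosFun fun a => φ (a.conj w) where
  nonneg _ := hφ.nonneg _
  add a b := by
    rw [← hφ.add]
    exact congrArg φ (Subtype.ext (by simp [Pos.coe_conj, mul_add, add_mul]))
  scale t a := by
    rw [← hφ.scale]
    exact congrArg φ (Subtype.ext (by simp only [Pos.coe_conj, Pos.coe_scale, mul_smul_comm,
      smul_mul_assoc]))

end IsPosFun

theorem linearMap_ext_pos {E : Type*} [AddCommGroup E] [Module ℂ E] {f g : A →ₗ[ℂ] E}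
    (h : ∀ a : Pos A, f a = g a) : f = g := by
  refine LinearMap.ext_on_range (v := fun a : Pos A => (a : A)) ?_ h
  rw [eq_top_iff, ← CStarAlgebra.span_nonneg]
  exact Submodule.span_mono fun a ha => ⟨⟨a, ha⟩, rfl⟩

theorem sesquilinear_ext_of_diag {E F : Type*} [AddCommGroup E] [Module ℂ E] [AddCommGroup F]
    [Module ℂ F] {S T : E →ₗ⋆[ℂ] E →ₗ[ℂ] F} (h : ∀ x, S x x = T x x) : S = T := by
  refine LinearMap.ext₂ fun x y => ?_
  have h1 := h (x + y)
  have h2 := h (x + Complex.I • y)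
  simp only [map_add, LinearMap.add_apply, LinearMap.map_smulₛₗ, LinearMap.smul_apply, h,
    Complex.conj_I, RingHom.id_apply] at h1 h2
  have h3 := congrArg (Complex.I • ·) h2
  simp only [smul_add, smul_smul, mul_neg, Complex.I_mul_I, neg_neg, mul_one] at h3
  linear_combination (norm := module) (1 / 2 : ℂ) • h1 - (1 / 2 : ℂ) • h3

end PosFun

section TraceNet

variable {A : Type*} [NonUnitalCStarAlgebra A] [PartialOrder A]

theorem Pos.starMul_sqrt [StarOrderedRing A] (a : Pos A) : Pos.starMul (a.sqrt : A) = a :=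
  Subtype.ext (by rw [Pos.coe_starMul, Pos.star_eq, Pos.sqrt_mul_sqrt])

variable [StarOrderedRing A]

theorem Pos.conj_le (a : Pos A) (w : A) (ha : ‖(a : A)‖ ≤ 1) :
    (a.conj w : A) ≤ Pos.starMul w := by
  refine (CStarAlgebra.star_left_conjugate_le_norm_smul (IsSelfAdjoint.of_nonneg a.2)).trans ?_
  calc ‖(a : A)‖ • (star w * w) ≤ (1 : ℝ) • (star w * w) :=
        smul_le_smul_of_nonneg_right ha (star_mul_self_nonneg w)
    _ = _ := one_smul _ _

theorem tendsto_conj {I : Type*} {l : Filter I} {e : I → Pos A} {x : A}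
    (h : Tendsto (fun i => (e i : A) * x) l (𝓝 x)) :
    Tendsto (fun i => (e i).conj x) l (𝓝 (Pos.starMul x)) := by
  rw [tendsto_subtype_rng]
  simpa only [Pos.coe_conj, Pos.coe_starMul, mul_assoc] using h.const_mul (star x)

/-- An increasing net `ω` of positive functionals that behaves as `ω i x = τ (√(e i) x √(e i))` does
for a trace `τ` and an approximate unit `e` on which `τ` is finite. -/
structure IsTraceNet {I : Type*} [Preorder I] (e : I → Pos A) (ω : I → Pos A → ℝ) : Prop where
  isPosFun : ∀ i, IsPosFun (ω i)
  mono : ∀ x, Monotone fun i => ω i x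
  norm_le_one : ∀ i, ‖(e i : A)‖ ≤ 1
  symm : ∀ i j x, ω i ((e j).conj x) = ω j ((e i).conj (star x))
  tendsto_mul : ∀ x : A, Tendsto (fun i => (e i : A) * x) atTop (𝓝 x)

namespace IsTraceNet

variable {I : Type*} [Preorder I] [IsDirected I (· ≤ ·)] [Nonempty I] {e : I → Pos A}
  {ω : I → Pos A → ℝ}

theorem iSup_starMul_le (h : IsTraceNet e ω) (x : A) :
    ⨆ i, ENNReal.ofReal (ω i (Pos.starMul x)) ≤
      ⨆ i, ENNReal.ofReal (ω i (Pos.starMul (star x))) := by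
  refine iSup_le fun i => ?_
  have hlim : Tendsto (fun j => ENNReal.ofReal (ω i ((e j).conj x))) atTop
      (𝓝 (ENNReal.ofReal (ω i (Pos.starMul x)))) :=
    ((ENNReal.continuous_ofReal.comp (h.isPosFun i).continuous).tendsto _).comp
      (tendsto_conj (h.tendsto_mul x))
  refine le_of_tendsto' hlim fun j => ?_
  rw [h.symm]
  refine (ENNReal.ofReal_le_ofReal ((h.isPosFun j).mono (Pos.conj_le _ _ (h.norm_le_one i)))).trans
    (le_iSup (fun j => ENNReal.ofReal (ω j (Pos.starMul (star x)))) j)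

theorem isTrace_iSup (h : IsTraceNet e ω) : IsTrace fun x => ⨆ i, ENNReal.ofReal (ω i x) where
  add a b := by
    have hmono (x : Pos A) : Monotone fun i => ENNReal.ofReal (ω i x) := fun i j hij =>
      ENNReal.ofReal_le_ofReal (h.mono x hij)
    rw [ENNReal.iSup_add_iSup_of_monotone (hmono a) (hmono b)]
    exact iSup_congr fun i => by
      rw [(h.isPosFun i).add,
        ENNReal.ofReal_add ((h.isPosFun i).nonneg _) ((h.isPosFun i).nonneg _)]
  scale t a := by
    rw [ENNReal.mul_iSup]
    exact iSup_congr fun i => by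
      rw [(h.isPosFun i).scale, ENNReal.ofReal_mul (NNReal.coe_nonneg t), ENNReal.ofReal_coe_nnreal]
  tracial x := (h.iSup_starMul_le x).antisymm (by simpa using h.iSup_starMul_le (star x))

theorem denselyFinite_iSup (h : IsTraceNet e ω) :
    DenselyFinite fun x => ⨆ i, ENNReal.ofReal (ω i x) := by
  intro y
  have hlim := tendsto_conj (h.tendsto_mul (y.sqrt : A))
  rw [Pos.starMul_sqrt] at hlim
  refine mem_closure_of_tendsto hlim (Eventually.of_forall fun i => ?_)
  refine (iSup_le fun j => ?_).trans_lt
    (ENNReal.ofReal_lt_top (r := ω i (Pos.starMul (star (y.sqrt : A)))))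
  rw [h.symm]
  exact ENNReal.ofReal_le_ofReal ((h.isPosFun i).mono (Pos.conj_le _ _ (h.norm_le_one j)))

/-- The supremum of a trace net, as a trace in `LTC(A)`. -/
def toLTC (h : IsTraceNet e ω) : LTC A :=
  ⟨fun x => ⨆ i, ENNReal.ofReal (ω i x), h.isTrace_iSup,
    lowerSemicontinuous_iSup fun i =>
      (ENNReal.continuous_ofReal.comp (h.isPosFun i).continuous).lowerSemicontinuous,
    h.denselyFinite_iSup⟩

theorem toLTC_apply (h : IsTraceNet e ω) (x : Pos A) :
    h.toLTC x = ⨆ i, ENNReal.ofReal (ω i x) := rfl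

end IsTraceNet

end TraceNet

section PedTrace

variable {A : Type*} [NonUnitalCStarAlgebra A] [PartialOrder A]

@[ext]
theorem PedPos.ext {a b : PedPos A} (h : (a.1 : A) = b.1) : a = b := Subtype.ext (Subtype.ext h)

variable [StarOrderedRing A]

theorem Pos.starMul_sqrt_mul (s : Pos A) (x : A) : Pos.starMul ((s.sqrt : A) * x) = s.conj x := by
  refine Subtype.ext ?_
  rw [Pos.coe_starMul, Pos.coe_conj, star_mul, Pos.star_eq, ← s.sqrt_mul_sqrt]
  simp only [mul_assoc]

theorem Pos.starMul_star_mul (x y : A) :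
    Pos.starMul (star (y * x)) = (Pos.starMul (star x)).conj (star y) := by
  refine Subtype.ext ?_
  simp only [Pos.coe_starMul, Pos.coe_conj, star_mul, star_star, mul_assoc]

namespace PedPos

instance : Add (PedPos A) := ⟨fun a b => ⟨a.1 + b.1, Submodule.add_mem _ a.2 b.2⟩⟩

instance : SMul ℝ≥0 (PedPos A) := ⟨fun t a => ⟨a.1.scale t, by
  rw [Pos.coe_scale, ← Complex.coe_smul]
  exact Submodule.smul_mem _ _ a.2⟩⟩

/-- The element `w* a w` of `K(A)₊`. -/
def conj (a : PedPos A) (w : A) : PedPos A :=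
  ⟨a.1.conj w, pedersenIdeal.mul_mem_right _ (pedersenIdeal.mul_mem_left _ a.2)⟩

theorem smul_val (t : ℝ≥0) (a : PedPos A) : (t • a).1 = a.1.scale t := rfl

theorem conj_val (a : PedPos A) (w : A) : (a.conj w).1 = a.1.conj w := rfl

theorem exists_add_of_le {a b : PedPos A} (h : (a.1 : A) ≤ b.1) : ∃ c : PedPos A, b = a + c :=
  ⟨⟨⟨(b.1 : A) - a.1, sub_nonneg.2 h⟩, Submodule.sub_mem _ b.2 a.2⟩,
    ext (add_sub_cancel _ _).symm⟩

end PedPos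

/-- The restrictions of traces to `K(A)₊`, characterized by relations among values on `K(A)₊`.
The last two express that `φ (x* e x) = φ (√e x x* √e)` is additive in `x x*`, and symmetric in
`e` and `f` for `x x*` replaced by `x* f x`. As no relation involves the order of the values, `φ`
may take values in any cone, and the relations pass to limits and to images under linear maps. -/
structure IsPedTrace {M : Type*} [AddCommMonoid M] [Module ℝ≥0 M] (φ : PedPos A → M) : Prop where
  add : ∀ a b, φ (a + b) = φ a + φ b
  smul : ∀ (t : ℝ≥0) (a), φ (t • a) = t • φ a
  conj_add : ∀ (e : PedPos A) (x y z : A), z * star z = x * star x + y * star y →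
    φ (e.conj z) = φ (e.conj x) + φ (e.conj y)
  conj_symm : ∀ (e f : PedPos A) (x y z : A), y * star y = star x * f.1 * x →
    z * star z = x * e.1 * star x → φ (e.conj y) = φ (f.conj z)

namespace IsPedTrace

variable {M N : Type*} [AddCommMonoid M] [Module ℝ≥0 M] [AddCommMonoid N] [Module ℝ≥0 N]

theorem comp {φ : PedPos A → M} (hφ : IsPedTrace φ) (f : M →ₗ[ℝ≥0] N) :
    IsPedTrace fun a => f (φ a) where
  add a b := by rw [hφ.add, map_add]
  smul t a := by rw [hφ.smul, map_smul]
  conj_add e x y z hz := by rw [hφ.conj_add e x y z hz, map_add]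
  conj_symm e f x y z hy hz := by rw [hφ.conj_symm e f x y z hy hz]

theorem pi {ι : Type*} {φ : PedPos A → ι → M} (h : ∀ i, IsPedTrace fun a => φ a i) :
    IsPedTrace φ where
  add a b := funext fun i => (h i).add a b
  smul t a := funext fun i => (h i).smul t a
  conj_add e x y z hz := funext fun i => (h i).conj_add e x y z hz
  conj_symm e f x y z hy hz := funext fun i => (h i).conj_symm e f x y z hy hz

theorem of_injective {φ : PedPos A → M} (f : M →ₗ[ℝ≥0] N) (hf : Function.Injective f)
    (h : IsPedTrace fun a => f (φ a)) : IsPedTrace φ where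
  add a b := hf ((h.add a b).trans (map_add f _ _).symm)
  smul t a := hf ((h.smul t a).trans (map_smul f _ _).symm)
  conj_add e x y z hz := hf ((h.conj_add e x y z hz).trans (map_add f _ _).symm)
  conj_symm e f x y z hy hz := hf (h.conj_symm e f x y z hy hz)

theorem of_add_left [IsCancelAdd M] {φ ψ : PedPos A → M} (hφ : IsPedTrace φ)
    (h : IsPedTrace fun a => φ a + ψ a) : IsPedTrace ψ where
  add a b := by
    have := h.add a b
    rw [hφ.add, add_add_add_comm (φ a)] at this
    exact add_left_cancel this
  smul t a := by
    have := h.smul t a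
    rw [hφ.smul, smul_add] at this
    exact add_left_cancel this
  conj_add e x y z hz := by
    have := h.conj_add e x y z hz
    rw [hφ.conj_add e x y z hz, add_add_add_comm (φ _)] at this
    exact add_left_cancel this
  conj_symm e f x y z hy hz := by
    have := h.conj_symm e f x y z hy hz
    rw [hφ.conj_symm e f x y z hy hz] at this
    exact add_left_cancel this

theorem of_coe {φ : PedPos A → ℝ≥0} (h : IsPedTrace fun a => (φ a : ℝ≥0∞)) : IsPedTrace φ :=
  of_injective (Algebra.linearMap ℝ≥0 ℝ≥0∞) ENNReal.coe_injective h

theorem of_tendsto {I : Type*} {l : Filter I} [l.NeBot] {φ : I → PedPos A → ℝ≥0}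
    {ψ : PedPos A → ℝ≥0} (hφ : ∀ i, IsPedTrace (φ i))
    (h : ∀ a, Tendsto (fun i => φ i a) l (𝓝 (ψ a))) : IsPedTrace ψ where
  add a b := tendsto_nhds_unique (h _)
    (((h a).add (h b)).congr fun i => ((hφ i).add a b).symm)
  smul t a := tendsto_nhds_unique (h _)
    (((h a).const_smul t).congr fun i => ((hφ i).smul t a).symm)
  conj_add e x y z hz := tendsto_nhds_unique (h _)
    (((h _).add (h _)).congr fun i => ((hφ i).conj_add e x y z hz).symm)
  conj_symm e f x y z hy hz := tendsto_nhds_unique (h _)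
    ((h _).congr fun i => ((hφ i).conj_symm e f x y z hy hz).symm)

theorem of_lt_top {τ μ : Pos A → ℝ≥0∞} (hτ : IsTrace τ) (hK : ∀ k : PedPos A, τ k.1 < ∞)
    (hadd : ∀ a b, τ a < ∞ → τ b < ∞ → μ (a + b) = μ a + μ b)
    (hscale : ∀ (t : ℝ≥0) a, τ a < ∞ → μ (a.scale t) = t * μ a)
    (htr : ∀ x, τ (Pos.starMul x) < ∞ → μ (Pos.starMul x) = μ (Pos.starMul (star x))) :
    IsPedTrace fun k : PedPos A => μ k.1 := by
  have hstar (e : PedPos A) (x : A) : Pos.starMul (star ((e.1.sqrt : A) * x)) =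
      (Pos.starMul (star x)).conj (e.1.sqrt : A) := by
    rw [Pos.starMul_star_mul, Pos.star_eq]
  have hconj (e : PedPos A) (x : A) :
      μ (e.1.conj x) = μ ((Pos.starMul (star x)).conj (e.1.sqrt : A)) := by
    rw [← Pos.starMul_sqrt_mul, ← hstar]
    exact htr _ (by rw [Pos.starMul_sqrt_mul]; exact hK (e.conj x))
  have hfin (e : PedPos A) (x : A) : τ ((Pos.starMul (star x)).conj (e.1.sqrt : A)) < ∞ := by
    rw [← hstar, ← hτ.tracial, Pos.starMul_sqrt_mul]
    exact hK (e.conj x)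
  refine ⟨fun a b => hadd _ _ (hK a) (hK b), fun t a => hscale t _ (hK a), ?_, ?_⟩
  · intro e x y z hz
    simp only [PedPos.conj_val, hconj]
    rw [← hadd _ _ (hfin _ _) (hfin _ _)]
    refine congrArg μ (Subtype.ext ?_)
    simp only [Nonneg.coe_add, Pos.coe_conj, Pos.coe_starMul, star_star, hz, mul_add, add_mul]
  · intro e f x y z hy hz
    have hy' : (Pos.starMul (star y)).conj (e.1.sqrt : A) =
        Pos.starMul ((f.1.sqrt : A) * (x * e.1.sqrt)) := by
      refine Subtype.ext ?_
      rw [Pos.starMul_sqrt_mul]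
      simp only [Pos.coe_conj, Pos.coe_starMul, star_star, hy, star_mul, mul_assoc]
    have hz' : (Pos.starMul (star z)).conj (f.1.sqrt : A) =
        Pos.starMul (star ((f.1.sqrt : A) * (x * e.1.sqrt))) := by
      refine Subtype.ext ?_
      rw [hstar]
      simp only [Pos.coe_conj, Pos.coe_starMul, star_star, hz, star_mul, Pos.star_eq]
      rw [← e.1.sqrt_mul_sqrt]
      simp only [mul_assoc]
    simp only [PedPos.conj_val, hconj]
    rw [hy', hz']
    exact htr _ (hy' ▸ hfin _ _)

end IsPedTrace

theorem IsTrace.isPedTrace {τ : Pos A → ℝ≥0∞} (hτ : IsTrace τ) :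
    IsPedTrace fun k : PedPos A => τ k.1 :=
  .of_lt_top (τ := 0) ⟨by simp, by simp, by simp⟩ (by simp) (fun a b _ _ => hτ.add a b)
    (fun t a _ => hτ.scale t a) fun x _ => hτ.tracial x

theorem LTC.isPedTrace_restrict (τ : LTC A) : IsPedTrace (LTC.restrict A τ) := by
  refine .of_coe ?_
  simp only [LTC.coe_restrict]
  exact τ.2.1.isPedTrace

end PedTrace

section Extension

variable {A : Type*} [NonUnitalCStarAlgebra A] [PartialOrder A] [StarOrderedRing A]

/-- The element of `K(A)₊` given by an element of `PedBall A`. -/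
def PedBall.toPed (e : PedBall A) : PedPos A := ⟨e.1, e.2.1⟩

/-- The functional `x ↦ φ (√x e √x)` on `A₊`. If `φ` is the restriction of a trace `τ`, its value
is `τ (√e x √e)`. -/
def cutFun (φ : PedPos A → ℝ≥0) (e : PedPos A) (x : Pos A) : ℝ := φ (e.conj (x.sqrt : A))

namespace IsPedTrace

variable {φ : PedPos A → ℝ≥0}

theorem mono (hφ : IsPedTrace φ) {a b : PedPos A} (h : (a.1 : A) ≤ b.1) : φ a ≤ φ b := by
  obtain ⟨c, rfl⟩ := PedPos.exists_add_of_le h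
  rw [hφ.add]
  exact le_self_add

theorem eq_zero (hφ : IsPedTrace φ) {z : PedPos A} (hz : (z.1 : A) = 0) : φ z = 0 := by
  have h : (0 : ℝ≥0) • z = z :=
    PedPos.ext (by rw [PedPos.smul_val, Pos.coe_scale, hz, smul_zero])
  rw [← h, hφ.smul, zero_smul]

theorem conj_congr (hφ : IsPedTrace φ) (e : PedPos A) {x y : A} (h : x * star x = y * star y) :
    φ (e.conj x) = φ (e.conj y) := by
  have h0 : φ (e.conj 0) = 0 := hφ.eq_zero (by simp [PedPos.conj_val, Pos.coe_conj])
  rw [hφ.conj_add e y 0 x (by simpa using h), h0, add_zero]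

theorem cutFun_starMul (hφ : IsPedTrace φ) (e : PedPos A) (x : A) :
    cutFun φ e (Pos.starMul x) = φ (e.conj (star x)) :=
  congrArg NNReal.toReal (hφ.conj_congr e (by
    rw [Pos.star_eq, Pos.sqrt_mul_sqrt, Pos.coe_starMul, star_star]))

theorem isPosFun_cutFun (hφ : IsPedTrace φ) (e : PedPos A) : IsPosFun (cutFun φ e) where
  nonneg _ := NNReal.coe_nonneg _
  add x y := by
    rw [cutFun, hφ.conj_add e (x.sqrt : A) (y.sqrt : A), NNReal.coe_add]
    · rfl
    · simp only [Pos.star_eq, Pos.sqrt_mul_sqrt, Nonneg.coe_add]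
  scale t x := by
    have hsqrt : Pos.starMul ((NNReal.sqrt t : ℝ) • (x.sqrt : A)) = x.scale t := by
      refine Subtype.ext ?_
      rw [Pos.coe_starMul, star_smul, smul_mul_smul_comm, star_trivial, ← NNReal.coe_mul,
        NNReal.mul_self_sqrt, Pos.star_eq, Pos.sqrt_mul_sqrt, Pos.coe_scale]
    have hconj : e.conj (star ((NNReal.sqrt t : ℝ) • (x.sqrt : A))) = t • e.conj (x.sqrt : A) := by
      ext
      simp only [PedPos.conj_val, PedPos.smul_val, Pos.coe_conj, Pos.coe_scale, star_smul,
        smul_mul_assoc, mul_smul_comm, smul_smul, star_trivial, Pos.star_eq]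
      rw [← NNReal.coe_mul, NNReal.mul_self_sqrt]
    rw [← hsqrt, hφ.cutFun_starMul, hconj, hφ.smul, smul_eq_mul, NNReal.coe_mul]
    rfl

theorem cutFun_mono (hφ : IsPedTrace φ) {e f : PedPos A} (h : (e.1 : A) ≤ f.1) (x : Pos A) :
    cutFun φ e x ≤ cutFun φ f x :=
  NNReal.coe_le_coe.2 (hφ.mono (star_left_conjugate_le_conjugate h _))

theorem cutFun_conj (hφ : IsPedTrace φ) (e f : PedPos A) (x : A) :
    cutFun φ e (f.1.conj x) = cutFun φ f (e.1.conj (star x)) :=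
  congrArg NNReal.toReal (hφ.conj_symm e f x _ _
    (by rw [Pos.star_eq, Pos.sqrt_mul_sqrt, Pos.coe_conj])
    (by rw [Pos.star_eq, Pos.sqrt_mul_sqrt, Pos.coe_conj, star_star]))

theorem tendsto_cutFun_of_mem_conjCone (hφ : IsPedTrace φ) {p : Pos A}
    (hp : p ∈ conjCone (unitSet A)) : ∃ hpK : (p : A) ∈ pedersenIdeal A,
      Tendsto (fun e : PedBall A => cutFun φ e.toPed p) atTop (𝓝 (φ ⟨p, hpK⟩)) := by
  induction hp using AddSubmonoid.closure_induction with
  | mem p h =>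
    obtain ⟨f, hf, w, rfl⟩ := h
    let f' : PedPos A := ⟨f, mem_pedersenIdeal_of_mem_unitSet hf⟩
    refine ⟨(f'.conj w).2, ?_⟩
    have hlim := ((hφ.isPosFun_cutFun f').continuous.tendsto _).comp
      (tendsto_conj (tendsto_pedBall_mul (star w)))
    rw [hφ.cutFun_starMul, star_star] at hlim
    exact hlim.congr fun e => (hφ.cutFun_conj e.toPed f' w).symm
  | zero =>
    refine ⟨zero_mem _, ?_⟩
    rw [hφ.eq_zero (z := ⟨0, zero_mem _⟩) rfl]
    exact tendsto_const_nhds.congr fun e => (hφ.isPosFun_cutFun e.toPed).zero.symm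
  | add p q _ _ hp hq =>
    obtain ⟨hpK, hp⟩ := hp
    obtain ⟨hqK, hq⟩ := hq
    have hadd : φ ⟨p + q, Submodule.add_mem _ hpK hqK⟩ = φ ⟨p, hpK⟩ + φ ⟨q, hqK⟩ :=
      hφ.add ⟨p, hpK⟩ ⟨q, hqK⟩
    refine ⟨Submodule.add_mem _ hpK hqK, ?_⟩
    rw [hadd, NNReal.coe_add]
    exact (hp.add hq).congr fun e => ((hφ.isPosFun_cutFun e.toPed).add p q).symm

theorem tendsto_cutFun (hφ : IsPedTrace φ) (k : PedPos A) :
    Tendsto (fun e : PedBall A => cutFun φ e.toPed k.1) atTop (𝓝 (φ k)) := by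
  obtain ⟨n, hn, p, hp, rfl⟩ := exists_add_eq_of_mem_idealSpan
    (pedersenIdeal_le_idealSpan_unitSet A k.2)
  obtain ⟨hnK, hn⟩ := hφ.tendsto_cutFun_of_mem_conjCone hn
  obtain ⟨hpK, hp⟩ := hφ.tendsto_cutFun_of_mem_conjCone hp
  have hadd : φ ⟨k.1 + n, hpK⟩ = φ k + φ ⟨n, hnK⟩ := hφ.add k ⟨n, hnK⟩
  have hsub := hp.sub hn
  rw [hadd, NNReal.coe_add, add_sub_cancel_right] at hsub
  exact hsub.congr fun e => by rw [(hφ.isPosFun_cutFun e.toPed).add, add_sub_cancel_right]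

theorem isTraceNet_cutFun (hφ : IsPedTrace φ) :
    IsTraceNet (fun e : PedBall A => e.1) fun e => cutFun φ e.toPed where
  isPosFun e := hφ.isPosFun_cutFun e.toPed
  mono x _ _ hef := hφ.cutFun_mono hef x
  norm_le_one e := e.2.2.le
  symm e f x := hφ.cutFun_conj e.toPed f.toPed x
  tendsto_mul := tendsto_pedBall_mul

theorem restrict_toLTC_isTraceNet_cutFun (hφ : IsPedTrace φ) :
    LTC.restrict A hφ.isTraceNet_cutFun.toLTC = φ := by
  funext k
  have hlim := (ENNReal.continuous_ofReal.tendsto _).comp (hφ.tendsto_cutFun k)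
  rw [← ENNReal.coe_inj, LTC.coe_restrict, IsTraceNet.toLTC_apply,
    ← ENNReal.ofReal_coe_nnreal (p := φ k)]
  exact tendsto_nhds_unique (tendsto_atTop_iSup fun e f hef =>
    ENNReal.ofReal_le_ofReal (hφ.isTraceNet_cutFun.mono k.1 hef)) hlim

theorem exists_restrict_eq (hφ : IsPedTrace φ) : ∃ τ : LTC A, LTC.restrict A τ = φ :=
  ⟨_, hφ.restrict_toLTC_isTraceNet_cutFun⟩

end IsPedTrace

namespace LTC

theorem iSup_cutFun (τ : LTC A) (x : Pos A) :
    ⨆ e : PedBall A, ENNReal.ofReal (cutFun (restrict A τ) e.toPed x) = τ x := by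
  have hcut (e : PedBall A) :
      ENNReal.ofReal (cutFun (restrict A τ) e.toPed x) = τ (e.1.conj (x.sqrt : A)) := by
    rw [cutFun, ENNReal.ofReal_coe_nnreal, coe_restrict]
    rfl
  simp only [hcut]
  refine le_antisymm (iSup_le fun e => ?_) ?_
  · refine τ.2.1.mono ((Pos.conj_le _ _ e.2.2.le).trans_eq ?_)
    rw [Pos.starMul_sqrt]
  · have hlim := tendsto_conj (tendsto_pedBall_mul (x.sqrt : A))
    rw [Pos.starMul_sqrt] at hlim
    refine le_of_forall_lt fun c hc => ?_
    obtain ⟨e, he⟩ := (hlim.eventually (τ.2.2.1 x c hc)).exists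
    exact he.trans_le (le_iSup (fun e : PedBall A => τ (e.1.conj (x.sqrt : A))) e)

theorem apply_le_apply_of_restrict_le {σ τ : LTC A} (h : restrict A σ ≤ restrict A τ)
    (x : Pos A) : σ x ≤ τ x := by
  rw [← iSup_cutFun σ, ← iSup_cutFun τ]
  exact iSup_mono fun e => ENNReal.ofReal_le_ofReal (NNReal.coe_le_coe.2 (h _))

variable (A) in
theorem restrict_injective : Function.Injective (restrict A) := fun _ _ h =>
  Subtype.ext (funext fun x => (apply_le_apply_of_restrict_le h.le x).antisymm
    (apply_le_apply_of_restrict_le h.ge x))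

variable (A) in
theorem isClosed_range_restrict : IsClosed (Set.range (restrict A)) := by
  refine isClosed_of_closure_subset fun φ hφ => ?_
  have : (comap ((↑) : Set.range (restrict A) → PedPos A → ℝ≥0) (𝓝 φ)).NeBot :=
    mem_closure_iff_comap_neBot.1 hφ
  refine (IsPedTrace.of_tendsto (φ := ((↑) : Set.range (restrict A) → _)) (fun x => ?_)
    (tendsto_pi_nhds.1 tendsto_comap)).exists_restrict_eq
  obtain ⟨τ, hτ⟩ := x.2
  exact hτ ▸ isPedTrace_restrict τ

end LTC

end Extension

section Riesz

variable {A : Type*} [NonUnitalCStarAlgebra A] [PartialOrder A] [StarOrderedRing A]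

theorem abs_sub_div_mul_sub_le {ε t : ℝ} (hε : 0 < ε) (ht : 0 ≤ t) :
    |t - t ^ 2 / (t ^ 2 + ε ^ 2) * t -
      (t - t ^ 2 / (t ^ 2 + ε ^ 2) * t) * (t ^ 2 / (t ^ 2 + ε ^ 2))| ≤ ε := by
  have hpos : 0 < t ^ 2 + ε ^ 2 := by positivity
  have heq : t - t ^ 2 / (t ^ 2 + ε ^ 2) * t -
      (t - t ^ 2 / (t ^ 2 + ε ^ 2) * t) * (t ^ 2 / (t ^ 2 + ε ^ 2)) =
      t * ε ^ 4 / (t ^ 2 + ε ^ 2) ^ 2 := by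
    field_simp
    ring
  rw [heq, abs_of_nonneg (by positivity), div_le_iff₀ (by positivity)]
  have hmul : t * ε ≤ t ^ 2 + ε ^ 2 := by nlinarith [sq_nonneg (t - ε)]
  have hsq : ε ^ 2 ≤ t ^ 2 + ε ^ 2 := le_add_of_nonneg_left (sq_nonneg t)
  calc t * ε ^ 4 = ε * ((t * ε) * ε ^ 2) := by ring
    _ ≤ ε * ((t ^ 2 + ε ^ 2) * (t ^ 2 + ε ^ 2)) := by gcongr
    _ = ε * (t ^ 2 + ε ^ 2) ^ 2 := by ring

-- The element `q` is `√(y / (y² + ε²))`, so that `q y q = y² / (y² + ε²)`.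
theorem Pos.exists_commute_norm_sub_le (y : Pos A) {ε : ℝ} (hε : 0 < ε) :
    ∃ q : A, star q = q ∧ Commute q y ∧ ‖q * y * q‖ ≤ 1 ∧
      ‖(y : A) - q * y * q * y - (y - q * y * q * y) * (q * y * q)‖ ≤ ε := by
  have hy : IsSelfAdjoint (y : A) := .of_nonneg y.2
  have hpos (t : ℝ) : 0 < t ^ 2 + ε ^ 2 := by positivity
  have hspec {t : ℝ} (ht : t ∈ quasispectrum ℝ (y : A)) : 0 ≤ t :=
    quasispectrum_nonneg_of_nonneg (y : A) y.2 t ht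
  let fq : ℝ → ℝ := fun t => √(t / (t ^ 2 + ε ^ 2))
  let fk : ℝ → ℝ := fun t => t ^ 2 / (t ^ 2 + ε ^ 2)
  have hfq : Continuous fq := by fun_prop (disch := intro t; exact (hpos t).ne')
  have hfk : Continuous fk := by fun_prop (disch := intro t; exact (hpos t).ne')
  have hid : cfcₙ (fun t : ℝ => t) (y : A) = y := cfcₙ_id' ℝ (y : A) hy
  have hk : cfcₙ fq (y : A) * y * cfcₙ fq (y : A) = cfcₙ fk (y : A) := by
    nth_rewrite 2 [← hid]
    rw [← cfcₙ_mul fq _ (y : A), ← cfcₙ_mul _ fq (y : A) (by fun_prop) (by simp)]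
    refine cfcₙ_congr fun t ht => ?_
    calc fq t * t * fq t = fq t * fq t * t := by ring
      _ = t / (t ^ 2 + ε ^ 2) * t := by
        rw [Real.mul_self_sqrt (div_nonneg (hspec ht) (hpos t).le)]
      _ = fk t := by ring
  refine ⟨cfcₙ fq (y : A), (cfcₙ_predicate fq (y : A)).star_eq,
    (Commute.refl (y : A)).cfcₙ_real fq, ?_, ?_⟩
  · rw [hk]
    refine norm_cfcₙ_le fun t _ => ?_
    rw [Real.norm_of_nonneg (by positivity), div_le_one (hpos t)]
    exact le_add_of_nonneg_right (sq_nonneg ε)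
  · have herr : (y : A) - cfcₙ fk (y : A) * y - (y - cfcₙ fk (y : A) * y) * cfcₙ fk (y : A) =
        cfcₙ (fun t => t - fk t * t - (t - fk t * t) * fk t) (y : A) := by
      rw [cfcₙ_sub _ _ (y : A) (by fun_prop) (by simp) (by fun_prop) (by simp),
        cfcₙ_mul _ fk (y : A) (by fun_prop) (by simp),
        cfcₙ_sub _ _ (y : A) (by fun_prop) rfl (by fun_prop) (by simp),
        cfcₙ_mul fk _ (y : A), hid]
    rw [hk, herr]
    exact norm_cfcₙ_le fun t ht => abs_sub_div_mul_sub_le hε (hspec ht)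

theorem Pos.norm_conj_mul_mul_star_le_one {x q : A} {y : Pos A} (hy : (y : A) ≤ star x * x)
    (hq : star q = q) (hqn : ‖q * (star x * x) * q‖ ≤ 1) :
    ‖(y.conj (q * q * star x) : A)‖ ≤ 1 := by
  have hle : (y.conj (q * q * star x) : A) ≤
      star (star (q * star x) * (q * star x)) * (star (q * star x) * (q * star x)) := by
    refine (star_left_conjugate_le_conjugate hy _).trans_eq ?_
    simp only [star_mul, star_star, hq, mul_assoc]
  have hone : ‖star (q * star x) * (q * star x)‖ ≤ 1 := by
    rw [CStarRing.norm_star_mul_self, ← CStarRing.norm_self_mul_star]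
    simpa only [star_mul, star_star, hq, mul_assoc] using hqn
  refine (CStarAlgebra.norm_le_norm_of_nonneg_of_le (y.conj _).2 hle).trans ?_
  rw [CStarRing.norm_star_mul_self]
  exact mul_le_one₀ hone (norm_nonneg _) hone

theorem Pos.conj_conj_mul_mul_star {x q : A} (y : Pos A) (hqx : Commute q (star x * x)) :
    (y.conj (q * q * star x)).conj x = y.conj (q * (star x * x) * q) := by
  have hright : q * q * (star x * x) = q * (star x * x) * q := by
    rw [mul_assoc, mul_assoc q (star x * x), ← hqx.eq]
  refine Subtype.ext ?_
  calc star x * (star (q * q * star x) * y * (q * q * star x)) * x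
      = star (q * q * (star x * x)) * y * (q * q * (star x * x)) := by
        simp only [star_mul, star_star, mul_assoc]
    _ = _ := by rw [hright, Pos.coe_conj]

theorem Pos.norm_mul_sqrt_sub_sqrt_sq_le {y₁ y : Pos A} (h : (y₁ : A) ≤ y) {k : A}
    (hk : star k = k) :
    ‖k * (y₁.sqrt : A) - y₁.sqrt‖ ^ 2 ≤ ‖(y : A) - k * y - (y - k * y) * k‖ := by
  have hexpand (z : Pos A) : (k * (z.sqrt : A) - z.sqrt) * star (k * (z.sqrt : A) - z.sqrt) =
      z - k * z - (z - k * z) * k := by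
    rw [← z.sqrt_mul_sqrt]
    simp only [star_sub, star_mul, Pos.star_eq, hk]
    noncomm_ring
  rw [sq, ← CStarRing.norm_self_mul_star]
  refine CStarAlgebra.norm_le_norm_of_nonneg_of_le (mul_star_self_nonneg _) ?_
  let y₂ : Pos A := ⟨(y : A) - y₁, sub_nonneg.2 h⟩
  have hy₂ := mul_star_self_nonneg (k * (y₂.sqrt : A) - y₂.sqrt)
  rw [hexpand] at hy₂ ⊢
  rw [← sub_nonneg]
  refine hy₂.trans_eq ?_
  simp only [y₂]
  noncomm_ring

theorem tendsto_conj_of_le {I : Type*} {l : Filter I} {k : I → A} (hk : ∀ i, star (k i) = k i)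
    {y₁ y : Pos A} (h : (y₁ : A) ≤ y)
    (hlim : Tendsto (fun i => (y : A) - k i * y - (y - k i * y) * k i) l (𝓝 0)) :
    Tendsto (fun i => y₁.conj (k i)) l (𝓝 y₁) := by
  have hsqrt : Tendsto (fun i => k i * (y₁.sqrt : A)) l (𝓝 (y₁.sqrt : A)) := by
    rw [tendsto_iff_norm_sub_tendsto_zero]
    refine squeeze_zero (fun i => norm_nonneg _)
      (fun i => Real.le_sqrt_of_sq_le (Pos.norm_mul_sqrt_sub_sqrt_sq_le h (hk i))) ?_
    simpa using hlim.norm.sqrt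
  rw [tendsto_subtype_rng]
  have hmul := hsqrt.mul hsqrt.star
  rw [Pos.star_eq, Pos.sqrt_mul_sqrt] at hmul
  refine hmul.congr fun i => ?_
  rw [Pos.coe_conj, star_mul, Pos.star_eq, hk, ← y₁.sqrt_mul_sqrt]
  simp only [mul_assoc]

theorem IsTrace.conj_eq {τ : Pos A → ℝ≥0∞} (hτ : IsTrace τ) (s : Pos A) (x : A) :
    τ (s.conj x) = τ ((Pos.starMul (star x)).conj (s.sqrt : A)) := by
  rw [← Pos.starMul_sqrt_mul, hτ.tracial, Pos.starMul_star_mul, Pos.star_eq]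

theorem IsTrace.conj_sqrt {τ : Pos A → ℝ≥0∞} (hτ : IsTrace τ) (s w : Pos A) :
    τ (s.conj (w.sqrt : A)) = τ (w.conj (s.sqrt : A)) := by
  rw [hτ.conj_eq, Pos.star_eq, Pos.starMul_sqrt]

theorem IsTrace.conj_le_self {τ : Pos A → ℝ≥0∞} (hτ : IsTrace τ) (y : Pos A) {k : A}
    (hk : ‖k‖ ≤ 1) : τ (y.conj k) ≤ τ y := by
  rw [hτ.conj_eq]
  calc τ ((Pos.starMul (star k)).conj (y.sqrt : A)) ≤ τ (Pos.starMul (y.sqrt : A)) := by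
        refine hτ.mono (Pos.conj_le _ _ ?_)
        rw [Pos.coe_starMul, star_star, CStarRing.norm_self_mul_star]
        exact mul_le_one₀ hk (norm_nonneg _) hk
    _ = τ y := by rw [Pos.starMul_sqrt]

-- The positive contraction is `s = x q² y₁ q² x*`, where `q²` is an approximate inverse of `x* x`,
-- so that `x* s x` is close to `y₁`.
theorem exists_contraction {σ ψ : Pos A → ℝ≥0∞} (hσ : IsTrace σ) (hψ : LowerSemicontinuous ψ)
    {x : A} {y₁ : Pos A} (h : (y₁ : A) ≤ star x * x) (hf : ψ y₁ ≠ ∞) {ε : ℝ≥0∞} (hε : ε ≠ 0) :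
    ∃ s : Pos A, ‖(s : A)‖ ≤ 1 ∧ σ (s.conj x) ≤ σ y₁ ∧ ψ y₁ ≤ ψ (s.conj x) + ε := by
  choose q hq hqx hqn hlim using fun n : ℕ =>
    (Pos.starMul x).exists_commute_norm_sub_le (ε := 1 / ((n : ℝ) + 1)) (by positivity)
  rw [Pos.coe_starMul] at hqx hqn hlim
  have hconv : Tendsto (fun n => y₁.conj (q n * (star x * x) * q n)) atTop (𝓝 y₁) :=
    tendsto_conj_of_le (y := Pos.starMul x)
      (fun n => by simp only [star_mul, star_star, hq, mul_assoc]) h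
      (squeeze_zero_norm hlim tendsto_one_div_add_atTop_nhds_zero_nat)
  obtain ⟨n, hn⟩ : ∃ n, ψ y₁ ≤ ψ (y₁.conj (q n * (star x * x) * q n)) + ε := by
    rcases eq_or_ne (ψ y₁) 0 with h0 | h0
    · exact ⟨0, by simp [h0]⟩
    · obtain ⟨n, hn⟩ := (hconv.eventually (hψ y₁ _ (ENNReal.sub_lt_self hf h0 hε))).exists
      exact ⟨n, tsub_le_iff_right.1 hn.le⟩
  refine ⟨y₁.conj (q n * q n * star x), Pos.norm_conj_mul_mul_star_le_one h (hq n) (hqn n), ?_, ?_⟩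
  · rw [y₁.conj_conj_mul_mul_star (hqx n)]
    exact hσ.conj_le_self y₁ (hqn n)
  · rwa [y₁.conj_conj_mul_mul_star (hqx n)]

end Riesz

section Lattice

variable {A : Type*} [NonUnitalCStarAlgebra A] [PartialOrder A]

/-- The infimum of two traces, `y ↦ inf {σ y₁ + ψ y₂ : y₁ + y₂ = y}`. -/
def traceInf [IsOrderedAddMonoid A] (σ ψ : Pos A → ℝ≥0∞) (y : Pos A) : ℝ≥0∞ :=
  ⨅ p : {p : Pos A × Pos A // p.1 + p.2 = y}, σ p.1.1 + ψ p.1.2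

variable [StarOrderedRing A] {σ ψ : Pos A → ℝ≥0∞}

theorem traceInf_le {y y₁ y₂ : Pos A} (h : y₁ + y₂ = y) : traceInf σ ψ y ≤ σ y₁ + ψ y₂ :=
  iInf_le (fun p : {p : Pos A × Pos A // p.1 + p.2 = y} => σ p.1.1 + ψ p.1.2) ⟨(y₁, y₂), h⟩

theorem le_traceInf {y : Pos A} {c : ℝ≥0∞} (h : ∀ y₁ y₂ : Pos A, y₁ + y₂ = y → c ≤ σ y₁ + ψ y₂) :
    c ≤ traceInf σ ψ y :=
  le_iInf fun p => h _ _ p.2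

theorem traceInf_le_left (hψ : IsTrace ψ) (y : Pos A) : traceInf σ ψ y ≤ σ y := by
  simpa only [hψ.zero, add_zero] using traceInf_le (σ := σ) (ψ := ψ) (add_zero y)

theorem traceInf_le_right (hσ : IsTrace σ) (y : Pos A) : traceInf σ ψ y ≤ ψ y := by
  simpa only [hσ.zero, zero_add] using traceInf_le (σ := σ) (ψ := ψ) (zero_add y)

theorem traceInf_add_le (hσ : IsTrace σ) (hψ : IsTrace ψ) (a b : Pos A) :
    traceInf σ ψ (a + b) ≤ traceInf σ ψ a + traceInf σ ψ b := by
  refine ENNReal.le_iInf_add_iInf fun p q => ?_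
  rw [add_add_add_comm, ← hσ.add, ← hψ.add]
  refine traceInf_le ?_
  rw [add_add_add_comm, p.2, q.2]

theorem Pos.exists_conj_sqrt_add_eq {s : Pos A} (hs : ‖(s : A)‖ ≤ 1) (w : Pos A) :
    ∃ v : Pos A, s.conj (w.sqrt : A) + v = w := by
  have hle := Pos.conj_le s (w.sqrt : A) hs
  rw [Pos.starMul_sqrt] at hle
  exact ⟨⟨(w : A) - s.conj (w.sqrt : A), sub_nonneg.2 hle⟩, Subtype.ext (by simp)⟩

theorem IsTrace.conj_eq_add {τ : Pos A → ℝ≥0∞} (hτ : IsTrace τ) (s : Pos A) {x : A} {w w' : Pos A}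
    (h : Pos.starMul (star x) = w + w') :
    τ (s.conj x) = τ (s.conj (w.sqrt : A)) + τ (s.conj (w'.sqrt : A)) := by
  rw [hτ.conj_sqrt s w, hτ.conj_sqrt s w', hτ.conj_eq s x, h, ← hτ.add]
  refine congrArg τ (Subtype.ext ?_)
  simp [Pos.coe_conj, mul_add, add_mul]

-- If `x* x = y₁ + y₂` and `x x* = w + w'`, a positive contraction `s` with `x* s x` close to `y₁`
-- yields the decompositions `w = √w s √w + v` and `w' = √w' s √w' + v'`.
theorem traceInf_add_le_of_starMul_star_eq (hσ : IsTrace σ) (hψ : IsTrace ψ)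
    (hlsc : LowerSemicontinuous ψ) {x : A} {w w' : Pos A} (h : Pos.starMul (star x) = w + w')
    (hf : ψ (Pos.starMul x) < ∞) :
    traceInf σ ψ w + traceInf σ ψ w' ≤ traceInf σ ψ (Pos.starMul x) := by
  refine le_traceInf fun y₁ y₂ hy => ENNReal.le_of_forall_pos_le_add fun ε hε _ => ?_
  have hf₁ : ψ y₁ ≠ ∞ := ne_top_of_le_ne_top hf.ne (by rw [← hy, hψ.add]; exact le_self_add)
  have hy₁ : (y₁ : A) ≤ star x * x :=
    (le_add_of_nonneg_right y₂.2).trans_eq (congrArg Subtype.val hy)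
  obtain ⟨s, hs, hσs, hψs⟩ := exists_contraction hσ hlsc hy₁ hf₁ (ENNReal.coe_ne_zero.2 hε.ne')
  obtain ⟨v, hv⟩ := Pos.exists_conj_sqrt_add_eq hs w
  obtain ⟨v', hv'⟩ := Pos.exists_conj_sqrt_add_eq hs w'
  have hψv : ψ v + ψ v' ≤ ψ y₂ + ε := by
    have hsx : ψ (s.conj x) ≠ ∞ := ne_top_of_le_ne_top hf.ne (hψ.mono (Pos.conj_le s x hs))
    refine (ENNReal.add_le_add_iff_left hsx).1 ?_
    calc ψ (s.conj x) + (ψ v + ψ v') = ψ w + ψ w' := by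
          rw [hψ.conj_eq_add s h, add_add_add_comm, ← hψ.add, ← hψ.add, hv, hv']
      _ = ψ y₁ + ψ y₂ := by rw [← hψ.add, ← h, ← hψ.tracial, ← hy, hψ.add]
      _ ≤ ψ (s.conj x) + ε + ψ y₂ := by gcongr
      _ = _ := by rw [add_assoc, add_comm (ε : ℝ≥0∞)]
  calc traceInf σ ψ w + traceInf σ ψ w'
      ≤ (σ (s.conj (w.sqrt : A)) + ψ v) + (σ (s.conj (w'.sqrt : A)) + ψ v') :=
        add_le_add (traceInf_le hv) (traceInf_le hv')
    _ = σ (s.conj x) + (ψ v + ψ v') := by rw [add_add_add_comm, hσ.conj_eq_add s h]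
    _ ≤ σ y₁ + (ψ y₂ + ε) := add_le_add hσs hψv
    _ = _ := (add_assoc _ _ _).symm

theorem traceInf_zero (hσ : IsTrace σ) (hψ : IsTrace ψ) : traceInf σ ψ 0 = 0 :=
  le_antisymm ((traceInf_le_left hψ 0).trans_eq hσ.zero) bot_le

theorem traceInf_scale_le (hσ : IsTrace σ) (hψ : IsTrace ψ) {t : ℝ≥0} (ht : t ≠ 0) (y : Pos A) :
    traceInf σ ψ (y.scale t) ≤ t * traceInf σ ψ y := by
  unfold traceInf
  rw [ENNReal.mul_iInf_of_ne (ENNReal.coe_ne_zero.2 ht) ENNReal.coe_ne_top]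
  refine le_iInf ?_
  rintro ⟨p, rfl⟩
  rw [mul_add, ← hσ.scale, ← hψ.scale]
  exact traceInf_le (Subtype.ext (by simp [Pos.coe_scale, smul_add]))

theorem traceInf_scale (hσ : IsTrace σ) (hψ : IsTrace ψ) (t : ℝ≥0) (y : Pos A) :
    traceInf σ ψ (y.scale t) = t * traceInf σ ψ y := by
  rcases eq_or_ne t 0 with rfl | ht
  · have : y.scale 0 = 0 := Subtype.ext (by simp [Pos.coe_scale])
    rw [this, traceInf_zero hσ hψ, ENNReal.coe_zero, zero_mul]
  refine le_antisymm (traceInf_scale_le hσ hψ ht y) ?_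
  have hinv : (y.scale t).scale t⁻¹ = y := Subtype.ext (by
    simp only [Pos.coe_scale, smul_smul]
    rw [← NNReal.coe_mul, inv_mul_cancel₀ ht, NNReal.coe_one, one_smul])
  calc (t : ℝ≥0∞) * traceInf σ ψ y ≤ t * ((t⁻¹ : ℝ≥0) * traceInf σ ψ (y.scale t)) := by
        gcongr
        simpa only [hinv] using traceInf_scale_le hσ hψ (inv_ne_zero ht) (y.scale t)
    _ = _ := by
      rw [← mul_assoc, ← ENNReal.coe_mul, mul_inv_cancel₀ ht, ENNReal.coe_one, one_mul]

theorem traceInf_add (hσ : IsTrace σ) (hψ : IsTrace ψ) (hlsc : LowerSemicontinuous ψ) {a b : Pos A}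
    (ha : ψ a < ∞) (hb : ψ b < ∞) : traceInf σ ψ (a + b) = traceInf σ ψ a + traceInf σ ψ b := by
  refine le_antisymm (traceInf_add_le hσ hψ a b) ?_
  have := traceInf_add_le_of_starMul_star_eq hσ hψ hlsc (x := ((a + b).sqrt : A)) (w := a)
    (w' := b) (by rw [Pos.star_eq, Pos.starMul_sqrt])
    (by rw [Pos.starMul_sqrt, hψ.add]; exact ENNReal.add_lt_top.2 ⟨ha, hb⟩)
  rwa [Pos.starMul_sqrt] at this

theorem traceInf_starMul (hσ : IsTrace σ) (hψ : IsTrace ψ) (hlsc : LowerSemicontinuous ψ) {x : A}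
    (hx : ψ (Pos.starMul x) < ∞) :
    traceInf σ ψ (Pos.starMul x) = traceInf σ ψ (Pos.starMul (star x)) := by
  have hle (x : A) (h : ψ (Pos.starMul x) < ∞) :
      traceInf σ ψ (Pos.starMul (star x)) ≤ traceInf σ ψ (Pos.starMul x) := by
    simpa only [traceInf_zero hσ hψ, add_zero] using
      traceInf_add_le_of_starMul_star_eq hσ hψ hlsc (add_zero (Pos.starMul (star x))).symm h
  refine le_antisymm ?_ (hle x hx)
  simpa only [star_star] using hle (star x) (by rwa [← hψ.tracial])

theorem isPedTrace_traceInf (hσ : IsTrace σ) (ψ : LTC A) :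
    IsPedTrace fun k : PedPos A => traceInf σ ψ k.1 :=
  .of_lt_top ψ.2.1 ψ.lt_top (fun _ _ => traceInf_add hσ ψ.2.1 ψ.2.2.1)
    (fun t a _ => traceInf_scale hσ ψ.2.1 t a) fun _ => traceInf_starMul hσ ψ.2.1 ψ.2.2.1

namespace LTC

instance : PartialOrder (LTC A) := PartialOrder.lift (restrict A) (restrict_injective A)

theorem le_iff {σ τ : LTC A} : σ ≤ τ ↔ ∀ k, restrict A σ k ≤ restrict A τ k := Iff.rfl

theorem exists_restrict_eq_traceInf (σ ψ : LTC A) :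
    ∃ μ : LTC A, ∀ k, (restrict A μ k : ℝ≥0∞) = traceInf σ ψ k.1 := by
  have hfin (k : PedPos A) : ((traceInf σ ψ k.1).toNNReal : ℝ≥0∞) = traceInf σ ψ k.1 :=
    ENNReal.coe_toNNReal (ne_top_of_le_ne_top (ψ.lt_top k).ne (traceInf_le_right σ.2.1 k.1))
  have htrace : IsPedTrace fun k : PedPos A => (traceInf σ ψ k.1).toNNReal := .of_coe (by
    simp only [hfin]
    exact isPedTrace_traceInf σ.2.1 ψ)
  obtain ⟨μ, hμ⟩ := htrace.exists_restrict_eq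
  exact ⟨μ, fun k => by rw [hμ, hfin]⟩

instance : SemilatticeInf (LTC A) where
  inf σ ψ := (exists_restrict_eq_traceInf σ ψ).choose
  inf_le_left σ ψ := le_iff.2 fun k => by
    rw [← ENNReal.coe_le_coe, (exists_restrict_eq_traceInf σ ψ).choose_spec, coe_restrict]
    exact traceInf_le_left ψ.2.1 k.1
  inf_le_right σ ψ := le_iff.2 fun k => by
    rw [← ENNReal.coe_le_coe, (exists_restrict_eq_traceInf σ ψ).choose_spec, coe_restrict]
    exact traceInf_le_right σ.2.1 k.1
  le_inf χ σ ψ hσ hψ := le_iff.2 fun k => by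
    rw [← ENNReal.coe_le_coe, (exists_restrict_eq_traceInf σ ψ).choose_spec, coe_restrict]
    refine le_traceInf fun y₁ y₂ hy => ?_
    rw [← hy, χ.2.1.add]
    exact add_le_add (apply_le_apply_of_restrict_le hσ y₁) (apply_le_apply_of_restrict_le hψ y₂)

theorem exists_add_of_le {σ ψ : LTC A} (h : σ ≤ ψ) : ∃ χ, ψ = σ + χ := by
  have hsub (k : PedPos A) : restrict A σ k + (restrict A ψ k - restrict A σ k) = restrict A ψ k :=
    add_tsub_cancel_of_le (h k)
  obtain ⟨χ, hχ⟩ := (IsPedTrace.of_add_left (ψ := fun k => restrict A ψ k - restrict A σ k)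
    (isPedTrace_restrict σ) (by simpa only [hsub] using isPedTrace_restrict ψ)).exists_restrict_eq
  refine ⟨χ, restrict_injective A (funext fun k => ?_)⟩
  rw [map_add, Pi.add_apply, hχ, hsub]

instance : CanonicallyOrderedAdd (LTC A) where
  exists_add_of_le := exists_add_of_le
  le_self_add σ ψ := le_iff.2 fun k => by
    rw [map_add]; exact le_self_add
  le_add_self σ ψ := le_iff.2 fun k => by
    rw [map_add]; exact le_add_self

instance : IsOrderedCancelAddMonoid (LTC A) where
  add_le_add_left σ ψ h χ := le_iff.2 fun k => by
    simp only [map_add, Pi.add_apply]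
    exact add_le_add_left (h k) _
  le_of_add_le_add_left σ ψ χ h := le_iff.2 fun k => by
    have := h k
    simp only [map_add, Pi.add_apply] at this
    exact le_of_add_le_add_left this

end LTC

end Lattice

section Band

theorem monotone_of_canonicallyOrderedAdd {M N F : Type*}
    [AddCommMonoid M] [PartialOrder M] [CanonicallyOrderedAdd M]
    [AddCommMonoid N] [PartialOrder N] [CanonicallyOrderedAdd N]
    [FunLike F M N] [AddHomClass F M N] (f : F) : Monotone f := by
  intro x y h
  obtain ⟨z, rfl⟩ := le_iff_exists_add.1 h
  rw [map_add]
  exact le_self_add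

section Module

variable {M : Type*} [AddCommMonoid M] [PartialOrder M] [CanonicallyOrderedAdd M] [Module ℝ≥0 M]

theorem smul_le_smul_of_le_left {s t : ℝ≥0} (h : s ≤ t) (x : M) : s • x ≤ t • x :=
  monotone_of_canonicallyOrderedAdd ((smulAddHom ℝ≥0 M).flip x) h

theorem smul_le_smul_of_le_right (t : ℝ≥0) {x y : M} (h : x ≤ y) : t • x ≤ t • y :=
  monotone_of_canonicallyOrderedAdd (smulAddHom ℝ≥0 M t) h

theorem exists_smul_le_and_le_add_inv_smul {x u : M} (hxu : x ≤ u) {N : ℕ} (hN : 0 < N)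
    (h : ∀ j ≤ N, x ≤ ((j : ℝ≥0) / N) • u ∨ ((j : ℝ≥0) / N) • u ≤ x) :
    ∃ c : ℝ≥0, c • u ≤ x ∧ x ≤ (c + (N : ℝ≥0)⁻¹) • u := by
  classical
  let P : ℕ → Prop := fun j => ((j : ℝ≥0) / N) • u ≤ x
  have hP0 : P 0 := by
    change (((0 : ℕ) : ℝ≥0) / N) • u ≤ x
    rw [Nat.cast_zero, zero_div, zero_smul]
    exact zero_le
  have hN' : (N : ℝ≥0) ≠ 0 := Nat.cast_ne_zero.2 hN.ne'
  refine ⟨_, Nat.findGreatest_spec (P := P) N.zero_le hP0, ?_⟩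
  rcases (Nat.findGreatest_le (P := P) N).eq_or_lt with heq | hlt
  · rw [heq, div_self hN', add_smul, one_smul]
    exact hxu.trans le_self_add
  · have hle := (h _ hlt).resolve_right (Nat.findGreatest_is_greatest (Nat.lt_succ_self _) hlt)
    rwa [Nat.cast_succ, add_div, one_div] at hle

end Module

section SemilatticeInf

variable {M : Type*} [AddCommMonoid M] [SemilatticeInf M] [CanonicallyOrderedAdd M]
  [IsOrderedCancelAddMonoid M]

theorem add_inf_eq (x y z : M) : x + y ⊓ z = (x + y) ⊓ (x + z) := by
  refine le_antisymm (le_inf (add_le_add_right inf_le_left x) (add_le_add_right inf_le_right x)) ?_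
  obtain ⟨w, hw⟩ := le_iff_exists_add.1 (le_inf le_self_add le_self_add : x ≤ (x + y) ⊓ (x + z))
  rw [hw]
  exact add_le_add_right (le_inf (le_of_add_le_add_left (hw ▸ inf_le_left : x + w ≤ x + y))
    (le_of_add_le_add_left (hw ▸ inf_le_right : x + w ≤ x + z))) x

theorem add_inf_le (x y z : M) : (x + y) ⊓ z ≤ x ⊓ z + y ⊓ z := by
  rw [add_inf_eq, add_comm (x ⊓ z) y, add_comm (x ⊓ z) z, add_inf_eq, add_inf_eq, add_comm y x]
  exact le_inf (inf_le_inf_left _ le_add_self) (inf_le_right.trans (le_inf le_self_add le_self_add))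

theorem exists_eq_inf_add_and_disjoint (x y : M) :
    ∃ v w : M, x = x ⊓ y + v ∧ y = x ⊓ y + w ∧ v ⊓ w = 0 := by
  obtain ⟨v, hv⟩ := le_iff_exists_add.1 (inf_le_left : x ⊓ y ≤ x)
  obtain ⟨w, hw⟩ := le_iff_exists_add.1 (inf_le_right : x ⊓ y ≤ y)
  refine ⟨v, w, hv, hw, add_left_cancel (a := x ⊓ y) ?_⟩
  rw [add_inf_eq, ← hv, ← hw, add_zero]

theorem inf_nsmul_eq_zero {x y : M} (h : x ⊓ y = 0) (n : ℕ) : x ⊓ n • y = 0 := by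
  rw [← nonpos_iff_eq_zero, inf_comm] at *
  induction n with
  | zero => rw [zero_nsmul]; exact inf_le_left
  | succ n ih =>
    rw [succ_nsmul]
    exact (add_inf_le _ _ _).trans ((add_le_add ih h).trans_eq (add_zero 0))

theorem monotone_inf_nsmul (x y : M) : Monotone fun n : ℕ => x ⊓ n • y := fun _ _ h =>
  inf_le_inf_left x (nsmul_le_nsmul_left zero_le h)

end SemilatticeInf

/-- Monotone σ-completeness: bounded increasing sequences have a least upper bound. -/
class MonotoneSigmaComplete (M : Type*) [Preorder M] : Prop where
  exists_isLUB {u : ℕ → M} : Monotone u → BddAbove (Set.range u) → ∃ x, IsLUB (Set.range u) x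

variable {M : Type*} [AddCommMonoid M] [SemilatticeInf M] [CanonicallyOrderedAdd M]
  [IsOrderedCancelAddMonoid M] [MonotoneSigmaComplete M]

theorem exists_isLUB_inf_nsmul (θ x : M) : ∃ y, IsLUB (Set.range fun n : ℕ => x ⊓ n • θ) y :=
  MonotoneSigmaComplete.exists_isLUB (monotone_inf_nsmul x θ)
    ⟨x, Set.forall_mem_range.2 fun _ => inf_le_left⟩

/-- The component of `x` in the band generated by `θ`. -/
def band (θ x : M) : M := (exists_isLUB_inf_nsmul θ x).choose

theorem isLUB_band (θ x : M) : IsLUB (Set.range fun n : ℕ => x ⊓ n • θ) (band θ x) :=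
  (exists_isLUB_inf_nsmul θ x).choose_spec

theorem inf_nsmul_le_band (θ x : M) (n : ℕ) : x ⊓ n • θ ≤ band θ x :=
  (isLUB_band θ x).1 ⟨n, rfl⟩

theorem band_le {θ x y : M} (h : ∀ n : ℕ, x ⊓ n • θ ≤ y) : band θ x ≤ y :=
  (isLUB_band θ x).2 (Set.forall_mem_range.2 h)

theorem band_le_self (θ x : M) : band θ x ≤ x := band_le fun _ => inf_le_left

theorem band_self (θ : M) : band θ θ = θ := by
  refine le_antisymm (band_le_self _ _) ?_
  simpa only [one_nsmul, inf_idem] using inf_nsmul_le_band θ θ 1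

theorem band_eq_zero {θ x : M} (h : x ⊓ θ = 0) : band θ x = 0 :=
  nonpos_iff_eq_zero.1 (band_le fun n => (inf_nsmul_eq_zero h n).le)

theorem band_add_le {θ x y z : M} (h : ∀ n : ℕ, x ⊓ n • θ + y ≤ z) : band θ x + y ≤ z := by
  obtain ⟨d, rfl⟩ := le_iff_exists_add'.1 (le_add_self.trans (h 0))
  exact add_le_add_left (band_le fun n => le_of_add_le_add_right (h n)) y

theorem band_add (θ x y : M) : band θ (x + y) = band θ x + band θ y := by
  refine le_antisymm (band_le fun n => (add_inf_le _ _ _).trans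
    (add_le_add (inf_nsmul_le_band θ x n) (inf_nsmul_le_band θ y n))) (band_add_le fun n => ?_)
  rw [add_comm]
  refine band_add_le fun m => (le_inf ?_ ?_).trans (inf_nsmul_le_band θ (x + y) (m + n))
  · rw [add_comm x y]
    exact add_le_add inf_le_left inf_le_left
  · rw [add_nsmul]
    exact add_le_add inf_le_right inf_le_right

variable [Module ℝ≥0 M]

theorem band_smul_le (θ x : M) {t : ℝ≥0} (ht : t ≠ 0) : band θ (t • x) ≤ t • band θ x := by
  refine band_le fun n => ?_
  obtain ⟨m, hm⟩ := exists_nat_ge (t⁻¹ * n)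
  have hle : t⁻¹ • ((t • x) ⊓ n • θ) ≤ x ⊓ m • θ := by
    refine le_inf ?_ ?_
    · refine (smul_le_smul_of_le_right t⁻¹ inf_le_left).trans_eq ?_
      rw [smul_smul, inv_mul_cancel₀ ht, one_smul]
    · refine (smul_le_smul_of_le_right t⁻¹ inf_le_right).trans ?_
      rw [← Nat.cast_smul_eq_nsmul ℝ≥0 n, ← Nat.cast_smul_eq_nsmul ℝ≥0 m, smul_smul]
      exact smul_le_smul_of_le_left hm θ
  calc (t • x) ⊓ n • θ = t • t⁻¹ • ((t • x) ⊓ n • θ) := by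
        rw [smul_smul, mul_inv_cancel₀ ht, one_smul]
    _ ≤ t • band θ x := smul_le_smul_of_le_right t (hle.trans (inf_nsmul_le_band θ x m))

theorem band_smul (θ x : M) (t : ℝ≥0) : band θ (t • x) = t • band θ x := by
  rcases eq_or_ne t 0 with rfl | ht
  · rw [zero_smul, zero_smul]
    exact nonpos_iff_eq_zero.1 (band_le_self θ 0)
  refine le_antisymm (band_smul_le θ x ht) ?_
  have hle := band_smul_le θ (t • x) (inv_ne_zero ht)
  rw [smul_smul, inv_mul_cancel₀ ht, one_smul] at hle
  calc t • band θ x ≤ t • t⁻¹ • band θ (t • x) := smul_le_smul_of_le_right t hle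
    _ = band θ (t • x) := by rw [smul_smul, mul_inv_cancel₀ ht, one_smul]

/-- The projection onto the band generated by `θ`. -/
def bandProj (θ : M) : M →ₗ[ℝ≥0] M where
  toFun := band θ
  map_add' := band_add θ
  map_smul' t x := band_smul θ x t

theorem exists_bandProj_add_eq (θ x : M) : ∃ y, bandProj θ x + y = x :=
  (le_iff_exists_add.1 (band_le_self θ x)).imp fun _ => Eq.symm

/-- The projection onto the disjoint complement of the band generated by `θ`. -/
def bandCompl (θ : M) : M →ₗ[ℝ≥0] M where
  toFun x := (exists_bandProj_add_eq θ x).choose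
  map_add' x y := by
    refine add_left_cancel (a := bandProj θ (x + y)) ?_
    rw [(exists_bandProj_add_eq θ (x + y)).choose_spec, map_add, add_add_add_comm,
      (exists_bandProj_add_eq θ x).choose_spec, (exists_bandProj_add_eq θ y).choose_spec]
  map_smul' t x := by
    refine add_left_cancel (a := bandProj θ (t • x)) ?_
    rw [(exists_bandProj_add_eq θ (t • x)).choose_spec, map_smul, RingHom.id_apply, ← smul_add,
      (exists_bandProj_add_eq θ x).choose_spec]

theorem bandProj_add_bandCompl (θ x : M) : bandProj θ x + bandCompl θ x = x :=
  (exists_bandProj_add_eq θ x).choose_spec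

theorem bandProj_self (θ : M) : bandProj θ θ = θ := band_self θ

theorem bandCompl_self (θ : M) : bandCompl θ θ = 0 :=
  add_left_cancel (a := bandProj θ θ) (by rw [bandProj_add_bandCompl, bandProj_self, add_zero])

-- The band is generated by the part `θ` of `x` that exceeds `x ⊓ y`.
theorem exists_add_eq_and_le_and_le (x y : M) : ∃ P P' : M →ₗ[ℝ≥0] M,
    (∀ z, P z + P' z = z) ∧ P y ≤ P x ∧ P' x ≤ P' y := by
  obtain ⟨θ, θ', hx, hy, hdisj⟩ := exists_eq_inf_add_and_disjoint x y
  have hθ' : bandProj θ θ' = 0 := band_eq_zero (by rwa [inf_comm])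
  refine ⟨bandProj θ, bandCompl θ, bandProj_add_bandCompl θ, ?_, ?_⟩
  · conv_lhs => rw [hy, map_add, hθ', add_zero]
    exact monotone_of_canonicallyOrderedAdd _ inf_le_left
  · conv_lhs => rw [hx, map_add, bandCompl_self, add_zero]
    exact monotone_of_canonicallyOrderedAdd _ inf_le_right

theorem exists_partition_le_or_le {s : Set (M × M)} (hs : s.Finite) :
    ∃ (J : Type) (_ : Fintype J) (Q : J → M →ₗ[ℝ≥0] M), (∀ x, ∑ j, Q j x = x) ∧
      ∀ j, ∀ p ∈ s, Q j p.1 ≤ Q j p.2 ∨ Q j p.2 ≤ Q j p.1 := by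
  induction s, hs using Set.Finite.induction_on with
  | empty => exact ⟨Unit, inferInstance, fun _ => LinearMap.id, by simp, by simp⟩
  | @insert p s _ _ ih =>
    obtain ⟨J, _, Q, hQ, hs⟩ := ih
    choose P P' hP hPle hPle' using fun j => exists_add_eq_and_le_and_le (Q j p.1) (Q j p.2)
    refine ⟨J ⊕ J, inferInstance, Sum.elim (fun j => P j ∘ₗ Q j) (fun j => P' j ∘ₗ Q j),
      fun x => ?_, ?_⟩
    · rw [Fintype.sum_sum_type, ← Finset.sum_add_distrib]
      simp only [Sum.elim_inl, Sum.elim_inr, LinearMap.comp_apply, hP, hQ]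
    · rintro (j | j) q (rfl | hq)
      · exact .inr (hPle j)
      · exact (hs j q hq).imp (monotone_of_canonicallyOrderedAdd (P j) ·)
          (monotone_of_canonicallyOrderedAdd (P j) ·)
      · exact .inl (hPle' j)
      · exact (hs j q hq).imp (monotone_of_canonicallyOrderedAdd (P' j) ·)
          (monotone_of_canonicallyOrderedAdd (P' j) ·)

-- A version of Freudenthal's spectral theorem.
theorem exists_partition_smul_le_and_le_smul {s : Set M} (hs : s.Finite) {u : M}
    (hu : ∀ x ∈ s, x ≤ u) {N : ℕ} (hN : 0 < N) :
    ∃ (J : Type) (_ : Fintype J) (Q : J → M →ₗ[ℝ≥0] M), (∀ x, ∑ j, Q j x = x) ∧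
      ∀ j, ∀ x ∈ s, ∃ c : ℝ≥0, c • Q j u ≤ Q j x ∧ Q j x ≤ (c + (N : ℝ≥0)⁻¹) • Q j u := by
  obtain ⟨J, hJ, Q, hQ, hcmp⟩ := exists_partition_le_or_le
    (hs.image2 (fun x (i : ℕ) => (x, ((i : ℝ≥0) / N) • u)) (Set.finite_Iic N))
  refine ⟨J, hJ, Q, hQ, fun j x hx => exists_smul_le_and_le_add_inv_smul
    (monotone_of_canonicallyOrderedAdd (Q j) (hu x hx)) hN fun i hi => ?_⟩
  simpa only [map_smul] using hcmp j _ (Set.mem_image2_of_mem hx (Set.mem_Iic.2 hi))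

end Band

section TraceBand

variable {A : Type*} [NonUnitalCStarAlgebra A] [PartialOrder A] [StarOrderedRing A]

instance : MonotoneSigmaComplete (LTC A) where
  exists_isLUB {u} hu := by
    rintro ⟨ψ, hψ⟩
    have hbdd (k : PedPos A) : BddAbove (Set.range fun n => LTC.restrict A (u n) k) :=
      ⟨LTC.restrict A ψ k, Set.forall_mem_range.2 fun n => hψ ⟨n, rfl⟩ k⟩
    obtain ⟨μ, hμ⟩ := (IsPedTrace.of_tendsto (fun n => LTC.isPedTrace_restrict (u n))
      fun k => tendsto_atTop_ciSup (fun m n hmn => hu hmn k) (hbdd k)).exists_restrict_eq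
    refine ⟨μ, Set.forall_mem_range.2 fun n => LTC.le_iff.2 fun k => ?_,
      fun χ hχ => LTC.le_iff.2 fun k => ?_⟩
    · rw [hμ]
      exact le_ciSup (hbdd k) n
    · rw [hμ]
      exact ciSup_le fun n => hχ ⟨n, rfl⟩ k

end TraceBand

section SingleAlgebra

variable {A : Type*} [NonUnitalCStarAlgebra A] [PartialOrder A] [StarOrderedRing A]

theorem norm_starMul (x : A) : ‖(Pos.starMul x : A)‖ = ‖x‖ ^ 2 := by
  rw [Pos.coe_starMul, CStarRing.norm_star_mul_self, sq]

theorem Pos.exists_eq_add {a b : Pos A} (h : a ≤ b) : ∃ c, b = a + c :=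
  ⟨⟨(b : A) - a, sub_nonneg.2 h⟩, Subtype.ext (by simp)⟩

theorem Pos.starMul_le_self {a : Pos A} (ha : ‖(a : A)‖ ≤ 1) : starMul (a : A) ≤ a := by
  have h : (a.conj a.sqrt : A) ≤ starMul (a.sqrt : A) := Pos.conj_le a a.sqrt ha
  have e : (a.conj a.sqrt : A) = starMul (a : A) := by
    conv_lhs => rw [Pos.coe_conj, Pos.star_eq, ← a.sqrt_mul_sqrt]
    conv_rhs => rw [Pos.coe_starMul, Pos.star_eq, ← a.sqrt_mul_sqrt]
    simp only [mul_assoc]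
  rwa [e, Pos.starMul_sqrt] at h

theorem IsPosFun.conj_le {ω : Pos A → ℝ} (hω : IsPosFun ω) (x : Pos A) (w : A) :
    ω (x.conj w) ≤ ‖(x : A)‖ * ω (Pos.starMul w) :=
  calc ω (x.conj w) ≤ ω ((Pos.starMul w).scale ‖(x : A)‖₊) :=
        hω.mono (CStarAlgebra.star_left_conjugate_le_norm_smul (IsSelfAdjoint.of_nonneg x.2))
    _ = ‖(x : A)‖ * ω (Pos.starMul w) := by rw [hω.scale, coe_nnnorm]

end SingleAlgebra

section AlgebraicTensor

theorem tmul_ne_zero {K V W : Type*} [Field K] [AddCommGroup V] [Module K V] [AddCommGroup W]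
    [Module K W] {v : V} {w : W} (hv : v ≠ 0) (hw : w ≠ 0) : v ⊗ₜ[K] w ≠ 0 := by
  obtain ⟨f, hf⟩ := not_forall.1 (mt (Module.forall_dual_apply_eq_zero_iff K v).1 hv)
  obtain ⟨g, hg⟩ := not_forall.1 (mt (Module.forall_dual_apply_eq_zero_iff K w).1 hw)
  intro h
  have := congrArg (fun t => TensorProduct.lid K K (TensorProduct.map f g t)) h
  simp [hf, hg] at this

variable {A₁ A₂ C : Type*} [NonUnitalCStarAlgebra A₁] [NonUnitalCStarAlgebra A₂]
  [NonUnitalCStarAlgebra C] (ι : A₁ ⊗[ℂ] A₂ →⋆ₙₐ[ℂ] C)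

theorem map_tmul_mul (a a' : A₁) (b b' : A₂) :
    ι (a ⊗ₜ[ℂ] b) * ι (a' ⊗ₜ[ℂ] b') = ι ((a * a') ⊗ₜ[ℂ] (b * b')) := by
  rw [← map_mul, Algebra.TensorProduct.tmul_mul_tmul]

theorem star_map_tmul (a : A₁) (b : A₂) : star (ι (a ⊗ₜ[ℂ] b)) = ι (star a ⊗ₜ[ℂ] star b) := by
  rw [← map_star, TensorProduct.star_tmul]

theorem map_real_smul_tmul (t : ℝ) (a : A₁) (b : A₂) :
    ι ((t • a) ⊗ₜ[ℂ] b) = t • ι (a ⊗ₜ[ℂ] b) := by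
  rw [← Complex.coe_smul, ← Complex.coe_smul, ← TensorProduct.smul_tmul', map_smul]

theorem map_tmul_real_smul (t : ℝ) (a : A₁) (b : A₂) :
    ι (a ⊗ₜ[ℂ] (t • b)) = t • ι (a ⊗ₜ[ℂ] b) := by
  rw [← Complex.coe_smul, ← Complex.coe_smul, TensorProduct.tmul_smul, map_smul]

theorem IsTensorCompletion.map_tmul_ne_zero {ι : A₁ ⊗[ℂ] A₂ →⋆ₙₐ[ℂ] C} {β : CStarNorm A₁ A₂}
    (hι : IsTensorCompletion β ι) {a : A₁} {b : A₂} (ha : a ≠ 0) (hb : b ≠ 0) :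
    ι (a ⊗ₜ[ℂ] b) ≠ 0 := fun h =>
  tmul_ne_zero ha hb (β.eq_zero _ (by rw [← hι.norm_map, h, norm_zero]))

end AlgebraicTensor

section TensorBasics

variable {A₁ A₂ C : Type*}
  [NonUnitalCStarAlgebra A₁] [PartialOrder A₁] [StarOrderedRing A₁]
  [NonUnitalCStarAlgebra A₂] [PartialOrder A₂] [StarOrderedRing A₂]
  [NonUnitalCStarAlgebra C] [PartialOrder C] [StarOrderedRing C]
  (ι : A₁ ⊗[ℂ] A₂ →⋆ₙₐ[ℂ] C)

namespace Pos

theorem coe_tmul (a : Pos A₁) (b : Pos A₂) : (tmul ι a b : C) = ι ((a : A₁) ⊗ₜ[ℂ] (b : A₂)) := rfl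

theorem add_tmul (a a' : Pos A₁) (b : Pos A₂) : tmul ι (a + a') b = tmul ι a b + tmul ι a' b :=
  Subtype.ext (by simp [coe_tmul, TensorProduct.add_tmul])

theorem tmul_add (a : Pos A₁) (b b' : Pos A₂) : tmul ι a (b + b') = tmul ι a b + tmul ι a b' :=
  Subtype.ext (by simp [coe_tmul, TensorProduct.tmul_add])

theorem scale_tmul (t : ℝ≥0) (a : Pos A₁) (b : Pos A₂) :
    tmul ι (a.scale t) b = (tmul ι a b).scale t :=
  Subtype.ext (by simp only [coe_tmul, coe_scale, map_real_smul_tmul])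

theorem tmul_scale (t : ℝ≥0) (a : Pos A₁) (b : Pos A₂) :
    tmul ι a (b.scale t) = (tmul ι a b).scale t :=
  Subtype.ext (by simp only [coe_tmul, coe_scale, map_tmul_real_smul])

theorem conj_tmul (a : Pos A₁) (b : Pos A₂) (u : A₁) (v : A₂) :
    (tmul ι a b).conj (ι (u ⊗ₜ[ℂ] v)) = tmul ι (a.conj u) (b.conj v) :=
  Subtype.ext (by simp only [coe_conj, coe_tmul, star_map_tmul, map_tmul_mul])

theorem starMul_tmul (u : A₁) (v : A₂) :
    starMul (ι (u ⊗ₜ[ℂ] v)) = tmul ι (starMul u) (starMul v) :=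
  Subtype.ext (by simp only [coe_starMul, coe_tmul, star_map_tmul, map_tmul_mul])

theorem tmul_le_tmul {a a' : Pos A₁} {b b' : Pos A₂} (ha : a ≤ a') (hb : b ≤ b') :
    tmul ι a b ≤ tmul ι a' b' := by
  obtain ⟨c, rfl⟩ := exists_eq_add ha
  obtain ⟨d, rfl⟩ := exists_eq_add hb
  rw [tmul_add, add_tmul, add_assoc]
  exact le_add_of_nonneg_right (add_nonneg (tmul ι c b).2 (tmul ι (a + c) d).2)

end Pos

/-- Tensoring with a fixed positive element, as a positive linear map. It serves to deduce that
`a ↦ a ⊗ b` is bounded from the automatic continuity of positive maps. -/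
def tmulLeft (b : Pos A₂) : A₁ →ₚ[ℂ] C :=
  PositiveLinearMap.mk₀
    { toFun := fun a => ι (a ⊗ₜ[ℂ] (b : A₂))
      map_add' := fun a a' => by rw [TensorProduct.add_tmul, map_add]
      map_smul' := fun c a => by rw [← TensorProduct.smul_tmul', map_smul]; rfl }
    fun a ha => (Pos.tmul ι ⟨a, ha⟩ b).2

theorem exists_norm_tmul_le (b : Pos A₂) :
    ∃ M : ℝ≥0, ∀ a : A₁, ‖ι (a ⊗ₜ[ℂ] (b : A₂))‖ ≤ M * ‖a‖ :=
  (tmulLeft ι b).exists_norm_apply_le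

theorem norm_tmul_pow_le {b : Pos A₂} {M : ℝ≥0}
    (hM : ∀ a : A₁, ‖ι (a ⊗ₜ[ℂ] (b : A₂))‖ ≤ M * ‖a‖) (n : ℕ) {a : Pos A₁} {b' : Pos A₂}
    (ha : ‖(a : A₁)‖ ≤ 1) (hb' : ‖(b' : A₂)‖ ≤ 1) (hb'b : b' ≤ b) :
    ‖(Pos.tmul ι a b' : C)‖ ^ 2 ^ n ≤ M := by
  induction n generalizing a b' with
  | zero =>
    rw [pow_zero, pow_one]
    calc ‖(Pos.tmul ι a b' : C)‖ ≤ ‖(Pos.tmul ι a b : C)‖ :=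
          CStarAlgebra.norm_le_norm_of_nonneg_of_le (Pos.tmul ι a b').2
            (Pos.tmul_le_tmul ι le_rfl hb'b)
      _ ≤ M * ‖(a : A₁)‖ := hM a
      _ ≤ M := mul_le_of_le_one_right M.2 ha
  | succ n ih =>
    rw [pow_succ', pow_mul, ← norm_starMul, Pos.coe_tmul, Pos.starMul_tmul]
    refine ih ?_ ?_ ((Pos.starMul_le_self hb').trans hb'b)
    · rw [norm_starMul]; exact pow_le_one₀ (norm_nonneg _) ha
    · rw [norm_starMul]; exact pow_le_one₀ (norm_nonneg _) hb'

theorem norm_tmul_le_one {a : Pos A₁} {b : Pos A₂} (ha : ‖(a : A₁)‖ ≤ 1) (hb : ‖(b : A₂)‖ ≤ 1) :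
    ‖(Pos.tmul ι a b : C)‖ ≤ 1 := by
  obtain ⟨M, hM⟩ := exists_norm_tmul_le ι b
  by_contra! hlt
  obtain ⟨n, hn⟩ := pow_unbounded_of_one_lt (M : ℝ) hlt
  have hle : ‖(Pos.tmul ι a b : C)‖ ^ n ≤ ‖(Pos.tmul ι a b : C)‖ ^ 2 ^ n :=
    pow_le_pow_right₀ hlt.le Nat.lt_two_pow_self.le
  exact (hn.trans_le hle).not_ge (norm_tmul_pow_le ι hM n ha hb le_rfl)

theorem norm_pos_tmul_le (a : Pos A₁) (b : Pos A₂) :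
    ‖(Pos.tmul ι a b : C)‖ ≤ ‖(a : A₁)‖ * ‖(b : A₂)‖ := by
  rcases eq_or_ne (a : A₁) 0 with ha | ha
  · simp [Pos.coe_tmul, ha]
  rcases eq_or_ne (b : A₂) 0 with hb | hb
  · simp [Pos.coe_tmul, hb]
  have h := norm_tmul_le_one ι (a := a.scale ‖(a : A₁)‖₊⁻¹) (b := b.scale ‖(b : A₂)‖₊⁻¹)
    (by simp [Pos.coe_scale, norm_smul, ha]) (by simp [Pos.coe_scale, norm_smul, hb])
  rw [Pos.scale_tmul, Pos.tmul_scale, Pos.coe_scale, Pos.coe_scale, norm_smul, norm_smul] at h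
  simp only [NNReal.coe_inv, coe_nnnorm, norm_inv, norm_norm] at h
  have ha' := norm_pos_iff.2 ha
  have hb' := norm_pos_iff.2 hb
  rwa [← mul_assoc, ← mul_inv, inv_mul_le_iff₀ (by positivity), mul_one] at h

theorem norm_tmul_le (a : A₁) (b : A₂) : ‖ι (a ⊗ₜ[ℂ] b)‖ ≤ ‖a‖ * ‖b‖ := by
  rw [← sq_le_sq₀ (norm_nonneg _) (by positivity), ← norm_starMul, Pos.starMul_tmul, mul_pow,
    ← norm_starMul, ← norm_starMul]
  exact norm_pos_tmul_le ι _ _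

theorem IsPosFun.tmul_left {ω : Pos C → ℝ} (hω : IsPosFun ω) (b : Pos A₂) :
    IsPosFun fun a : Pos A₁ => ω (Pos.tmul ι a b) where
  nonneg _ := hω.nonneg _
  add a a' := by rw [Pos.add_tmul, hω.add]
  scale t a := by rw [Pos.scale_tmul, hω.scale]

theorem IsPosFun.tmul_right {ω : Pos C → ℝ} (hω : IsPosFun ω) (a : Pos A₁) :
    IsPosFun fun b : Pos A₂ => ω (Pos.tmul ι a b) where
  nonneg _ := hω.nonneg _
  add b b' := by rw [Pos.tmul_add, hω.add]
  scale t b := by rw [Pos.tmul_scale, hω.scale]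

namespace IsTensorCompletion

variable {ι} {β : CStarNorm A₁ A₂}

theorem clm_ext (hι : IsTensorCompletion β ι) {f g : C →L[ℂ] ℂ}
    (h : ∀ (a : Pos A₁) (b : Pos A₂), f (Pos.tmul ι a b) = g (Pos.tmul ι a b)) : f = g := by
  have htmul : ((f : C →ₗ[ℂ] ℂ) ∘ₗ (ι : A₁ ⊗[ℂ] A₂ →ₗ[ℂ] C)) =
      (g : C →ₗ[ℂ] ℂ) ∘ₗ (ι : A₁ ⊗[ℂ] A₂ →ₗ[ℂ] C) :=
    TensorProduct.ext <| linearMap_ext_pos fun a => linearMap_ext_pos fun b => h a b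
  exact DFunLike.coe_injective <| hι.denseRange.equalizer f.continuous g.continuous <|
    funext (LinearMap.congr_fun htmul)

theorem posFun_ext (hι : IsTensorCompletion β ι) {φ ψ : Pos C → ℝ} (hφ : IsPosFun φ)
    (hψ : IsPosFun ψ)
    (h : ∀ (a : Pos A₁) (b : Pos A₂), φ (Pos.tmul ι a b) = ψ (Pos.tmul ι a b)) : φ = ψ := by
  have e : hφ.ext = hψ.ext := hι.clm_ext fun a b => by rw [hφ.ext_apply, hψ.ext_apply, h]
  funext x
  rw [hφ.eq_re, hψ.eq_re, e]

end IsTensorCompletion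

end TensorBasics

section NormAbove

variable {A : Type*} [NonUnitalCStarAlgebra A] [PartialOrder A]

/-- The infimum of the norms of the positive elements above a given selfadjoint element. A linear
functional is dominated by it if and only if it is positive of norm at most one. -/
def normAbove (a : selfAdjoint A) : ℝ := ⨅ p : {p : Pos A // (a : A) ≤ p}, ‖(p.1 : A)‖

theorem normAbove_le {a : selfAdjoint A} {p : Pos A} (h : (a : A) ≤ p) :
    normAbove a ≤ ‖(p : A)‖ :=
  ciInf_le (f := fun p : {p : Pos A // (a : A) ≤ p} => ‖(p.1 : A)‖)
    ⟨0, by rintro _ ⟨p, rfl⟩; exact norm_nonneg _⟩ ⟨p, h⟩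

end NormAbove

section QuasiState

variable {A : Type*} [NonUnitalCStarAlgebra A] [PartialOrder A] [StarOrderedRing A]

namespace IsPosFun

variable {φ ψ : Pos A → ℝ}

theorem add_fun (hφ : IsPosFun φ) (hψ : IsPosFun ψ) : IsPosFun fun a => φ a + ψ a where
  nonneg a := add_nonneg (hφ.nonneg a) (hψ.nonneg a)
  add a b := by rw [hφ.add, hψ.add, add_add_add_comm]
  scale t a := by rw [hφ.scale, hψ.scale, mul_add]

theorem sub_fun (hφ : IsPosFun φ) (hψ : IsPosFun ψ) (h : ∀ a, ψ a ≤ φ a) :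
    IsPosFun fun a => φ a - ψ a where
  nonneg a := sub_nonneg.2 (h a)
  add a b := by rw [hφ.add, hψ.add, add_sub_add_comm]
  scale t a := by rw [hφ.scale, hψ.scale, mul_sub]

theorem mul_add_le (hφ : IsPosFun φ) {r : ℝ≥0} {a b c : Pos A} (h : a.scale r + b ≤ c) :
    r * φ a + φ b ≤ φ c := by
  rw [← hφ.scale, ← hφ.add]
  exact hφ.mono h

theorem zero_fun : IsPosFun fun _ : Pos A => (0 : ℝ) :=
  ⟨fun _ => le_rfl, fun _ _ => (add_zero 0).symm, fun _ _ => (mul_zero _).symm⟩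

end IsPosFun

theorem isClosed_isPosFun : IsClosed {φ : Pos A → ℝ | IsPosFun φ} := by
  have : {φ : Pos A → ℝ | IsPosFun φ} = (⋂ a, {φ : Pos A → ℝ | 0 ≤ φ a}) ∩
      ((⋂ a, ⋂ b, {φ : Pos A → ℝ | φ (a + b) = φ a + φ b}) ∩
        ⋂ t : ℝ≥0, ⋂ a, {φ : Pos A → ℝ | φ (a.scale t) = (t : ℝ) * φ a}) := by
    ext φ
    simp only [Set.mem_ofPred_eq, Set.mem_inter_iff, Set.mem_iInter]
    exact ⟨fun h => ⟨h.nonneg, h.add, h.scale⟩, fun h => ⟨h.1, h.2.1, h.2.2⟩⟩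
  rw [this]
  refine (isClosed_iInter fun a => ?_).inter
    ((isClosed_iInter fun a => isClosed_iInter fun b => ?_).inter
      (isClosed_iInter fun t => isClosed_iInter fun a => ?_))
  · exact isClosed_le continuous_const (continuous_apply a)
  · exact isClosed_eq (by fun_prop) (by fun_prop)
  · exact isClosed_eq (by fun_prop) (by fun_prop)

variable (A) in
/-- The positive functionals of norm at most one, as functions on the positive cone. -/
def quasiState : Set (Pos A → ℝ) := {φ | IsPosFun φ ∧ ∀ x : Pos A, φ x ≤ ‖(x : A)‖}

theorem isCompact_quasiState : IsCompact (quasiState A) := by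
  have hbox : IsCompact (Set.univ.pi fun x : Pos A => Set.Icc (0 : ℝ) ‖(x : A)‖) :=
    isCompact_univ_pi fun _ => isCompact_Icc
  refine hbox.of_isClosed_subset (isClosed_isPosFun.inter ?_)
    fun φ hφ x _ => ⟨hφ.1.nonneg x, hφ.2 x⟩
  change IsClosed {φ : Pos A → ℝ | ∀ x : Pos A, φ x ≤ ‖(x : A)‖}
  rw [Set.ofPred_forall]
  exact isClosed_iInter fun x => isClosed_le (continuous_apply x) continuous_const

theorem convex_quasiState : Convex ℝ (quasiState A) := by
  intro φ hφ ψ hψ s t hs ht hst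
  refine ⟨(hφ.1.smul hs).add_fun (hψ.1.smul ht), fun x => ?_⟩
  calc s * φ x + t * ψ x ≤ s * ‖(x : A)‖ + t * ‖(x : A)‖ :=
        add_le_add (mul_le_mul_of_nonneg_left (hφ.2 x) hs) (mul_le_mul_of_nonneg_left (hψ.2 x) ht)
    _ = ‖(x : A)‖ := by rw [← add_mul, hst, one_mul]

theorem zero_mem_quasiState : (0 : Pos A → ℝ) ∈ quasiState A :=
  ⟨IsPosFun.zero_fun, fun _ => norm_nonneg _⟩

theorem IsPosFun.inv_mul_mem_quasiState {φ : Pos A → ℝ} (hφ : IsPosFun φ) {s : ℝ} (hs : 0 < s)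
    (h : ∀ x : Pos A, φ x ≤ s * ‖(x : A)‖) : (fun x => s⁻¹ * φ x) ∈ quasiState A :=
  ⟨hφ.smul (inv_nonneg.2 hs.le), fun x => (inv_mul_le_iff₀ hs).2 (h x)⟩

theorem IsPosFun.exists_inv_mul_mem_quasiState {φ : Pos A → ℝ} (hφ : IsPosFun φ) :
    ∃ s : ℝ, 0 < s ∧ (fun x => s⁻¹ * φ x) ∈ quasiState A := by
  obtain ⟨M, hM, hφM⟩ := hφ.exists_bound
  refine ⟨M + 1, by positivity, hφ.inv_mul_mem_quasiState (by positivity) fun x => ?_⟩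
  exact (hφM x).trans (mul_le_mul_of_nonneg_right (le_add_of_nonneg_right zero_le_one)
    (norm_nonneg _))

section NormAbove

instance (a : selfAdjoint A) : Nonempty {p : Pos A // (a : A) ≤ p} :=
  ⟨⟨⟨(a : A)⁺, CFC.posPart_nonneg _⟩, CFC.le_posPart a.2⟩⟩

theorem le_normAbove {a : selfAdjoint A} {c : ℝ} (h : ∀ p : Pos A, (a : A) ≤ p → c ≤ ‖(p : A)‖) :
    c ≤ normAbove a :=
  le_ciInf fun p => h p.1 p.2

theorem normAbove_smul_le {c : ℝ} (hc : 0 < c) (a : selfAdjoint A) :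
    normAbove (c • a) ≤ c * normAbove a := by
  rw [← div_le_iff₀' hc]
  refine le_normAbove fun p hp => ?_
  rw [div_le_iff₀' hc]
  lift c to ℝ≥0 using hc.le
  refine (normAbove_le (p := p.scale c) ?_).trans_eq ?_
  · exact smul_le_smul_of_nonneg_left hp hc.le
  · rw [Pos.coe_scale, norm_smul, Real.norm_of_nonneg hc.le]

theorem normAbove_smul {c : ℝ} (hc : 0 < c) (a : selfAdjoint A) :
    normAbove (c • a) = c * normAbove a := by
  refine (normAbove_smul_le hc a).antisymm ?_
  have h := normAbove_smul_le (inv_pos.2 hc) (c • a)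
  rwa [smul_smul, inv_mul_cancel₀ hc.ne', one_smul, le_inv_mul_iff₀ hc] at h

theorem normAbove_add (a b : selfAdjoint A) : normAbove (a + b) ≤ normAbove a + normAbove b := by
  rw [← sub_le_iff_le_add]
  refine le_normAbove fun p hp => ?_
  rw [sub_le_iff_le_add, ← sub_le_iff_le_add']
  refine le_normAbove fun q hq => ?_
  rw [sub_le_iff_le_add']
  exact (normAbove_le (p := p + q) (add_le_add hp hq)).trans (norm_add_le _ _)

theorem mul_norm_le_normAbove (t : ℝ) (x : Pos A) :
    t * ‖(x : A)‖ ≤ normAbove (t • ⟨x, .of_nonneg x.2⟩ : selfAdjoint A) := by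
  refine le_normAbove fun p hp => ?_
  rcases le_total t 0 with ht | ht
  · exact (mul_nonpos_of_nonpos_of_nonneg ht (norm_nonneg _)).trans (norm_nonneg _)
  · rw [← Real.norm_of_nonneg ht, ← norm_smul]
    exact CStarAlgebra.norm_le_norm_of_nonneg_of_le (smul_nonneg ht x.2) hp

theorem mem_quasiState_of_le_normAbove {g : selfAdjoint A →ₗ[ℝ] ℝ}
    (hg : ∀ a, g a ≤ normAbove a) :
    (fun p : Pos A => g ⟨p, .of_nonneg p.2⟩) ∈ quasiState A := by
  let toSA (p : Pos A) : selfAdjoint A := ⟨p, .of_nonneg p.2⟩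
  refine ⟨⟨fun p => ?_, fun p q => map_add g (toSA p) (toSA q),
    fun t p => map_smul g (t : ℝ) (toSA p)⟩, fun p => (hg _).trans (normAbove_le le_rfl)⟩
  have h := (hg (-toSA p)).trans (normAbove_le (p := 0) (neg_nonpos.2 p.2))
  rw [map_neg] at h
  simpa using h

theorem exists_quasiState_eq_norm (x : Pos A) : ∃ ω ∈ quasiState A, ω x = ‖(x : A)‖ := by
  rcases eq_or_ne (x : A) 0 with hx | hx
  · exact ⟨0, zero_mem_quasiState, by simp [hx]⟩
  let y : selfAdjoint A := ⟨x, .of_nonneg x.2⟩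
  have hy : y ≠ 0 := fun h => hx (congrArg Subtype.val h)
  obtain ⟨g, hg, hgN⟩ := exists_extension_of_le_sublinear
    (LinearPMap.mkSpanSingleton (K := ℝ) y ‖(x : A)‖ hy) normAbove
    (fun c hc a => normAbove_smul hc a) normAbove_add (by
      rintro ⟨_, h⟩
      obtain ⟨t, rfl⟩ := Submodule.mem_span_singleton.1 h
      change LinearPMap.mkSpanSingleton' _ _ _ _ ≤ _
      rw [LinearPMap.mkSpanSingleton'_apply]
      exact mul_norm_le_normAbove t x)
  refine ⟨_, mem_quasiState_of_le_normAbove hgN, ?_⟩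
  have h := hg ⟨y, Submodule.mem_span_singleton_self _⟩
  rwa [LinearPMap.mkSpanSingleton_apply] at h

end NormAbove

section Separation

theorem mem_span_eval {X : Type*} (l : (X → ℝ) →L[ℝ] ℝ) :
    (l : (X → ℝ) →ₗ[ℝ] ℝ) ∈
      Submodule.span ℝ (Set.range (LinearMap.proj : X → (X → ℝ) →ₗ[ℝ] ℝ)) :=
  LinearMap.mem_span_iff_continuous _ |>.2 l.continuous

theorem exists_eq_eval_sub_eval (l : (Pos A → ℝ) →L[ℝ] ℝ) :
    ∃ p q : Pos A, ∀ χ, IsPosFun χ → l χ = χ p - χ q := by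
  obtain ⟨l', hl'⟩ : ∃ l' : (Pos A → ℝ) →ₗ[ℝ] ℝ, l' = l := ⟨_, rfl⟩
  suffices ∃ p q : Pos A, ∀ χ, IsPosFun χ → l' χ = χ p - χ q by rwa [hl'] at this
  have hmem := mem_span_eval l
  rw [← hl'] at hmem
  clear hl'
  induction hmem using Submodule.span_induction with
  | mem l h =>
    obtain ⟨p, rfl⟩ := h
    exact ⟨p, 0, fun χ hχ => by rw [hχ.zero, sub_zero, LinearMap.proj_apply]⟩
  | zero => exact ⟨0, 0, fun χ _ => by rw [LinearMap.zero_apply, sub_self]⟩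
  | add l l' _ _ h h' =>
    obtain ⟨p, q, h⟩ := h
    obtain ⟨p', q', h'⟩ := h'
    refine ⟨p + p', q + q', fun χ hχ => ?_⟩
    rw [LinearMap.add_apply, h χ hχ, h' χ hχ, hχ.add, hχ.add, add_sub_add_comm]
  | smul c l _ h =>
    obtain ⟨p, q, h⟩ := h
    refine ⟨p.scale c.toNNReal + q.scale (-c).toNNReal,
      q.scale c.toNNReal + p.scale (-c).toNNReal, fun χ hχ => ?_⟩
    rw [LinearMap.smul_apply, h χ hχ, hχ.add, hχ.add, hχ.scale, hχ.scale, hχ.scale, hχ.scale,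
      Real.coe_toNNReal', Real.coe_toNNReal', smul_eq_mul]
    nth_rewrite 1 [← max_zero_sub_max_neg_zero_eq_self c]
    ring

theorem exists_mem_quasispectrum_sub_gt {φ : Pos A → ℝ} (hφ : φ ∈ quasiState A) {p q : Pos A}
    {s : ℝ} (hs : 0 ≤ s) (h : s < φ p - φ q) : ∃ t ∈ quasispectrum ℝ ((p : A) - q), s < t := by
  by_contra! hle
  let m : Pos A := ⟨((p : A) - q)⁺, CFC.posPart_nonneg _⟩
  have hm : ‖(m : A)‖ ≤ s := by
    change ‖((p : A) - q)⁺‖ ≤ s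
    rw [CFC.posPart_def]
    refine norm_cfcₙ_le fun t ht => ?_
    rw [Real.norm_of_nonneg (posPart_nonneg t)]
    exact sup_le (hle t ht) hs
  have hpq : (p : A) ≤ (q + m : Pos A) := by
    rw [Nonneg.coe_add, ← sub_le_iff_le_add']
    exact CFC.le_posPart ((IsSelfAdjoint.of_nonneg p.2).sub (IsSelfAdjoint.of_nonneg q.2))
  have hφpq : φ p ≤ φ q + φ m := (hφ.1.mono hpq).trans_eq (hφ.1.add q m)
  linarith [hφ.2 m]

theorem exists_smul_mul_self_le {k : A} (hk : IsSelfAdjoint k) {r t : ℝ} (hr : 0 ≤ r)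
    (hrt : r < t) (ht : t ∈ quasispectrum ℝ k) :
    ∃ u : Pos A, (u : A) ≠ 0 ∧ r • ((u : A) * u) ≤ u * k * u := by
  let f : ℝ → ℝ := fun x => max (x - r) 0
  have hf : Continuous f := by fun_prop
  have hf0 : f 0 = 0 := by simp [f, hr]
  refine ⟨⟨cfcₙ f k, cfcₙ_nonneg fun _ _ => le_max_right _ _⟩, fun hu => ?_, ?_⟩
  · have h := norm_apply_le_norm_cfcₙ f k ht hf.continuousOn hf0 hk
    rw [show cfcₙ f k = 0 from hu, norm_zero, norm_le_zero_iff] at h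
    exact (lt_max_of_lt_left (sub_pos.2 hrt)).ne' h
  · have e : cfcₙ (fun x => f x * x * f x - r * (f x * f x)) k =
        cfcₙ f k * k * cfcₙ f k - r • (cfcₙ f k * cfcₙ f k) := by
      rw [cfcₙ_sub (fun x => f x * x * f x) (fun x => r * (f x * f x)) k
          (hf0 := by simp [hf0]) (hg0 := by simp [hf0]),
        cfcₙ_mul (fun x => f x * x) f k (hf0 := by simp [hf0]), cfcₙ_mul f (fun x => x) k,
        cfcₙ_const_mul r (fun x => f x * f x) k, cfcₙ_mul f f k, cfcₙ_id' ℝ k]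
    rw [← sub_nonneg, ← e]
    refine cfcₙ_nonneg fun x _ => ?_
    rcases le_total x r with hx | hx
    · simp [f, max_eq_right (sub_nonpos.2 hx)]
    · calc 0 ≤ (x - r) * (f x * f x) := mul_nonneg (sub_nonneg.2 hx) (mul_self_nonneg _)
        _ = f x * x * f x - r * (f x * f x) := by ring

theorem exists_scale_add_conj_le_conj {φ : Pos A → ℝ} (hφ : φ ∈ quasiState A) {p q : Pos A}
    {s : ℝ} (hs : 0 ≤ s) (h : s < φ p - φ q) :
    ∃ u : Pos A, (u : A) ≠ 0 ∧ ∃ r : ℝ≥0, s < r ∧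
      (Pos.starMul (u : A)).scale r + q.conj u ≤ p.conj u := by
  obtain ⟨t, ht, hst⟩ := exists_mem_quasispectrum_sub_gt hφ hs h
  obtain ⟨r, hsr, hrt⟩ := exists_between hst
  lift r to ℝ≥0 using hs.trans hsr.le
  obtain ⟨u, hu, hle⟩ := exists_smul_mul_self_le
    ((IsSelfAdjoint.of_nonneg p.2).sub (IsSelfAdjoint.of_nonneg q.2)) r.2 hrt ht
  refine ⟨u, hu, r, hsr, ?_⟩
  change (r : ℝ) • (star (u : A) * u) + star (u : A) * q * u ≤ star (u : A) * p * u
  rwa [Pos.star_eq, ← le_sub_iff_add_le, ← sub_mul, ← mul_sub]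

theorem exists_scale_add_conj_le_conj_of_notMem {S : Set (Pos A → ℝ)} (hS : Convex ℝ S)
    (hSc : IsClosed S) (h0 : 0 ∈ S) {φ : Pos A → ℝ} (hφ : φ ∈ quasiState A) (hφS : φ ∉ S) :
    ∃ p q u : Pos A, ∃ r : ℝ≥0, (u : A) ≠ 0 ∧
      (Pos.starMul (u : A)).scale r + q.conj u ≤ p.conj u ∧
      ∀ χ ∈ S, IsPosFun χ → χ p - χ q < r := by
  obtain ⟨l, s, hl, hs⟩ := geometric_hahn_banach_closed_point hS hSc hφS
  obtain ⟨p, q, hpq⟩ := exists_eq_eval_sub_eval l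
  have hs0 : 0 ≤ s := by simpa only [map_zero] using (hl 0 h0).le
  rw [hpq φ hφ.1] at hs
  obtain ⟨u, hu, r, hr, hle⟩ := exists_scale_add_conj_le_conj hφ hs0 hs
  exact ⟨p, q, u, r, hu, hle, fun χ hχS hχ => by rw [← hpq χ hχ]; exact (hl χ hχS).trans hr⟩

end Separation

section Extreme

theorem IsPosFun.le_mul_norm_of_norm_lt_one {φ : Pos A → ℝ} (hφ : IsPosFun φ) {M : ℝ}
    (hM : ∀ x : Pos A, ‖(x : A)‖ < 1 → φ x ≤ M) (x : Pos A) : φ x ≤ M * ‖(x : A)‖ := by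
  have hlim : Tendsto (fun r : ℝ => M * r) (𝓝[>] ‖(x : A)‖) (𝓝 (M * ‖(x : A)‖)) :=
    ((continuous_const_mul M).tendsto _).mono_left nhdsWithin_le_nhds
  refine ge_of_tendsto hlim (eventually_nhdsWithin_of_forall fun r hr => ?_)
  have hr0 : 0 < r := (norm_nonneg _).trans_lt hr
  lift r to ℝ≥0 using hr0.le
  have h := hM (x.scale r⁻¹) (by
    rw [Pos.coe_scale, norm_smul, NNReal.coe_inv, norm_inv, Real.norm_of_nonneg hr0.le,
      inv_mul_lt_iff₀ hr0, mul_one]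
    exact hr)
  rwa [hφ.scale, NNReal.coe_inv, inv_mul_le_iff₀' hr0] at h

theorem exists_le_mul_norm_of_add_mem_quasiState {φ ψ : Pos A → ℝ} (hφ : IsPosFun φ)
    (hψ : IsPosFun ψ) (h : ∀ x : Pos A, φ x + ψ x ≤ ‖(x : A)‖) :
    ∃ s t : ℝ, 0 ≤ s ∧ 0 ≤ t ∧ s + t = 1 ∧ (∀ x : Pos A, φ x ≤ s * ‖(x : A)‖) ∧
      ∀ x : Pos A, ψ x ≤ t * ‖(x : A)‖ := by
  let B := {x : Pos A // ‖(x : A)‖ < 1}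
  have : Nonempty B := ⟨⟨0, by simp⟩⟩
  have hdir (x y : B) : φ x.1 + ψ y.1 ≤ 1 := by
    obtain ⟨z, hz, hxz, hyz⟩ := CStarAlgebra.directedOn_nonneg_ball (A := A) x.1.1
      ⟨x.1.2, by simpa using x.2⟩ y.1.1 ⟨y.1.2, by simpa using y.2⟩
    have hzφ : φ x.1 ≤ φ ⟨z, hz.1⟩ := hφ.mono hxz
    have hzψ : ψ y.1 ≤ ψ ⟨z, hz.1⟩ := hψ.mono hyz
    have hz1 : ‖z‖ < 1 := by simpa using hz.2
    linarith [h ⟨z, hz.1⟩]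
  have hφle (x : B) : φ x.1 ≤ ⨆ x : B, φ x.1 :=
    le_ciSup (f := fun x : B => φ x.1) ⟨1, by
      rintro _ ⟨x, rfl⟩
      exact le_of_add_le_of_nonneg_left (hdir x x) (hψ.nonneg _)⟩ x
  have hψle (y : B) : ψ y.1 ≤ 1 - ⨆ x : B, φ x.1 :=
    le_sub_comm.1 (ciSup_le fun x => le_sub_iff_add_le.2 (hdir x y))
  obtain ⟨x⟩ := this
  exact ⟨⨆ x : B, φ x.1, 1 - ⨆ x : B, φ x.1, (hφ.nonneg _).trans (hφle x),
    (hψ.nonneg _).trans (hψle x), add_sub_cancel _ _,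
    hφ.le_mul_norm_of_norm_lt_one fun x hx => hφle ⟨x, hx⟩,
    hψ.le_mul_norm_of_norm_lt_one fun y hy => hψle ⟨y, hy⟩⟩

theorem exists_eq_mul_of_mem_extremePoints {φ χ : Pos A → ℝ}
    (hφ : φ ∈ (quasiState A).extremePoints ℝ) (hχ : IsPosFun χ) (hle : ∀ x, χ x ≤ φ x) :
    ∃ c, ∀ x, χ x = c * φ x := by
  obtain ⟨hφQ, hext⟩ := mem_extremePoints.1 hφ
  have hφχ := hφQ.1.sub_fun hχ hle
  obtain ⟨s, t, hs, ht, hst, hχs, hφχt⟩ := exists_le_mul_norm_of_add_mem_quasiState hχ hφχ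
    fun x => (add_sub_cancel (χ x) (φ x)).trans_le (hφQ.2 x)
  have eq_zero {ρ : Pos A → ℝ} (hρ : IsPosFun ρ) {r : ℝ} (hr : 0 = r)
      (h : ∀ x : Pos A, ρ x ≤ r * ‖(x : A)‖) (x : Pos A) : ρ x = 0 :=
    (hρ.nonneg x).antisymm' ((h x).trans_eq (by rw [← hr, zero_mul]))
  rcases hs.eq_or_lt with hs0 | hs0
  · exact ⟨0, fun x => by rw [eq_zero hχ hs0 hχs, zero_mul]⟩
  rcases ht.eq_or_lt with ht0 | ht0
  · exact ⟨1, fun x => by linarith [eq_zero hφχ ht0 hφχt x]⟩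
  have h := hext _ (hχ.inv_mul_mem_quasiState hs0 hχs) _ (hφχ.inv_mul_mem_quasiState ht0 hφχt)
    ⟨s, t, hs0, ht0, hst, funext fun x => by
      simp only [Pi.add_apply, Pi.smul_apply, smul_eq_mul]
      rw [mul_inv_cancel_left₀ hs0.ne', mul_inv_cancel_left₀ ht0.ne', add_sub_cancel]⟩
  exact ⟨s, fun x => by rw [← congrFun h.1 x, mul_inv_cancel_left₀ hs0.ne']⟩

end Extreme

end QuasiState

section ProductFunctional

variable {A₁ A₂ C : Type*}
  [NonUnitalCStarAlgebra A₁] [PartialOrder A₁] [StarOrderedRing A₁]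
  [NonUnitalCStarAlgebra A₂] [PartialOrder A₂] [StarOrderedRing A₂]
  [NonUnitalCStarAlgebra C] [PartialOrder C] [StarOrderedRing C]
  {β : CStarNorm A₁ A₂} {ι : A₁ ⊗[ℂ] A₂ →⋆ₙₐ[ℂ] C}

section Marginal

/-- The pairs of a functional `φ` on `A₁` and a functional `ω` on `C` such that `φ` dominates the
restrictions `ω (· ⊗ f)` for `f` of norm at most one and is dominated, up to the factor `r`, by
`ω (· ⊗ (p - q))`. -/
def marginalSet (ι : A₁ ⊗[ℂ] A₂ →⋆ₙₐ[ℂ] C) (r : ℝ) (p q : Pos A₂) :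
    Set ((Pos A₁ → ℝ) × (Pos C → ℝ)) :=
  (quasiState A₁ ×ˢ quasiState C) ∩
    ((⋂ (a) (f : Pos A₂), {z | z.2 (Pos.tmul ι a f) ≤ ‖(f : A₂)‖ * z.1 a}) ∩
      ⋂ a, {z | r * z.1 a + z.2 (Pos.tmul ι a q) ≤ z.2 (Pos.tmul ι a p)})

theorem mem_marginalSet {r : ℝ} {p q : Pos A₂} {φ : Pos A₁ → ℝ} {ω : Pos C → ℝ} :
    (φ, ω) ∈ marginalSet ι r p q ↔ (φ ∈ quasiState A₁ ∧ ω ∈ quasiState C) ∧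
      (∀ a (f : Pos A₂), ω (Pos.tmul ι a f) ≤ ‖(f : A₂)‖ * φ a) ∧
      ∀ a, r * φ a + ω (Pos.tmul ι a q) ≤ ω (Pos.tmul ι a p) := by
  simp only [marginalSet, Set.mem_inter_iff, Set.mem_prod, Set.mem_iInter, Set.mem_ofPred_eq]

theorem isCompact_marginalSet (r : ℝ) (p q : Pos A₂) : IsCompact (marginalSet ι r p q) := by
  refine (isCompact_quasiState.prod isCompact_quasiState).inter_right (IsClosed.inter ?_ ?_)
  · exact isClosed_iInter fun a => isClosed_iInter fun f => isClosed_le (by fun_prop) (by fun_prop)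
  · exact isClosed_iInter fun a => isClosed_le (by fun_prop) (by fun_prop)

theorem convex_marginalSet (r : ℝ) (p q : Pos A₂) : Convex ℝ (marginalSet ι r p q) := by
  rintro ⟨φ, ω⟩ h ⟨φ', ω'⟩ h' s t hs ht hst
  obtain ⟨⟨hφ, hω⟩, hle, hge⟩ := mem_marginalSet.1 h
  obtain ⟨⟨hφ', hω'⟩, hle', hge'⟩ := mem_marginalSet.1 h'
  refine mem_marginalSet.2 ⟨⟨convex_quasiState hφ hφ' hs ht hst,
    convex_quasiState hω hω' hs ht hst⟩, fun a f => ?_, fun a => ?_⟩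
  · calc s * ω (Pos.tmul ι a f) + t * ω' (Pos.tmul ι a f)
        ≤ s * (‖(f : A₂)‖ * φ a) + t * (‖(f : A₂)‖ * φ' a) :=
          add_le_add (mul_le_mul_of_nonneg_left (hle a f) hs)
            (mul_le_mul_of_nonneg_left (hle' a f) ht)
      _ = ‖(f : A₂)‖ * (s * φ a + t * φ' a) := by ring
  · calc r * (s * φ a + t * φ' a) + (s * ω (Pos.tmul ι a q) + t * ω' (Pos.tmul ι a q))
        = s * (r * φ a + ω (Pos.tmul ι a q)) + t * (r * φ' a + ω' (Pos.tmul ι a q)) := by ring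
      _ ≤ s * ω (Pos.tmul ι a p) + t * ω' (Pos.tmul ι a p) :=
          add_le_add (mul_le_mul_of_nonneg_left (hge a) hs) (mul_le_mul_of_nonneg_left (hge' a) ht)

theorem zero_mem_marginalSet (r : ℝ) (p q : Pos A₂) : 0 ∈ marginalSet ι r p q :=
  mem_marginalSet.2 ⟨⟨zero_mem_quasiState, zero_mem_quasiState⟩, by simp, by simp⟩

theorem compression_mem_marginalSet {ω : Pos C → ℝ} (hω : IsPosFun ω) {u : A₁} {v : A₂}
    (hN : 0 < ω (Pos.tmul ι (Pos.starMul u) (Pos.starMul v))) {r : ℝ≥0} {p q : Pos A₂}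
    (h : (Pos.starMul v).scale r + q.conj v ≤ p.conj v) :
    (fun x => (ω (Pos.tmul ι (Pos.starMul u) (Pos.starMul v)))⁻¹ *
        ω (Pos.tmul ι (x.conj u) (Pos.starMul v)),
      fun x => (ω (Pos.tmul ι (Pos.starMul u) (Pos.starMul v)))⁻¹ *
        ω (x.conj (ι (u ⊗ₜ[ℂ] v)))) ∈ marginalSet ι r p q := by
  have hleft := hω.tmul_left ι (Pos.starMul v)
  have hright (a : Pos A₁) := hω.tmul_right ι (a.conj u)
  refine mem_marginalSet.2 ⟨⟨?_, ?_⟩, fun a f => ?_, fun a => ?_⟩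
  · refine (hleft.comp_conj u).inv_mul_mem_quasiState hN fun x => ?_
    rw [mul_comm]
    exact hleft.conj_le x u
  · refine (hω.comp_conj _).inv_mul_mem_quasiState hN fun x => ?_
    rw [mul_comm, ← Pos.starMul_tmul]
    exact hω.conj_le x _
  · rw [Pos.conj_tmul, mul_left_comm]
    exact mul_le_mul_of_nonneg_left ((hright a).conj_le f v) (inv_nonneg.2 hN.le)
  · rw [Pos.conj_tmul, Pos.conj_tmul, mul_left_comm, ← mul_add]
    exact mul_le_mul_of_nonneg_left ((hright a).mul_add_le h) (inv_nonneg.2 hN.le)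

theorem mem_image_fst_marginalSet (hι : IsTensorCompletion β ι) {φ : Pos A₁ → ℝ}
    (hφ : φ ∈ quasiState A₁) {p q : Pos A₂} {v : A₂} (hv : v ≠ 0) {r : ℝ≥0}
    (h : (Pos.starMul v).scale r + q.conj v ≤ p.conj v) :
    φ ∈ Prod.fst '' marginalSet ι r p q := by
  by_contra hnot
  obtain ⟨p', q', u, r', hu, hle, hlt⟩ := exists_scale_add_conj_le_conj_of_notMem
    ((convex_marginalSet (r : ℝ) p q).linear_image (LinearMap.fst ℝ _ (Pos C → ℝ)))
    ((isCompact_marginalSet (ι := ι) (r : ℝ) p q).image continuous_fst).isClosed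
    ⟨0, zero_mem_marginalSet _ p q, rfl⟩ hφ hnot
  obtain ⟨ω, hω, hN⟩ := exists_quasiState_eq_norm (Pos.starMul (ι ((u : A₁) ⊗ₜ[ℂ] v)))
  have hN0 : 0 < ω (Pos.tmul ι (Pos.starMul (u : A₁)) (Pos.starMul v)) := by
    rw [← Pos.starMul_tmul, hN, norm_starMul]
    exact pow_pos (norm_pos_iff.2 (hι.map_tmul_ne_zero hu hv)) 2
  have hmem := compression_mem_marginalSet hω.1 hN0 h
  have hlt := hlt _ ⟨_, hmem, rfl⟩ (mem_marginalSet.1 hmem).1.1.1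
  have hge := (hω.1.tmul_left ι (Pos.starMul v)).mul_add_le hle
  rw [LinearMap.fst_apply, ← mul_sub, inv_mul_lt_iff₀ hN0] at hlt
  linarith

end Marginal

section Extension

/-- The pairs of functionals on `A₁` and `A₂` whose product extends to a functional on `C`. -/
def prodExtendable (ι : A₁ ⊗[ℂ] A₂ →⋆ₙₐ[ℂ] C) : Set ((Pos A₁ → ℝ) × (Pos A₂ → ℝ)) :=
  {z | (z.1 ∈ quasiState A₁ ∧ z.2 ∈ quasiState A₂) ∧
    ∃ ω ∈ quasiState C, ∀ a b, ω (Pos.tmul ι a b) = z.1 a * z.2 b}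

theorem isClosed_prodExtendable : IsClosed (prodExtendable ι) := by
  have e : prodExtendable ι = Prod.fst '' (((quasiState A₁ ×ˢ quasiState A₂) ×ˢ quasiState C) ∩
      ⋂ (a) (b), {z | z.2 (Pos.tmul ι a b) = z.1.1 a * z.1.2 b}) := by
    ext z
    constructor
    · rintro ⟨hz, ω, hω, h⟩
      exact ⟨(z, ω), ⟨⟨hz, hω⟩, Set.mem_iInter₂.2 h⟩, rfl⟩
    · rintro ⟨⟨z, ω⟩, ⟨⟨hz, hω⟩, h⟩, rfl⟩
      exact ⟨hz, ω, hω, Set.mem_iInter₂.1 h⟩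
  rw [e]
  refine (IsCompact.image ?_ continuous_fst).isClosed
  exact ((isCompact_quasiState.prod isCompact_quasiState).prod isCompact_quasiState).inter_right
    (isClosed_iInter fun a => isClosed_iInter fun b => isClosed_eq (by fun_prop) (by fun_prop))

theorem convex_prodExtendable_left (ψ : Pos A₂ → ℝ) :
    Convex ℝ {φ | (φ, ψ) ∈ prodExtendable ι} := by
  rintro φ ⟨⟨hφ, hψ⟩, ω, hω, h⟩ φ' ⟨⟨hφ', -⟩, ω', hω', h'⟩ s t hs ht hst
  refine ⟨⟨convex_quasiState hφ hφ' hs ht hst, hψ⟩, s • ω + t • ω',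
    convex_quasiState hω hω' hs ht hst, fun a b => ?_⟩
  simp only [Pi.add_apply, Pi.smul_apply, smul_eq_mul, h, h']
  ring

theorem convex_prodExtendable_right (φ : Pos A₁ → ℝ) :
    Convex ℝ {ψ | (φ, ψ) ∈ prodExtendable ι} := by
  rintro ψ ⟨⟨hφ, hψ⟩, ω, hω, h⟩ ψ' ⟨⟨-, hψ'⟩, ω', hω', h'⟩ s t hs ht hst
  refine ⟨⟨hφ, convex_quasiState hψ hψ' hs ht hst⟩, s • ω + t • ω',
    convex_quasiState hω hω' hs ht hst, fun a b => ?_⟩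
  simp only [Pi.add_apply, Pi.smul_apply, smul_eq_mul, h, h']
  ring

theorem zero_right_mem_prodExtendable {φ : Pos A₁ → ℝ} (hφ : φ ∈ quasiState A₁) :
    (φ, 0) ∈ prodExtendable ι :=
  ⟨⟨hφ, zero_mem_quasiState⟩, 0, zero_mem_quasiState, by simp⟩

theorem zero_left_mem_prodExtendable {ψ : Pos A₂ → ℝ} (hψ : ψ ∈ quasiState A₂) :
    (0, ψ) ∈ prodExtendable ι :=
  ⟨⟨zero_mem_quasiState, hψ⟩, 0, zero_mem_quasiState, by simp⟩

theorem exists_quasiState_mul_eq_of_mem_extremePoints {φ : Pos A₁ → ℝ}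
    (hφ : φ ∈ (quasiState A₁).extremePoints ℝ) {a₀ : Pos A₁} (ha₀ : 0 < φ a₀) {ω : Pos C → ℝ}
    (hω : IsPosFun ω) (h : ∀ a (f : Pos A₂), ω (Pos.tmul ι a f) ≤ ‖(f : A₂)‖ * φ a) :
    ∃ ψ ∈ quasiState A₂, ∀ a f, ω (Pos.tmul ι a f) = φ a * ψ f := by
  refine ⟨fun f => (φ a₀)⁻¹ * ω (Pos.tmul ι a₀ f), (hω.tmul_right ι a₀).inv_mul_mem_quasiState ha₀
    fun f => (h a₀ f).trans_eq (mul_comm _ _), fun a f => ?_⟩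
  obtain ⟨c, hc⟩ : ∃ c, ∀ x, ω (Pos.tmul ι x f) = c * φ x := by
    rcases (norm_nonneg (f : A₂)).eq_or_lt with hf | hf
    · refine ⟨0, fun x => ?_⟩
      have hle := h x f
      rw [← hf, zero_mul] at hle
      rw [zero_mul, hle.antisymm (hω.nonneg _)]
    · obtain ⟨c, hc⟩ := exists_eq_mul_of_mem_extremePoints hφ
        ((hω.tmul_left ι f).smul (inv_nonneg.2 hf.le)) fun x => (inv_mul_le_iff₀ hf).2 (h x f)
      exact ⟨‖(f : A₂)‖ * c, fun x => by rw [mul_assoc, ← inv_mul_eq_iff_eq_mul₀ hf.ne', hc]⟩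
  simp only [hc]
  field_simp

theorem mem_prodExtendable_of_mem_extremePoints (hι : IsTensorCompletion β ι) {φ : Pos A₁ → ℝ}
    (hφ : φ ∈ (quasiState A₁).extremePoints ℝ) {ψ : Pos A₂ → ℝ} (hψ : ψ ∈ quasiState A₂) :
    (φ, ψ) ∈ prodExtendable ι := by
  rcases eq_or_ne φ 0 with rfl | hφ0
  · exact zero_left_mem_prodExtendable hψ
  obtain ⟨a₀, ha₀⟩ := Function.ne_iff.1 hφ0
  have ha₀ : 0 < φ a₀ := (hφ.1.1.nonneg a₀).lt_of_ne' ha₀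
  by_contra hnot
  obtain ⟨p, q, v, r, hv, hle, hlt⟩ := exists_scale_add_conj_le_conj_of_notMem
    (convex_prodExtendable_right φ)
    ((isClosed_prodExtendable (ι := ι)).preimage (f := fun ψ => (φ, ψ)) (by fun_prop))
    (zero_right_mem_prodExtendable hφ.1) hψ hnot
  obtain ⟨⟨_, ω⟩, hmem, rfl⟩ := mem_image_fst_marginalSet hι hφ.1 hv hle
  obtain ⟨⟨hφQ, hω⟩, hdom, hge⟩ := mem_marginalSet.1 hmem
  obtain ⟨ψ', hψ', hmul⟩ := exists_quasiState_mul_eq_of_mem_extremePoints hφ ha₀ hω.1 hdom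
  have hlt := hlt ψ' ⟨⟨hφQ, hψ'⟩, ω, hω, hmul⟩ hψ'.1
  have hge := hge a₀
  rw [hmul, hmul, mul_comm, ← mul_add, mul_le_mul_iff_right₀ ha₀] at hge
  linarith

theorem mem_prodExtendable (hι : IsTensorCompletion β ι) {φ : Pos A₁ → ℝ}
    (hφ : φ ∈ quasiState A₁) {ψ : Pos A₂ → ℝ} (hψ : ψ ∈ quasiState A₂) :
    (φ, ψ) ∈ prodExtendable ι := by
  rw [← closure_convexHull_extremePoints isCompact_quasiState convex_quasiState] at hφ
  exact closure_minimal (convexHull_min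
      (fun φ hφ => mem_prodExtendable_of_mem_extremePoints hι hφ hψ) (convex_prodExtendable_left ψ))
    ((isClosed_prodExtendable (ι := ι)).preimage (f := fun φ => (φ, ψ)) (by fun_prop)) hφ

theorem exists_prod_posFun (hι : IsTensorCompletion β ι) {φ : Pos A₁ → ℝ} (hφ : IsPosFun φ)
    {ψ : Pos A₂ → ℝ} (hψ : IsPosFun ψ) :
    ∃ ω : Pos C → ℝ, IsPosFun ω ∧ ∀ a b, ω (Pos.tmul ι a b) = φ a * ψ b := by
  obtain ⟨s, hs, hsφ⟩ := hφ.exists_inv_mul_mem_quasiState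
  obtain ⟨t, ht, htψ⟩ := hψ.exists_inv_mul_mem_quasiState
  obtain ⟨-, ω, hω, h⟩ := mem_prodExtendable hι hsφ htψ
  refine ⟨fun x => s * t * ω x, hω.1.smul (mul_pos hs ht).le, fun a b => ?_⟩
  simp only [h]
  field_simp

end Extension

end ProductFunctional

section ProductTrace

theorem IsPosFun.ext_star_mul_mul {A : Type*} [NonUnitalCStarAlgebra A] [PartialOrder A]
    [StarOrderedRing A] {φ ψ : Pos A → ℝ} (hφ : IsPosFun φ) (hψ : IsPosFun ψ) {e f : Pos A}
    (h : ∀ x, φ (f.conj x) = ψ (e.conj (star x))) (x y : A) :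
    hφ.ext (star x * (f : A) * y) = hψ.ext (y * (e : A) * star x) := by
  let S : A →ₗ⋆[ℂ] A →ₗ[ℂ] ℂ := LinearMap.mk₂'ₛₗ (starRingEnd ℂ) (RingHom.id ℂ)
    (fun x y => hφ.ext (star x * (f : A) * y))
    (fun x x' y => by rw [star_add, add_mul, add_mul, map_add])
    (fun c x y => by rw [star_smul, smul_mul_assoc, smul_mul_assoc, map_smul]; rfl)
    (fun x y y' => by rw [mul_add, map_add])
    (fun c x y => by rw [mul_smul_comm, map_smul, RingHom.id_apply])
  let T : A →ₗ⋆[ℂ] A →ₗ[ℂ] ℂ := LinearMap.mk₂'ₛₗ (starRingEnd ℂ) (RingHom.id ℂ)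
    (fun x y => hψ.ext (y * (e : A) * star x))
    (fun x x' y => by rw [star_add, mul_add, map_add])
    (fun c x y => by rw [star_smul, mul_smul_comm, map_smul]; rfl)
    (fun x y y' => by rw [add_mul, add_mul, map_add])
    (fun c x y => by rw [smul_mul_assoc, smul_mul_assoc, map_smul, RingHom.id_apply])
  have hST : S = T := sesquilinear_ext_of_diag fun x => by
    have hx := hφ.ext_apply (f.conj x)
    have hx' := hψ.ext_apply (e.conj (star x))
    rw [Pos.coe_conj] at hx hx'
    rw [star_star] at hx'
    exact (hx.trans (congrArg _ (h x))).trans hx'.symm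
  exact LinearMap.congr_fun₂ hST x y

theorem isClosed_setOf_tendsto_clm {E F I : Type*} [NormedAddCommGroup E] [NormedSpace ℂ E]
    [NormedAddCommGroup F] [NormedSpace ℂ F] {l : Filter I} {L : I → E →L[ℂ] F} {M : ℝ}
    (hM : ∀ᶠ i in l, ‖L i‖ ≤ M) (L₀ : E →L[ℂ] F) :
    IsClosed {x | Tendsto (fun i => L i x) l (𝓝 (L₀ x))} := by
  refine isClosed_of_closure_subset fun x hx => Metric.tendsto_nhds.2 fun ε hε => ?_
  obtain ⟨y, hxy : (M + ‖L₀‖) * ‖y - x‖ < ε / 2, hy⟩ := mem_closure_iff.1 hx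
    {y | (M + ‖L₀‖) * ‖y - x‖ < ε / 2} (isOpen_lt (by fun_prop) continuous_const)
    (by simpa only [Set.mem_ofPred_eq, sub_self, norm_zero, mul_zero] using half_pos hε)
  filter_upwards [hM, Metric.tendsto_nhds.1 hy (ε / 2) (half_pos hε)] with i hi hiy
  have hL : dist (L i x) (L i y) ≤ M * ‖y - x‖ := by
    rw [dist_comm, dist_eq_norm, ← map_sub]
    exact (L i).le_of_opNorm_le hi _
  have hL₀ : dist (L₀ y) (L₀ x) ≤ ‖L₀‖ * ‖y - x‖ := by
    rw [dist_eq_norm, ← map_sub]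
    exact L₀.le_opNorm _
  rw [add_mul] at hxy
  linarith [dist_triangle4 (L i x) (L i y) (L₀ y) (L₀ x)]

variable {A₁ A₂ C : Type*}
  [NonUnitalCStarAlgebra A₁] [PartialOrder A₁] [StarOrderedRing A₁]
  [NonUnitalCStarAlgebra A₂] [PartialOrder A₂] [StarOrderedRing A₂]
  [NonUnitalCStarAlgebra C] [PartialOrder C] [StarOrderedRing C]
  {β : CStarNorm A₁ A₂} {ι : A₁ ⊗[ℂ] A₂ →⋆ₙₐ[ℂ] C}

theorem continuous_tmul (ι : A₁ ⊗[ℂ] A₂ →⋆ₙₐ[ℂ] C) :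
    Continuous fun p : A₁ × A₂ => ι (p.1 ⊗ₜ[ℂ] p.2) :=
  (LinearMap.mkContinuous₂ ((TensorProduct.mk ℂ A₁ A₂).compr₂ (ι : A₁ ⊗[ℂ] A₂ →ₗ[ℂ] C)) 1
    fun a b => (norm_tmul_le ι a b).trans_eq (by rw [one_mul])).continuous₂

theorem tendsto_tmul_mul (hι : IsTensorCompletion β ι) {I : Type*} {l : Filter I} {e : I → Pos A₁}
    {f : I → Pos A₂} (he : ∀ i, ‖(e i : A₁)‖ ≤ 1) (hf : ∀ i, ‖(f i : A₂)‖ ≤ 1)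
    (hel : ∀ x, Tendsto (fun i => (e i : A₁) * x) l (𝓝 x))
    (hfl : ∀ x, Tendsto (fun i => (f i : A₂) * x) l (𝓝 x)) (x : C) :
    Tendsto (fun i => (Pos.tmul ι (e i) (f i) : C) * x) l (𝓝 x) := by
  refine hι.denseRange.induction_on (p := fun x : C =>
      Tendsto (fun i => (Pos.tmul ι (e i) (f i) : C) * x) l (𝓝 x)) x
    (isClosed_setOf_tendsto_clm (L := fun i => ContinuousLinearMap.mul ℂ C (Pos.tmul ι (e i) (f i)))
      (M := 1) (.of_forall fun i => (ContinuousLinearMap.opNorm_mul_apply_le ℂ C _).trans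
        (norm_tmul_le_one ι (he i) (hf i))) (.id ℂ C)) fun t => ?_
  induction t with
  | zero => simpa only [map_zero, mul_zero] using tendsto_const_nhds
  | add s t hs ht => simpa only [map_add, mul_add] using hs.add ht
  | tmul a b =>
    have hab := ((continuous_tmul ι).tendsto (a, b)).comp ((hel a).prodMk_nhds (hfl b))
    simpa only [Pos.coe_tmul, map_tmul_mul, Function.comp_def] using hab

section ProductFunctional

variable {φ φ' : Pos A₁ → ℝ} {ψ ψ' : Pos A₂ → ℝ} {ω ω' : Pos C → ℝ}

theorem IsPosFun.ext_tmul (hφ : IsPosFun φ) (hψ : IsPosFun ψ) (hω : IsPosFun ω)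
    (h : ∀ a b, ω (Pos.tmul ι a b) = φ a * ψ b) (a : A₁) (b : A₂) :
    hω.ext (ι (a ⊗ₜ[ℂ] b)) = hφ.ext a * hψ.ext b := by
  let S : A₁ →ₗ[ℂ] A₂ →ₗ[ℂ] ℂ := ((TensorProduct.mk ℂ A₁ A₂).compr₂
    (ι : A₁ ⊗[ℂ] A₂ →ₗ[ℂ] C)).compr₂ (hω.ext : C →ₗ[ℂ] ℂ)
  let T : A₁ →ₗ[ℂ] A₂ →ₗ[ℂ] ℂ :=
    (LinearMap.mul ℂ ℂ).compl₁₂ (hφ.ext : A₁ →ₗ[ℂ] ℂ) (hψ.ext : A₂ →ₗ[ℂ] ℂ)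
  have hST : S = T := linearMap_ext_pos fun a => linearMap_ext_pos fun b => by
    change hω.ext (Pos.tmul ι a b) = hφ.ext a * hψ.ext b
    rw [hω.ext_apply, hφ.ext_apply, hψ.ext_apply, h, Complex.ofReal_mul]
  exact LinearMap.congr_fun₂ hST a b

theorem prod_posFun_mono (hι : IsTensorCompletion β ι) (hφ : IsPosFun φ) (hφ' : IsPosFun φ')
    (hψ : IsPosFun ψ) (hψ' : IsPosFun ψ') (hω : IsPosFun ω) (hω' : IsPosFun ω')
    (h : ∀ a b, ω (Pos.tmul ι a b) = φ a * ψ b) (h' : ∀ a b, ω' (Pos.tmul ι a b) = φ' a * ψ' b)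
    (hφφ' : ∀ a, φ a ≤ φ' a) (hψψ' : ∀ b, ψ b ≤ ψ' b) (x : Pos C) : ω x ≤ ω' x := by
  obtain ⟨ρ, hρ, hρ_mul⟩ := exists_prod_posFun hι (hφ'.sub_fun hφ hφφ') hψ'
  obtain ⟨σ, hσ, hσ_mul⟩ := exists_prod_posFun hι hφ (hψ'.sub_fun hψ hψψ')
  have e : ω' = fun x => ω x + (ρ x + σ x) :=
    hι.posFun_ext hω' (hω.add_fun (hρ.add_fun hσ)) fun a b => by rw [h, h', hρ_mul, hσ_mul]; ring
  rw [e]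
  exact le_add_of_nonneg_right (add_nonneg (hρ.nonneg x) (hσ.nonneg x))

theorem prod_posFun_conj (hι : IsTensorCompletion β ι) (hφ : IsPosFun φ) (hφ' : IsPosFun φ')
    (hψ : IsPosFun ψ) (hψ' : IsPosFun ψ') (hω : IsPosFun ω) (hω' : IsPosFun ω')
    (h : ∀ a b, ω (Pos.tmul ι a b) = φ a * ψ b) (h' : ∀ a b, ω' (Pos.tmul ι a b) = φ' a * ψ' b)
    {e e' : Pos A₁} {f f' : Pos A₂} (hφφ' : ∀ x, φ (e'.conj x) = φ' (e.conj (star x)))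
    (hψψ' : ∀ x, ψ (f'.conj x) = ψ' (f.conj (star x))) (x : C) :
    ω ((Pos.tmul ι e' f').conj x) = ω' ((Pos.tmul ι e f).conj (star x)) := by
  have hpolar (t s : A₁ ⊗[ℂ] A₂) : hω.ext (star (ι t) * (Pos.tmul ι e' f' : C) * ι s) =
      hω'.ext (ι s * (Pos.tmul ι e f : C) * star (ι t)) := by
    induction t with
    | zero => simp
    | add t t' ht ht' => simp only [map_add, star_add, add_mul, mul_add, ht, ht']
    | tmul a b =>
      induction s with
      | zero => simp
      | add s s' hs hs' => simp only [map_add, add_mul, mul_add, hs, hs']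
      | tmul c d =>
        simp only [star_map_tmul, Pos.coe_tmul, map_tmul_mul]
        rw [hφ.ext_tmul hψ hω h, hφ'.ext_tmul hψ' hω' h', hφ.ext_star_mul_mul hφ' hφφ',
          hψ.ext_star_mul_mul hψ' hψψ']
  rw [hω.eq_re, hω'.eq_re, Pos.coe_conj, Pos.coe_conj, star_star]
  congr 1
  exact hι.denseRange.induction_on (p := fun x : C =>
      hω.ext (star x * (Pos.tmul ι e' f' : C) * x) = hω'.ext (x * (Pos.tmul ι e f : C) * star x)) x
    (isClosed_eq (by fun_prop) (by fun_prop)) fun t => hpolar t t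

end ProductFunctional

theorem IsTraceNet.exists_prod (hι : IsTensorCompletion β ι) {I J : Type*} [Preorder I]
    [Preorder J] {e : I → Pos A₁} {f : J → Pos A₂} {φ : I → Pos A₁ → ℝ} {ψ : J → Pos A₂ → ℝ}
    (hφ : IsTraceNet e φ) (hψ : IsTraceNet f ψ) :
    ∃ ω : I × J → Pos C → ℝ, IsTraceNet (fun p : I × J => Pos.tmul ι (e p.1) (f p.2)) ω ∧
      ∀ p a b, ω p (Pos.tmul ι a b) = φ p.1 a * ψ p.2 b := by
  choose ω hω hω_tmul using fun p : I × J =>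
    exists_prod_posFun hι (hφ.isPosFun p.1) (hψ.isPosFun p.2)
  refine ⟨ω, ⟨hω, fun x p q hpq => ?_, fun p => ?_, fun p q x => ?_, ?_⟩, hω_tmul⟩
  · exact prod_posFun_mono hι (hφ.isPosFun _) (hφ.isPosFun _) (hψ.isPosFun _) (hψ.isPosFun _)
      (hω p) (hω q) (hω_tmul p) (hω_tmul q) (fun a => hφ.mono a hpq.1) (fun b => hψ.mono b hpq.2) x
  · exact norm_tmul_le_one ι (hφ.norm_le_one _) (hψ.norm_le_one _)
  · exact prod_posFun_conj hι (hφ.isPosFun _) (hφ.isPosFun _) (hψ.isPosFun _) (hψ.isPosFun _)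
      (hω p) (hω q) (hω_tmul p) (hω_tmul q) (hφ.symm _ _) (hψ.symm _ _) x
  · rw [← prod_atTop_atTop_eq]
    exact tendsto_tmul_mul hι (fun p => hφ.norm_le_one p.1) (fun p => hψ.norm_le_one p.2)
      (fun x => (hφ.tendsto_mul x).comp tendsto_fst) fun x => (hψ.tendsto_mul x).comp tendsto_snd

theorem exists_prod_ltc (hι : IsTensorCompletion β ι) (τ₁ : LTC A₁) (τ₂ : LTC A₂) :
    ∃ τ : LTC C, ∀ a b, τ (Pos.tmul ι a b) = τ₁ a * τ₂ b := by
  have h₁ := τ₁.isPedTrace_restrict.isTraceNet_cutFun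
  have h₂ := τ₂.isPedTrace_restrict.isTraceNet_cutFun
  obtain ⟨ω, hω, hω_tmul⟩ := h₁.exists_prod hι h₂
  have : IsDirected (PedBall A₁ × PedBall A₂) (· ≤ ·) := ⟨fun p q => by
    obtain ⟨e, hpe, hqe⟩ := exists_ge_ge p.1 q.1
    obtain ⟨f, hpf, hqf⟩ := exists_ge_ge p.2 q.2
    exact ⟨(e, f), ⟨hpe, hpf⟩, ⟨hqe, hqf⟩⟩⟩
  refine ⟨hω.toLTC, fun a b => ?_⟩
  rw [hω.toLTC_apply, ← τ₁.iSup_cutFun, ← τ₂.iSup_cutFun, ENNReal.iSup_mul, iSup_prod]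
  refine iSup_congr fun e => ?_
  rw [ENNReal.mul_iSup]
  exact iSup_congr fun f => by rw [hω_tmul, ENNReal.ofReal_mul ((h₁.isPosFun e).nonneg a)]

end ProductTrace

section TensorPedersen

variable {A₁ A₂ C : Type*}
  [NonUnitalCStarAlgebra A₁] [PartialOrder A₁] [StarOrderedRing A₁]
  [NonUnitalCStarAlgebra A₂] [PartialOrder A₂] [StarOrderedRing A₂]
  [NonUnitalCStarAlgebra C] {β : CStarNorm A₁ A₂} (ι : A₁ ⊗[ℂ] A₂ →⋆ₙₐ[ℂ] C)

theorem tmul_mem_pedersenIdeal {a : A₁} (ha : a ∈ pedersenIdeal A₁) {b : A₂}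
    (hb : b ∈ pedersenIdeal A₂) : ι (a ⊗ₜ[ℂ] b) ∈ pedersenIdeal C := by
  replace ha := pedersenIdeal_le_idealSpan_unitSet A₁ ha
  replace hb := pedersenIdeal_le_idealSpan_unitSet A₂ hb
  induction ha using Submodule.span_induction with
  | zero => simp
  | add x y _ _ hx hy => rw [TensorProduct.add_tmul, map_add]; exact Submodule.add_mem _ hx hy
  | smul c x _ hx => rw [← TensorProduct.smul_tmul', map_smul]; exact Submodule.smul_mem _ c hx
  | mem a ha =>
    obtain ⟨x, f, z, ⟨u, hu⟩, rfl⟩ := ha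
    induction hb using Submodule.span_induction with
    | zero => simp
    | add x y _ _ hx hy => rw [TensorProduct.tmul_add, map_add]; exact Submodule.add_mem _ hx hy
    | smul c x _ hx => rw [TensorProduct.tmul_smul, map_smul]; exact Submodule.smul_mem _ c hx
    | mem b hb =>
      obtain ⟨x', f', z', ⟨u', hu'⟩, rfl⟩ := hb
      have hfu : ι (u ⊗ₜ[ℂ] u') * ι (f ⊗ₜ[ℂ] f') = ι (f ⊗ₜ[ℂ] f') := by
        rw [map_tmul_mul, hu, hu']
      rw [← map_tmul_mul, ← map_tmul_mul]
      exact pedersenIdeal.mul_mem_right _ (pedersenIdeal.mul_mem_left _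
        (pedersenIdeal.mem_of_mul_eq hfu))

variable [PartialOrder C] [StarOrderedRing C]

/-- The elementary tensor of positive elements of the Pedersen ideals, as an element of the
Pedersen ideal of the completion. -/
def PedPos.tmul (a : PedPos A₁) (b : PedPos A₂) : PedPos C :=
  ⟨Pos.tmul ι a.1 b.1, tmul_mem_pedersenIdeal ι a.2 b.2⟩

theorem PedPos.conj_tmul (a : PedPos A₁) (b : PedPos A₂) (u : A₁) (v : A₂) :
    (PedPos.tmul ι a b).conj (ι (u ⊗ₜ[ℂ] v)) = PedPos.tmul ι (a.conj u) (b.conj v) :=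
  Subtype.ext (Pos.conj_tmul ι a.1 b.1 u v)

theorem continuous_pos_tmul : Continuous fun p : Pos A₁ × Pos A₂ => Pos.tmul ι p.1 p.2 :=
  ((continuous_tmul ι).comp (f := fun p : Pos A₁ × Pos A₂ => ((p.1 : A₁), (p.2 : A₂)))
    (by fun_prop)).subtype_mk _

variable {ι}

theorem IsTensorCompletion.eq_top (hι : IsTensorCompletion β ι) {S : Submodule ℂ C}
    (hS : IsClosed (S : Set C)) (h : ∀ (a : Pos A₁) (b : Pos A₂), (Pos.tmul ι a b : C) ∈ S) :
    S = ⊤ := by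
  let T : A₁ →ₗ[ℂ] A₂ →ₗ[ℂ] (C ⧸ S) := ((TensorProduct.mk ℂ A₁ A₂).compr₂
    (ι : A₁ ⊗[ℂ] A₂ →ₗ[ℂ] C)).compr₂ S.mkQ
  have hT : T = 0 := linearMap_ext_pos fun a => linearMap_ext_pos fun b =>
    (Submodule.Quotient.mk_eq_zero S).2 (h a b)
  have hmem (t : A₁ ⊗[ℂ] A₂) : ι t ∈ S := by
    induction t with
    | zero => simp
    | add s t hs ht => rw [map_add]; exact S.add_mem hs ht
    | tmul a b => exact (Submodule.Quotient.mk_eq_zero S).1 (LinearMap.congr_fun₂ hT a b)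
  exact eq_top_iff.2 fun x _ => hι.denseRange.induction_on (p := fun x => x ∈ S) x hS hmem

theorem IsTensorCompletion.pedersenIdeal_le (hι : IsTensorCompletion β ι) :
    pedersenIdeal C ≤
      idealSpan {e | ∃ (a : PedPos A₁) (b : PedPos A₂), e = Pos.tmul ι a.1 b.1} := by
  refine pedersenIdeal_le_idealSpan (Submodule.dense_iff_topologicalClosure_eq_top.2
    (hι.eq_top (Submodule.isClosed_topologicalClosure _) fun a b => ?_))
  refine ((dense_pedPos A₁).prod (dense_pedPos A₂)).induction
    (P := fun p => (Pos.tmul ι p.1 p.2 : C) ∈ (idealSpan _).topologicalClosure) ?_ ?_ (a, b)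
  · exact fun p hp => mem_closure_idealSpan ⟨⟨p.1, hp.1⟩, ⟨p.2, hp.2⟩, rfl⟩
  · exact (Submodule.isClosed_topologicalClosure _).preimage
      (continuous_subtype_val.comp (continuous_pos_tmul ι))

theorem IsTensorCompletion.tendsto_clm (hι : IsTensorCompletion β ι) {I : Type*} {l : Filter I}
    {L : I → C →L[ℂ] ℂ} {L₀ : C →L[ℂ] ℂ} {M : ℝ} (hM : ∀ᶠ i in l, ‖L i‖ ≤ M)
    (h : ∀ (a : Pos A₁) (b : Pos A₂),
      Tendsto (fun i => L i (Pos.tmul ι a b)) l (𝓝 (L₀ (Pos.tmul ι a b)))) (x : C) :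
    Tendsto (fun i => L i x) l (𝓝 (L₀ x)) := by
  let V : Submodule ℂ C :=
    { carrier := {x | Tendsto (fun i => L i x) l (𝓝 (L₀ x))}
      zero_mem' := by simpa only [Set.mem_ofPred_eq, map_zero] using tendsto_const_nhds
      add_mem' hx hy := by
        simpa only [Set.mem_ofPred_eq, map_add] using Tendsto.add (Set.mem_ofPred.1 hx) hy
      smul_mem' c x hx := by
        simpa only [Set.mem_ofPred_eq, map_smul] using
          Tendsto.const_smul (Set.mem_ofPred.1 hx) c }
  have hV : V = ⊤ := hι.eq_top (isClosed_setOf_tendsto_clm hM L₀) h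
  exact (hV ▸ Submodule.mem_top : x ∈ V)

theorem IsPedTrace.cutFun_le {φ : PedPos C → ℝ≥0} (hφ : IsPedTrace φ) (e : PedPos C) (x : Pos C) :
    cutFun φ e x ≤ φ e * ‖(x : C)‖ := by
  obtain ⟨τ, rfl⟩ := hφ.exists_restrict_eq
  have h : LTC.restrict C τ (e.conj (x.sqrt : C)) ≤ ‖(x : C)‖₊ * LTC.restrict C τ e := by
    rw [← ENNReal.coe_le_coe, ENNReal.coe_mul, LTC.coe_restrict, LTC.coe_restrict,
      PedPos.conj_val, τ.2.1.conj_sqrt]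
    have hle := τ.2.1.conj_le x (e.1.sqrt : C) (x.conj (e.1.sqrt : C)) rfl
    rwa [Pos.starMul_sqrt] at hle
  rw [mul_comm]
  exact_mod_cast h

theorem IsPedTrace.cutFun_tmul {φ : PedPos C → ℝ≥0} (hφ : IsPedTrace φ) (a : PedPos A₁)
    (b : PedPos A₂) (c : Pos A₁) (d : Pos A₂) :
    cutFun φ (PedPos.tmul ι a b) (Pos.tmul ι c d) =
      φ (PedPos.tmul ι (a.conj (c.sqrt : A₁)) (b.conj (d.sqrt : A₂))) := by
  rw [← PedPos.conj_tmul]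
  refine congrArg NNReal.toReal (hφ.conj_congr _ ?_)
  rw [Pos.star_eq, Pos.sqrt_mul_sqrt, star_map_tmul, map_tmul_mul, Pos.star_eq, Pos.star_eq,
    Pos.sqrt_mul_sqrt, Pos.sqrt_mul_sqrt, Pos.coe_tmul]

section Convergence

variable {I : Type*} {l : Filter I} {φ : I → PedPos C → ℝ≥0} {ψ : PedPos C → ℝ≥0}

theorem IsTensorCompletion.tendsto_cutFun_tmul (hι : IsTensorCompletion β ι)
    (hφ : ∀ i, IsPedTrace (φ i)) (hψ : IsPedTrace ψ)
    (h : ∀ (a : PedPos A₁) (b : PedPos A₂),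
      Tendsto (fun i => φ i (PedPos.tmul ι a b)) l (𝓝 (ψ (PedPos.tmul ι a b))))
    (a : PedPos A₁) (b : PedPos A₂) (x : Pos C) :
    Tendsto (fun i => cutFun (φ i) (PedPos.tmul ι a b) x) l
      (𝓝 (cutFun ψ (PedPos.tmul ι a b) x)) := by
  set e := PedPos.tmul ι a b
  have hM : ∀ᶠ i in l, ‖((hφ i).isPosFun_cutFun e).ext‖ ≤ 4 * (ψ e + 1 : ℝ) := by
    filter_upwards [(h a b).eventually (gt_mem_nhds (lt_add_one _))] with i hi
    refine ContinuousLinearMap.opNorm_le_bound _ (by positivity)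
      (IsPosFun.norm_ext_le _ (fun y => ((hφ i).cutFun_le e y).trans ?_) (by positivity))
    exact mul_le_mul_of_nonneg_right (mod_cast hi.le) (norm_nonneg _)
  have hlim := hι.tendsto_clm (L₀ := (hψ.isPosFun_cutFun e).ext) hM (fun c d => by
    simp only [IsPosFun.ext_apply, (hφ _).cutFun_tmul, hψ.cutFun_tmul, e]
    exact (Complex.continuous_ofReal.tendsto _).comp (NNReal.tendsto_coe.2 (h _ _))) x
  simpa only [Function.comp_def, IsPosFun.ext_apply, Complex.ofReal_re] using
    (Complex.continuous_re.tendsto _).comp hlim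

theorem IsTensorCompletion.tendsto_of_mem_conjCone (hι : IsTensorCompletion β ι)
    (hφ : ∀ i, IsPedTrace (φ i)) (hψ : IsPedTrace ψ)
    (h : ∀ (a : PedPos A₁) (b : PedPos A₂),
      Tendsto (fun i => φ i (PedPos.tmul ι a b)) l (𝓝 (ψ (PedPos.tmul ι a b))))
    {p : Pos C}
    (hp : p ∈ conjCone {e | ∃ (a : PedPos A₁) (b : PedPos A₂), e = Pos.tmul ι a.1 b.1}) :
    ∃ hpK : (p : C) ∈ pedersenIdeal C, Tendsto (fun i => φ i ⟨p, hpK⟩) l (𝓝 (ψ ⟨p, hpK⟩)) := by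
  induction hp using AddSubmonoid.closure_induction with
  | zero =>
    refine ⟨zero_mem _, ?_⟩
    simpa only [(hφ _).eq_zero (z := ⟨0, zero_mem _⟩) rfl,
      hψ.eq_zero (z := ⟨0, zero_mem _⟩) rfl] using tendsto_const_nhds
  | add p q _ _ hp hq =>
    obtain ⟨hpK, hp⟩ := hp
    obtain ⟨hqK, hq⟩ := hq
    have hadd {ρ : PedPos C → ℝ≥0} (hρ : IsPedTrace ρ) :
        ρ ⟨p + q, Submodule.add_mem _ hpK hqK⟩ = ρ ⟨p, hpK⟩ + ρ ⟨q, hqK⟩ :=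
      hρ.add ⟨p, hpK⟩ ⟨q, hqK⟩
    refine ⟨Submodule.add_mem _ hpK hqK, ?_⟩
    simpa only [hadd (hφ _), hadd hψ] using hp.add hq
  | mem p hp =>
    obtain ⟨_, ⟨a, b, rfl⟩, w, rfl⟩ := hp
    refine ⟨((PedPos.tmul ι a b).conj w).2, NNReal.tendsto_coe.1 ?_⟩
    have hlim := hι.tendsto_cutFun_tmul hφ hψ h a b (Pos.starMul (star w))
    simp only [(hφ _).cutFun_starMul, hψ.cutFun_starMul, star_star] at hlim
    exact hlim

theorem IsTensorCompletion.tendsto_isPedTrace (hι : IsTensorCompletion β ι)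
    (hφ : ∀ i, IsPedTrace (φ i)) (hψ : IsPedTrace ψ)
    (h : ∀ (a : PedPos A₁) (b : PedPos A₂),
      Tendsto (fun i => φ i (PedPos.tmul ι a b)) l (𝓝 (ψ (PedPos.tmul ι a b)))) (k : PedPos C) :
    Tendsto (fun i => φ i k) l (𝓝 (ψ k)) := by
  obtain ⟨n, hn, _, hp, rfl⟩ := exists_add_eq_of_mem_idealSpan (hι.pedersenIdeal_le k.2)
  obtain ⟨hnK, hn⟩ := hι.tendsto_of_mem_conjCone hφ hψ h hn
  obtain ⟨hpK, hp⟩ := hι.tendsto_of_mem_conjCone hφ hψ h hp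
  have hsub {ρ : PedPos C → ℝ≥0} (hρ : IsPedTrace ρ) : ρ k = ρ ⟨k.1 + n, hpK⟩ - ρ ⟨n, hnK⟩ :=
    eq_tsub_of_add_eq (hρ.add k ⟨n, hnK⟩).symm
  simpa only [hsub (hφ _), hsub hψ] using hp.sub hn

end Convergence

theorem IsTensorCompletion.isInducing_restrict_tmul (hι : IsTensorCompletion β ι) :
    IsInducing fun (τ : LTC C) (p : PedPos A₁ × PedPos A₂) =>
      LTC.restrict C τ (PedPos.tmul ι p.1 p.2) := by
  set r := fun (τ : LTC C) (p : PedPos A₁ × PedPos A₂) =>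
    LTC.restrict C τ (PedPos.tmul ι p.1 p.2)
  have hr : Continuous r := continuous_pi fun p => (continuous_apply _).comp continuous_induced_dom
  refine isInducing_iff_nhds.2 fun τ => le_antisymm (hr.tendsto τ).le_comap ?_
  rw [nhds_induced, ← tendsto_iff_comap, tendsto_pi_nhds]
  exact hι.tendsto_isPedTrace (fun σ => σ.isPedTrace_restrict) τ.isPedTrace_restrict
    fun a b => tendsto_pi_nhds.1 (tendsto_comap (f := r)) (a, b)

theorem IsTensorCompletion.ltc_ext (hι : IsTensorCompletion β ι) {σ τ : LTC C}
    (h : ∀ (a : PedPos A₁) (b : PedPos A₂),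
      LTC.restrict C σ (PedPos.tmul ι a b) = LTC.restrict C τ (PedPos.tmul ι a b)) : σ = τ :=
  LTC.restrict_injective C <| funext fun k => tendsto_nhds_unique tendsto_const_nhds <|
    hι.tendsto_isPedTrace (l := pure ()) (fun _ => σ.isPedTrace_restrict) τ.isPedTrace_restrict
      (fun a b => (h a b).symm ▸ tendsto_const_nhds) k

end TensorPedersen

section Slices

variable {A₁ A₂ C : Type*}
  [NonUnitalCStarAlgebra A₁] [PartialOrder A₁] [StarOrderedRing A₁]
  [NonUnitalCStarAlgebra A₂] [PartialOrder A₂] [StarOrderedRing A₂]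
  [NonUnitalCStarAlgebra C] [PartialOrder C] [StarOrderedRing C]
  (ι : A₁ ⊗[ℂ] A₂ →⋆ₙₐ[ℂ] C)

theorem IsTrace.tmul_right {τ : Pos C → ℝ≥0∞} (hτ : IsTrace τ) (a : Pos A₁) :
    IsTrace fun b : Pos A₂ => τ (Pos.tmul ι a b) where
  add b c := by rw [Pos.tmul_add, hτ.add]
  scale t b := by rw [Pos.tmul_scale, hτ.scale]
  tracial x := by
    rw [← Pos.starMul_sqrt a, ← Pos.starMul_tmul, hτ.tracial, star_map_tmul, Pos.starMul_tmul,
      Pos.star_eq]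

theorem IsTrace.tmul_left {τ : Pos C → ℝ≥0∞} (hτ : IsTrace τ) (b : Pos A₂) :
    IsTrace fun a : Pos A₁ => τ (Pos.tmul ι a b) where
  add b c := by rw [Pos.add_tmul, hτ.add]
  scale t b := by rw [Pos.scale_tmul, hτ.scale]
  tracial x := by
    rw [← Pos.starMul_sqrt b, ← Pos.starMul_tmul, hτ.tracial, star_map_tmul, Pos.starMul_tmul,
      Pos.star_eq]

/-- The slice `b ↦ τ (a ⊗ b)` of a trace on the completion, a trace on the second factor. -/
def LTC.slice (τ : LTC C) (a : PedPos A₁) : LTC A₂ :=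
  ⟨fun b => τ (Pos.tmul ι a.1 b), τ.2.1.tmul_right ι a.1,
    τ.2.2.1.comp ((continuous_pos_tmul ι).comp (f := fun b => (a.1, b)) (by fun_prop)),
    (dense_pedPos A₂).mono fun b hb => τ.lt_top (PedPos.tmul ι a ⟨b, hb⟩)⟩

theorem LTC.restrict_slice (τ : LTC C) (a : PedPos A₁) (b : PedPos A₂) :
    LTC.restrict A₂ (τ.slice ι a) b = LTC.restrict C τ (PedPos.tmul ι a b) := rfl

theorem LTC.isPedTrace_slice (τ : LTC C) : IsPedTrace (τ.slice ι : PedPos A₁ → LTC A₂) := by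
  refine .of_injective (LTC.restrict A₂) (LTC.restrict_injective A₂) (.pi fun b => .of_coe ?_)
  simp only [LTC.restrict_slice, LTC.coe_restrict]
  exact (τ.2.1.tmul_left ι b.1).isPedTrace

end Slices

section Approximation

theorem mem_closure_pi_of_forall_finset {X Y : Type*} [PseudoMetricSpace Y] {S : Set (X → Y)}
    {f : X → Y} (h : ∀ F : Finset X, ∀ ε > 0, ∃ g ∈ S, ∀ x ∈ F, dist (g x) (f x) ≤ ε) :
    f ∈ closure S := by
  refine mem_closure_iff_nhds.2 fun U hU => ?_
  rw [nhds_pi, mem_pi'] at hU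
  obtain ⟨F, t, ht, hFU⟩ := hU
  have hball : ∀ᶠ ε in 𝓝[>] (0 : ℝ), ∀ x ∈ F, Metric.closedBall (f x) ε ⊆ t x :=
    nhdsWithin_le_nhds (F.eventually_all.2 fun x _ => eventually_closedBall_subset (ht x))
  obtain ⟨ε, hε, hε0⟩ := (hball.and self_mem_nhdsWithin).exists
  obtain ⟨g, hg, hgf⟩ := h F ε hε0
  exact ⟨g, hFU fun x hx => hε x hx (hgf x hx), hg⟩

theorem abs_inv_mul_mul_sub_le {s t u v c d : ℝ} (hu : 0 ≤ u) (huv : u ≤ v) (hd : 0 ≤ d)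
    (hcu : c * u ≤ s) (hsu : s ≤ (c + d) * u) (hcv : c * v ≤ t) (htv : t ≤ (c + d) * v) :
    |v⁻¹ * t * u - s| ≤ d * v := by
  rcases (hu.trans huv).eq_or_lt with rfl | hv
  · obtain rfl : u = 0 := le_antisymm huv hu
    rw [mul_zero] at hcu hsu
    simp [le_antisymm hsu hcu]
  · have hcu' : c * u ≤ v⁻¹ * t * u :=
      mul_le_mul_of_nonneg_right ((le_inv_mul_iff₀ hv).2 (by linarith)) hu
    have htu : v⁻¹ * t * u ≤ (c + d) * u :=
      mul_le_mul_of_nonneg_right ((inv_mul_le_iff₀ hv).2 (by linarith)) hu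
    have hduv : d * u ≤ d * v := mul_le_mul_of_nonneg_left huv hd
    rw [abs_le]
    constructor <;> linarith

section Factor

variable {A : Type*} [NonUnitalCStarAlgebra A] [PartialOrder A] [StarOrderedRing A]

theorem PedPos.exists_forall_le {X : Type*} (f : X → PedPos A) (F : Finset X) :
    ∃ a : PedPos A, ∀ x ∈ F, ((f x).1 : A) ≤ a.1 :=
  ⟨⟨⟨∑ x ∈ F, ((f x).1 : A), Finset.sum_nonneg fun x _ => (f x).1.2⟩,
    Submodule.sum_mem _ fun x _ => (f x).2⟩,
    fun _ hx => Finset.single_le_sum (f := fun x => ((f x).1 : A)) (fun y _ => (f y).1.2) hx⟩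

theorem LTC.dist_inv_mul_restrict_mul_restrict_le {σ υ : LTC A} {c d : ℝ≥0} (hcυ : c • υ ≤ σ)
    (hσυ : σ ≤ (c + d) • υ) {b b' : PedPos A} (hb : (b.1 : A) ≤ b'.1) :
    dist ((LTC.restrict A υ b')⁻¹ * LTC.restrict A σ b' * LTC.restrict A υ b)
      (LTC.restrict A σ b) ≤ d * LTC.restrict A υ b' := by
  have hle (x : PedPos A) : (c : ℝ) * LTC.restrict A υ x ≤ LTC.restrict A σ x ∧
      (LTC.restrict A σ x : ℝ) ≤ (c + d) * LTC.restrict A υ x := by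
    have hcx := LTC.le_iff.1 hcυ x
    have hxc := LTC.le_iff.1 hσυ x
    rw [map_smul, Pi.smul_apply, smul_eq_mul] at hcx hxc
    exact ⟨mod_cast hcx, mod_cast hxc⟩
  rw [NNReal.dist_eq]
  push_cast
  exact abs_inv_mul_mul_sub_le (NNReal.coe_nonneg _)
    (NNReal.coe_le_coe.2 (υ.isPedTrace_restrict.mono hb)) d.coe_nonneg (hle b).1 (hle b).2
    (hle b').1 (hle b').2

theorem LTC.isClosedEmbedding_restrict : IsClosedEmbedding (LTC.restrict A) :=
  ⟨⟨⟨rfl⟩, LTC.restrict_injective A⟩, LTC.isClosed_range_restrict A⟩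

end Factor

variable {A₁ A₂ C : Type*}
  [NonUnitalCStarAlgebra A₁] [PartialOrder A₁] [StarOrderedRing A₁]
  [NonUnitalCStarAlgebra A₂] [PartialOrder A₂] [StarOrderedRing A₂]
  [NonUnitalCStarAlgebra C] [PartialOrder C] [StarOrderedRing C]
  {β : CStarNorm A₁ A₂} {ι : A₁ ⊗[ℂ] A₂ →⋆ₙₐ[ℂ] C}

theorem exists_mem_algTensor_restrict_tmul (hι : IsTensorCompletion β ι) {φ : PedPos A₁ → ℝ≥0}
    (hφ : IsPedTrace φ) (υ : LTC A₂) :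
    ∃ σ : LTC C, tensorValues ι σ ∈ algTensor A₁ A₂ ∧
      ∀ a b, LTC.restrict C σ (PedPos.tmul ι a b) = φ a * LTC.restrict A₂ υ b := by
  obtain ⟨τ, rfl⟩ := hφ.exists_restrict_eq
  obtain ⟨σ, hσ⟩ := exists_prod_ltc hι τ υ
  refine ⟨σ, Submodule.subset_span ⟨τ, υ, fun a b => hσ a.1 b.1⟩, fun a b => ?_⟩
  rw [← ENNReal.coe_inj, ENNReal.coe_mul, LTC.coe_restrict, LTC.coe_restrict, LTC.coe_restrict]
  exact hσ a.1 b.1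

-- Along each part of a Freudenthal partition the slices `τ (a ⊗ ·)` with `a ≤ a'` are nearly
-- proportional to `υ = τ (a' ⊗ ·)`, so `τ` is nearly a product there; the coefficient of `υ` is
-- read off at the upper bound `b'`.
theorem exists_mem_algTensor_dist_le (hι : IsTensorCompletion β ι) (τ : LTC C)
    (F : Finset (PedPos A₁ × PedPos A₂)) {ε : ℝ} (hε : 0 < ε) :
    ∃ σ : LTC C, tensorValues ι σ ∈ algTensor A₁ A₂ ∧ ∀ p ∈ F,
      dist (LTC.restrict C σ (PedPos.tmul ι p.1 p.2))
        (LTC.restrict C τ (PedPos.tmul ι p.1 p.2)) ≤ ε := by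
  obtain ⟨a', ha'⟩ := PedPos.exists_forall_le Prod.fst F
  obtain ⟨b', hb'⟩ := PedPos.exists_forall_le Prod.snd F
  obtain ⟨N, hN⟩ := exists_nat_gt ((LTC.restrict C τ (PedPos.tmul ι a' b') : ℝ) / ε)
  have hN0 : (0 : ℝ) < N := lt_of_le_of_lt (by positivity) hN
  have hΦ := τ.isPedTrace_slice ι
  set Φ : PedPos A₁ → LTC A₂ := τ.slice ι
  have hΦ_mono {a : PedPos A₁} (ha : (a.1 : A₁) ≤ a'.1) : Φ a ≤ Φ a' := by
    obtain ⟨c, rfl⟩ := PedPos.exists_add_of_le ha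
    rw [hΦ.add]
    exact le_self_add
  obtain ⟨J, _, Q, hQ, hQΦ⟩ := exists_partition_smul_le_and_le_smul
    (F.finite_toSet.image fun p => Φ p.1) (u := Φ a')
    (Set.forall_mem_image.2 fun p hp => hΦ_mono (ha' p hp)) (Nat.cast_pos.1 hN0)
  let υ (j : J) : LTC A₂ := Q j (Φ a')
  choose σ hσ hσ_tmul using fun j => exists_mem_algTensor_restrict_tmul hι
    (hΦ.comp ((LTC.restrict A₂ (υ j) b')⁻¹ •
      (LinearMap.proj b' ∘ₗ LTC.restrict A₂ ∘ₗ Q j))) (υ j)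
  have hsum (a : PedPos A₁) (b : PedPos A₂) : LTC.restrict C τ (PedPos.tmul ι a b) =
      ∑ j, LTC.restrict A₂ (Q j (Φ a)) b := by
    rw [← LTC.restrict_slice, ← Finset.sum_apply, ← map_sum, hQ]
  have hdist {p} (hp : p ∈ F) (j : J) : dist (LTC.restrict C (σ j) (PedPos.tmul ι p.1 p.2))
      (LTC.restrict A₂ (Q j (Φ p.1)) p.2) ≤ (N : ℝ≥0)⁻¹ * (LTC.restrict A₂ (υ j) b' : ℝ) := by
    obtain ⟨c, hc, hc'⟩ := hQΦ j _ (Set.mem_image_of_mem _ hp)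
    rw [hσ_tmul]
    exact_mod_cast LTC.dist_inv_mul_restrict_mul_restrict_le hc hc' (hb' p hp)
  refine ⟨∑ j, σ j, by rw [map_sum]; exact Submodule.sum_mem _ fun j _ => hσ j, fun p hp => ?_⟩
  rw [hsum, map_sum, Finset.sum_apply, NNReal.dist_eq, NNReal.coe_sum, NNReal.coe_sum,
    ← Real.dist_eq]
  calc _ ≤ ∑ j, ((N : ℝ≥0)⁻¹ : ℝ) * (LTC.restrict A₂ (υ j) b' : ℝ) :=
        dist_sum_sum_le_of_le _ fun j _ => hdist hp j
    _ = (N : ℝ)⁻¹ * LTC.restrict C τ (PedPos.tmul ι a' b') := by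
        rw [← Finset.mul_sum, hsum, NNReal.coe_sum, NNReal.coe_natCast]
    _ ≤ ε := (inv_mul_le_iff₀ hN0).2 ((div_lt_iff₀ hε).1 hN).le

theorem dense_comap_tensorValues (hι : IsTensorCompletion β ι) :
    Dense ((algTensor A₁ A₂).comap (tensorValues ι) : Set (LTC C)) := by
  intro τ
  rw [hι.isInducing_restrict_tmul.closure_eq_preimage_closure_image]
  refine mem_closure_pi_of_forall_finset fun F ε hε => ?_
  obtain ⟨σ, hσ, hστ⟩ := exists_mem_algTensor_dist_le hι τ F hε
  exact ⟨_, ⟨σ, hσ, rfl⟩, hστ⟩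

theorem tensorCone_eq_range (hι : IsTensorCompletion β ι) :
    tensorCone ι = LinearMap.range (LTC.restrict C) := by
  refine SetLike.coe_injective ?_
  rw [tensorCone, Submodule.topologicalClosure_coe, Submodule.map_coe,
    LTC.isClosedEmbedding_restrict.closure_image_eq, (dense_comap_tensorValues hι).closure_eq,
    Set.image_univ, LinearMap.coe_range]

/-- The extension `𝒯` of the functionals in `LTC(A₁) ⊗_β LTC(A₂)` to traces on `C`, as a linear
map. -/
def tensorConeLinearEquiv (hι : IsTensorCompletion β ι) : tensorCone ι ≃ₗ[ℝ≥0] LTC C :=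
  (LinearEquiv.ofEq _ _ (tensorCone_eq_range hι)).trans
    (LinearEquiv.ofInjective (LTC.restrict C) (LTC.restrict_injective C)).symm

theorem restrict_tensorConeLinearEquiv (hι : IsTensorCompletion β ι) (φ : tensorCone ι) :
    LTC.restrict C (tensorConeLinearEquiv hι φ) = φ :=
  congrArg Subtype.val ((LinearEquiv.ofInjective (LTC.restrict C)
    (LTC.restrict_injective C)).apply_symm_apply (LinearEquiv.ofEq _ _ (tensorCone_eq_range hι) φ))

/-- The homeomorphism `𝒯` from `LTC(A₁) ⊗_β LTC(A₂)` onto `LTC(C)`. -/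
def tensorConeEquiv (hι : IsTensorCompletion β ι) : tensorCone ι ≃L[ℝ≥0] LTC C where
  toLinearEquiv := tensorConeLinearEquiv hι
  continuous_toFun := continuous_induced_rng.2 <| continuous_subtype_val.congr fun φ =>
    (restrict_tensorConeLinearEquiv hι φ).symm
  continuous_invFun := (LTC.isClosedEmbedding_restrict.continuous.subtype_mk fun τ =>
    (tensorCone_eq_range hι).ge ⟨τ, rfl⟩)

theorem existsUnique_tensorValues_eq (hι : IsTensorCompletion β ι)
    {f : PedPos A₁ × PedPos A₂ → ℝ≥0∞} (hf : f ∈ algTensor A₁ A₂) :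
    ∃! τ : LTC C, tensorValues ι τ = f := by
  have hle : algTensor A₁ A₂ ≤ LinearMap.range (tensorValues ι) := by
    refine Submodule.span_le.2 ?_
    rintro f ⟨τ₁, τ₂, h⟩
    obtain ⟨τ, hτ⟩ := exists_prod_ltc hι τ₁ τ₂
    exact ⟨τ, funext fun p => (hτ p.1.1 p.2.1).trans (h p.1 p.2).symm⟩
  obtain ⟨τ, rfl⟩ := hle hf
  exact ⟨τ, rfl, fun σ hσ => hι.ltc_ext fun a b => congrArg ENNReal.toNNReal (congrFun hσ (a, b))⟩

end Approximation

end TracialCone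

end

theorem mainTheorem2 {A₁ A₂ C : Type*}
    [NonUnitalCStarAlgebra A₁] [PartialOrder A₁] [StarOrderedRing A₁]
    [NonUnitalCStarAlgebra A₂] [PartialOrder A₂] [StarOrderedRing A₂]
    [NonUnitalCStarAlgebra C] [PartialOrder C] [StarOrderedRing C]
    (β : TracialCone.CStarNorm A₁ A₂) (ι : A₁ ⊗[ℂ] A₂ →⋆ₙₐ[ℂ] C)
    (hι : TracialCone.IsTensorCompletion β ι) :
    (∀ f ∈ TracialCone.algTensor A₁ A₂,
        ∃! τ : TracialCone.LTC C, TracialCone.tensorValues ι τ = f) ∧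
      ∃ 𝒯 : TracialCone.tensorCone ι ≃L[ℝ≥0] TracialCone.LTC C,
        ∀ φ : TracialCone.tensorCone ι, TracialCone.LTC.restrict C (𝒯 φ) = φ :=
  ⟨fun _ hf => TracialCone.existsUnique_tensorValues_eq hι hf,
    TracialCone.tensorConeEquiv hι, TracialCone.restrict_tensorConeLinearEquiv hι⟩
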